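/- \textbf{Setting.} Let $\mathcal R\subset\mathbb Z^d$ be finite and nonempty, let $\mathcal G$ be the additive subgroup of $\mathbb Z^d$ generated by $\mathcal R$, and let $\mathcal U\subset\mathbb R^d$ be the convex hull of $\mathcal R$. Under $P$ (expectation $E$), $X_n=Z_1+\dots+Z_n$ ($X_0=0$) is the random walk whose steps $Z_i$ are i.i.d. and uniform on $\mathcal R$. Let $(\Omega,\mathfrak S,\mathbb P)$ be a probability space with measurable $\mathbb P$-preserving maps $T_x:\Omega\to\Omega$, $x\in\mathcal G$, such that $T_0=\mathrm{id}$ and $T_{x+y}=T_xT_y$, and assume that $\mathbb P$ is ergodic: $\mathbb P(A)\in\{0,1\}$ for every event $A$ with $T_z^{-1}A=A$ for all $z\in\mathcal R$. Let $\ell\ge0$ be an integer and $g:\Omega\times\mathcal R^\ell\to\mathbb R$ measurable. We say $g\in\mathcal L$ if for every $\tilde z\in\mathcal R^\ell$, $g(\cdot,\tilde z)\in L^1(\mathbb P)$ and for every nonzero $z\in\mathcal R$, $$\varlimsup_{\varepsilon\searrow0}\varlimsup_{n\to\infty}\max_{x\in\mathcal G:|x|\le n}\frac1n\sum_{0\le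 k\le\varepsilon n}|g(T_{x+kz}\omega,\tilde z)|=0\quad\text{for }\mathbb P\text{-a.e. }\omega.$$ Put $H_n^\omega=\sum_{k=0}^{n-1}g(T_{X_k}\omega,(Z_{k+1},\dots,Z_{k+\ell}))$, $Z_n^{g,\omega}=E[e^{H_n^\omega}]$ and $Q_n^{g,\omega}(A)=E[e^{H_n^\omega}\mathbf 1_A]/Z_n^{g,\omega}$. For each $\zeta\in\mathcal U$ fix weights $\beta_z(\zeta)\ge0$ with $\sum_{z\in\mathcal R}\beta_z(\zeta)=1$ and $\sum_{z\in\mathcal R}\beta_z(\zeta)z=\zeta$, rational if $\zeta\in\mathbb Q^d$, and for each integer $n\ge0$ numbers $b_z^{(n)}(\zeta)\in\{0,1\}$ with $b_z^{(n)}(\zeta)=0$ whenever $\beta_z(\zeta)=0$ and $\sum_z b_z^{(n)}(\zeta)=n-\sum_z\lfloor n\beta_z(\zeta)\rfloor$; let $\hat x_n(\zeta)=\sum_{z}(\lfloor n\beta_z(\zeta)\rfloor+b_z^{(n)}(\zeta))z$. Define $$\Lambda_\ell(g;\omega)=\lim_{n\to\infty}\tfrac1n\log Z_n^{g,\omega},\qquad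 \Lambda_\ell(g,\zeta;\omega)=\lim_{n\to\infty}\tfrac1n\log E\bigl[e^{H_n^\omega}\mathbf 1\{X_n=\hat x_n(\zeta)\}\bigr]\ \ (\zeta\in\mathcal U),$$ both read as upper limits until the limits are known to exist, and $\Lambda_\ell(g,\zeta;\omega)=-\infty$ for $\zeta\notin\mathcal U$. Let $\Lambda_\ell^{\rm usc}(g,\zeta;\omega)=\inf_{B\ni\zeta\text{ open}}\sup_{\xi\in B}\Lambda_\ell(g,\xi;\omega)$ be the upper semicontinuous regularization in $\zeta\in\mathbb R^d$. \textbf{Theorem.} Assume $g\in\mathcal L$ and that $\Lambda_\ell(g;\omega)$ is finite for $\mathbb P$-a.e. $\omega$. Then there are a nonrandom $\Lambda_\ell(g)\in\mathbb R$ and a nonrandom function $I^g:\mathbb R^d\to[0,\infty]$ such that for $\mathbb P$-a.e. $\omega$ the limits defining $\Lambda_\ell(g;\omega)$ and, simultaneously for all $\zeta\in\mathcal U$, $\Lambda_\ell(g,\zeta;\omega)$ exist, $\Lambda_\ell(g;\omega)=\Lambda_\ell(g)$, $$I^g(\zeta)=\Lambda_\ell(g)-\Lambda_\ell^{\rm usc}(g,\zeta;\omega)\qquad\text{for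 all }\zeta\in\mathbb R^d,$$ and the distributions $Q_n^{g,\omega}\{X_n/n\in\cdot\,\}$ on $\mathbb R^d$ satisfy a large deviation principle with the lower semicontinuous rate function $I^g$: $$\varlimsup_{n\to\infty}\tfrac1n\log Q_n^{g,\omega}\{X_n/n\in A\}\le-\inf_{\zeta\in A}I^g(\zeta)\ \text{ for all closed }A\subset\mathbb R^d,$$ $$\varliminf_{n\to\infty}\tfrac1n\log Q_n^{g,\omega}\{X_n/n\in O\}\ge-\inf_{\zeta\in O}I^g(\zeta)\ \text{ for all open }O\subset\mathbb R^d.$$ Moreover, $I^g$ is convex on $\mathbb R^d$, and on $\mathcal U$ it is finite and continuous. -/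

import Mathlib

open MeasureTheory ProbabilityTheory Filter Topology Set
open scoped ENNReal

noncomputable section

namespace RWRP

/-- The inclusion of the lattice `ℤ^d` in Euclidean space `ℝ^d`. -/
def toEuclid {d : ℕ} (x : Fin d → ℤ) : EuclideanSpace ℝ (Fin d) :=
  WithLp.toLp 2 (fun i => (x i : ℝ))

/-- The additive subgroup of `ℤ^d` generated by the finite set `R` of admissible steps. -/
abbrev LatticeGroup {d : ℕ} (R : Finset (Fin d → ℤ)) : AddSubgroup (Fin d → ℤ) :=
  AddSubgroup.closure (R : Set (Fin d → ℤ))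

/-- An admissible step as an element of the generated group. -/
def step {d : ℕ} {R : Finset (Fin d → ℤ)} (z : R) : LatticeGroup R :=
  ⟨z.1, AddSubgroup.subset_closure z.2⟩

/-- The convex hull in `ℝ^d` of the set of admissible steps. -/
def velocitySet {d : ℕ} (R : Finset (Fin d → ℤ)) : Set (EuclideanSpace ℝ (Fin d)) :=
  convexHull ℝ (toEuclid '' (R : Set (Fin d → ℤ)))

/-- `(Ω, P, T)` is a measurable ergodic dynamical system: `T` is an action of the group
generated by `R` by measurable `P`-preserving maps, and every event that is invariant under all
`T_z`, `z ∈ R`, has probability `0` or `1`. -/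
structure IsErgodicSystem {d : ℕ} (R : Finset (Fin d → ℤ)) {Ω : Type*} [MeasurableSpace Ω]
    (P : Measure Ω) (T : LatticeGroup R → Ω → Ω) : Prop where
  map_zero : T 0 = id
  map_add : ∀ x y, T (x + y) = T x ∘ T y
  measurePreserving : ∀ x, MeasurePreserving (T x) P P
  ergodic : ∀ A : Set Ω, MeasurableSet A → (∀ z : R, T (step z) ⁻¹' A = A) → P A = 0 ∨ P A = 1

/-- The class of potentials: `g(·, z̃)` is integrable for every `z̃ ∈ R^ℓ`, and for every nonzero
step `z`, almost surely,
`limsup_{ε ↘ 0} limsup_{n → ∞} max_{|x| ≤ n} n⁻¹ ∑_{0 ≤ k ≤ ε n} |g(T_{x + k z} ω, z̃)| = 0`. -/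
def InClassL {d : ℕ} {R : Finset (Fin d → ℤ)} {Ω : Type*} [MeasurableSpace Ω]
    (P : Measure Ω) (T : LatticeGroup R → Ω → Ω) {ℓ : ℕ} (g : Ω × (Fin ℓ → R) → ℝ) : Prop :=
  ∀ zt : Fin ℓ → R,
    Integrable (fun ω => g (ω, zt)) P ∧
    ∀ z : R, z.1 ≠ 0 → ∀ᵐ ω ∂P,
      limsup (fun ε : ℝ =>
        limsup (fun n : ℕ =>
          ⨆ x : LatticeGroup R, ⨆ _ : ‖toEuclid x.1‖ ≤ (n : ℝ),
            (n : ℝ≥0∞)⁻¹ * ∑ k ∈ Finset.range (⌊ε * n⌋₊ + 1),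
              ENNReal.ofReal |g (T (x + k • step z) ω, zt)|) atTop) (𝓝[>] 0) = 0

/-- The law of the random walk, as a law on step sequences: the steps are i.i.d. and uniform
on `R`. The coordinate `s i` is the `(i+1)`-st step `Z_{i+1}`. -/
def walkLaw {d : ℕ} (R : Finset (Fin d → ℤ)) : Measure (ℕ → R) :=
  Measure.infinitePi (fun _ : ℕ => uniformOn (Set.univ : Set R))

/-- The position `X_n = Z_1 + ⋯ + Z_n` of the walk after `n` steps. -/
def position {d : ℕ} {R : Finset (Fin d → ℤ)} (n : ℕ) (s : ℕ → R) : LatticeGroup R :=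
  ∑ i ∈ Finset.range n, step (s i)

/-- The energy `∑_{k=0}^{n-1} g(T_{X_k} ω, (Z_{k+1}, …, Z_{k+ℓ}))` of a path. -/
def energy {d : ℕ} {R : Finset (Fin d → ℤ)} {Ω : Type*} (T : LatticeGroup R → Ω → Ω) {ℓ : ℕ}
    (g : Ω × (Fin ℓ → R) → ℝ) (ω : Ω) (n : ℕ) (s : ℕ → R) : ℝ :=
  ∑ k ∈ Finset.range n, g (T (position k s) ω, fun i : Fin ℓ => s (k + i))

/-- The Boltzmann-Gibbs weight `exp` of the energy. -/
def weight {d : ℕ} {R : Finset (Fin d → ℤ)} {Ω : Type*} (T : LatticeGroup R → Ω → Ω) {ℓ : ℕ}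
    (g : Ω × (Fin ℓ → R) → ℝ) (ω : Ω) (n : ℕ) (s : ℕ → R) : ℝ≥0∞ :=
  ENNReal.ofReal (Real.exp (energy T g ω n s))

/-- The quenched partition function `Z_n^{g,ω}`. -/
def partitionFunction {d : ℕ} {R : Finset (Fin d → ℤ)} {Ω : Type*} (T : LatticeGroup R → Ω → Ω)
    {ℓ : ℕ} (g : Ω × (Fin ℓ → R) → ℝ) (ω : Ω) (n : ℕ) : ℝ≥0∞ :=
  ∫⁻ s, weight T g ω n s ∂(walkLaw R)

/-- The point-to-point partition function `E[exp(∑ g) 1{X_n = x}]`. -/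
def pointPartitionFunction {d : ℕ} {R : Finset (Fin d → ℤ)} {Ω : Type*}
    (T : LatticeGroup R → Ω → Ω) {ℓ : ℕ} (g : Ω × (Fin ℓ → R) → ℝ) (ω : Ω) (n : ℕ)
    (x : Fin d → ℤ) : ℝ≥0∞ :=
  ∫⁻ s in {s | (position n s : Fin d → ℤ) = x}, weight T g ω n s ∂(walkLaw R)

/-- The quenched polymer measure `Q_n^{g,ω}`, on step sequences. -/
def polymerMeasure {d : ℕ} {R : Finset (Fin d → ℤ)} {Ω : Type*} (T : LatticeGroup R → Ω → Ω)
    {ℓ : ℕ} (g : Ω × (Fin ℓ → R) → ℝ) (ω : Ω) (n : ℕ) : Measure (ℕ → R) :=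
  (partitionFunction T g ω n)⁻¹ • (walkLaw R).withDensity (weight T g ω n)

/-- The distribution `Q_n^{g,ω}{X_n / n ∈ ·}` on `ℝ^d`. -/
def endpointLaw {d : ℕ} {R : Finset (Fin d → ℤ)} {Ω : Type*} (T : LatticeGroup R → Ω → Ω)
    {ℓ : ℕ} (g : Ω × (Fin ℓ → R) → ℝ) (ω : Ω) (n : ℕ) : Measure (EuclideanSpace ℝ (Fin d)) :=
  (polymerMeasure T g ω n).map (fun s => (n : ℝ)⁻¹ • toEuclid (position n s).1)

/-- The exponential rate `n⁻¹ log a`, with `log 0 = -∞` and `log ∞ = ∞`. -/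
def logRate (n : ℕ) (a : ℝ≥0∞) : EReal :=
  (((n : ℝ)⁻¹ : ℝ) : EReal) * ENNReal.log a

/-- A choice, for each velocity `ζ`, of convex weights `β_z(ζ)` with `ζ = ∑ β_z(ζ) z`
(rational weights at rational `ζ`), together with admissible roundings `b_z^{(n)}(ζ) ∈ {0,1}`. -/
structure IsVelocityChoice {d : ℕ} (R : Finset (Fin d → ℤ))
    (β : EuclideanSpace ℝ (Fin d) → R → ℝ) (b : ℕ → EuclideanSpace ℝ (Fin d) → R → ℕ) : Prop where
  nonneg : ∀ ζ ∈ velocitySet R, ∀ z, 0 ≤ β ζ z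
  sum_eq_one : ∀ ζ ∈ velocitySet R, ∑ z, β ζ z = 1
  mean_eq : ∀ ζ ∈ velocitySet R, ∑ z, β ζ z • toEuclid z.1 = ζ
  rational : ∀ ζ ∈ velocitySet R, (∀ i, ∃ q : ℚ, ζ i = (q : ℝ)) →
    ∀ z, ∃ q : ℚ, β ζ z = (q : ℝ)
  round_le_one : ∀ n, ∀ ζ ∈ velocitySet R, ∀ z, b n ζ z ≤ 1
  round_eq_zero : ∀ n, ∀ ζ ∈ velocitySet R, ∀ z, β ζ z = 0 → b n ζ z = 0
  sum_round : ∀ n : ℕ, ∀ ζ ∈ velocitySet R, ∑ z, b n ζ z + ∑ z, ⌊(n : ℝ) * β ζ z⌋₊ = n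

/-- The lattice point `x̂_n(ζ) = ∑_z (⌊n β_z(ζ)⌋ + b_z^{(n)}(ζ)) z`. -/
def latticePoint {d : ℕ} {R : Finset (Fin d → ℤ)} (β : EuclideanSpace ℝ (Fin d) → R → ℝ)
    (b : ℕ → EuclideanSpace ℝ (Fin d) → R → ℕ) (n : ℕ) (ζ : EuclideanSpace ℝ (Fin d)) :
    Fin d → ℤ :=
  ∑ z : R, (⌊(n : ℝ) * β ζ z⌋₊ + b n ζ z) • z.1

/-- The free energy `Λ_ℓ(g; ω) = lim n⁻¹ log Z_n^{g,ω}` (as an upper limit, so that it is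
always defined). -/
def freeEnergy {d : ℕ} {R : Finset (Fin d → ℤ)} {Ω : Type*} (T : LatticeGroup R → Ω → Ω)
    {ℓ : ℕ} (g : Ω × (Fin ℓ → R) → ℝ) (ω : Ω) : EReal :=
  limsup (fun n : ℕ => logRate n (partitionFunction T g ω n)) atTop

open Classical in
/-- The point-to-point free energy
`Λ_ℓ(g, ζ; ω) = lim n⁻¹ log E[exp(∑ g) 1{X_n = x̂_n(ζ)}]` for `ζ` in the convex hull of the steps
(as an upper limit, so that it is always defined), and `-∞` for all other `ζ`. -/
def pointFreeEnergy {d : ℕ} {R : Finset (Fin d → ℤ)} {Ω : Type*} (T : LatticeGroup R → Ω → Ω)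
    {ℓ : ℕ} (g : Ω × (Fin ℓ → R) → ℝ) (β : EuclideanSpace ℝ (Fin d) → R → ℝ)
    (b : ℕ → EuclideanSpace ℝ (Fin d) → R → ℕ) (ω : Ω) (ζ : EuclideanSpace ℝ (Fin d)) : EReal :=
  if ζ ∈ velocitySet R then
    limsup (fun n : ℕ => logRate n (pointPartitionFunction T g ω n (latticePoint β b n ζ))) atTop
  else ⊥

/-- The upper semicontinuous regularization
`f^usc(x) = inf_{open B ∋ x} sup_{y ∈ B} f(y)`. -/
def uscReg {E : Type*} [TopologicalSpace E] (f : E → EReal) (x : E) : EReal :=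
  ⨅ B : Set E, ⨅ _ : IsOpen B, ⨅ _ : x ∈ B, ⨆ y ∈ B, f y

/-- Convexity of an extended real valued function that does not take the value `-∞`. -/
def IsConvexFun {E : Type*} [AddCommGroup E] [Module ℝ E] (f : E → EReal) : Prop :=
  ∀ x y : E, ∀ a b : ℝ, 0 ≤ a → 0 ≤ b → a + b = 1 →
    f (a • x + b • y) ≤ (a : EReal) * f x + (b : EReal) * f y

/-- The large deviation principle at speed `n` with rate function `I`: `I` is a lower
semicontinuous function with values in `[0, ∞]`, and the upper bound for closed sets and the lower
bound for open sets hold. -/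
structure SatisfiesLDP {E : Type*} [TopologicalSpace E] [MeasurableSpace E]
    (μ : ℕ → Measure E) (I : E → EReal) : Prop where
  nonneg : ∀ x, 0 ≤ I x
  lowerSemicontinuous : LowerSemicontinuous I
  upper : ∀ A : Set E, IsClosed A →
    limsup (fun n : ℕ => logRate n (μ n A)) atTop ≤ -⨅ x ∈ A, I x
  lower : ∀ O : Set E, IsOpen O →
    -⨅ x ∈ O, I x ≤ liminf (fun n : ℕ => logRate n (μ n O)) atTop

end RWRP

end

/-!
Paths of the walk are recorded by their step counts `m : R → ℕ`, where `m z` is the number of uses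
of the step `z`. The number of steps and the endpoint are functions of `m`, and the logarithm of
the point-to-point partition function becomes a random field `a m ω`, superadditive along the
action of the group: `a m ω + a m' (T_x ω) ≤ a (m + m') ω`, with `x` the displacement of `m`. Two
points need care. The energy of a path looks `ℓ` steps beyond its end; replacing the terms that do
so by lower bounds restores superadditivity (`lowerEnergy`, `pathWeight`, `logWeight`), at a cost
that is exponentially negligible by the assumption on the potential
(`eventually_lintegral_weight_le`). And this assumption, in the form `SublinearOnLines`, says that
`o(n)` additional steps, at distance `O(n)` from the origin, lower the field by at
most `o(n)` (`IsSuperadditiveField.exists_le_of_le`).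

*Growth along one count vector.* Kingman's theorem (`kingman_real`) applies to `n ↦ a (n • k)`, for
the map `T_x` with `x` the displacement of `k`. This map need not be ergodic. If, however, `k` uses
every step, then a path along `k` may begin with any given step, so the limit is invariant under
all `T_z`, and hence is a constant `growthRate P a k` (`IsSuperadditiveField.measure_growthLE`,
`IsSuperadditiveField.ae_tendsto_growthRate`). The upper bound on the means that Kingman's theorem
asks for is not assumed. It follows from the finiteness of the free energy: by the same zero-one
law the growth is almost surely bounded by a deterministic constant, and then so are the means
(`integral_le_of_eventually_le`).

*All velocities at once.* There are countably many `k`, so that almost every `ω` is regular for all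
of them (`IsRegularAt`). At such `ω` everything else is a deterministic argument. Counts that
follow a fixed direction `β` lie between two multiples of an earlier one with the same support, by
factors close to one another; the comparison principle makes their rates a Cauchy sequence
(`IsRegularAt.exists_tendsto_of_direction`), which gives the point-to-point limits for all `ζ`.
Rounding an arbitrary count vector `m` up to a multiple of one of finitely many vectors `k` that
use every step bounds `a m` by the rate of `k`, uniformly in `m`
(`IsRegularAt.exists_rate_ge`). At the velocities of such `k`, which are rational, the choice of
the weights is immaterial, and the point-to-point limit is the nonrandom rate of `k`
(`IsRegularAt.tendsto_roundedCounts_velocity`). Hence the upper semicontinuous regularization of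
the random point-to-point free energy is that of the nonrandom function `interiorRate`
(`IsRegularAt.uscReg_pointFreeEnergy`).

*The large deviation principle.* A walk of `n` steps has polynomially many possible endpoints, so
that the weight of a closed set of velocities is governed by the largest point-to-point weight in
it, and compactness of the convex hull of the steps gives the upper bound
(`IsRegularAt.limsup_logRate_endpointWeight_le`). The lower bound retains a single endpoint
(`IsRegularAt.iSup_le_liminf_logRate_endpointWeight`). With the whole space in the place of the set
these bounds yield the limit `Λ` of the free energy, as the supremum of the regularized rate `F`,
and the rate function is `Λ - F`. Superadditivity of the growth rates makes `F` concave. A concave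
function bounded below on a polytope is lower semicontinuous there, since every point of the
polytope close to `x` is a convex combination of `x`, with weight close to one, and of a further
point of the polytope (`exists_delta_convex_combination`); so `F` is continuous on the convex hull
of the steps, up to the boundary (`IsConcaveOn.continuousOn_sub`).
-/

noncomputable section

namespace RWRP

/-! ### The subadditive ergodic theorem for nonnegative superadditive processes -/

section Kingman

variable {Ω : Type*} {S : Ω → Ω}

lemma eventually_mul_div_le {θ : ℝ≥0∞} (hθ : θ < 1) :
    ∀ᶠ n : ℕ in atTop, ∀ x : ℝ≥0∞, θ * (x / n) ≤ x / ((n + 1 : ℕ) : ℝ≥0∞) := by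
  lift θ to NNReal using hθ.ne_top
  have hθ' : (θ : ℝ) < 1 := by exact_mod_cast hθ
  obtain ⟨n₀, hn₀⟩ := exists_nat_gt ((θ : ℝ) / (1 - θ))
  filter_upwards [eventually_ge_atTop (max n₀ 1)] with n hn x
  have hn1 : 1 ≤ n := le_trans (le_max_right _ _) hn
  have hn2 : (n₀ : ℝ) ≤ n := by exact_mod_cast le_trans (le_max_left _ _) hn
  have key : (θ : ℝ) * (n + 1) ≤ n := by
    have h1 : 0 < 1 - (θ : ℝ) := by linarith
    rw [div_lt_iff₀ h1] at hn₀
    nlinarith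
  have key' : (θ : ℝ≥0∞) * ((n + 1 : ℕ) : ℝ≥0∞) ≤ n := by
    have : θ * ((n + 1 : ℕ) : NNReal) ≤ (n : NNReal) := by
      rw [← NNReal.coe_le_coe]; push_cast; exact key
    exact_mod_cast this
  have hn0 : (n : ℝ≥0∞) ≠ 0 := by simp; omega
  rw [ENNReal.le_div_iff_mul_le (by simp) (by simp)]
  calc (θ : ℝ≥0∞) * (x / n) * ((n + 1 : ℕ) : ℝ≥0∞)
      = (x / n) * (θ * ((n + 1 : ℕ) : ℝ≥0∞)) := by ring
    _ ≤ (x / n) * n := by gcongr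
    _ = x := ENNReal.div_mul_cancel hn0 (by simp)

/-- The greedy covering bound: an orbit segment is cut into blocks on which the process is at
least the length of the block times `h`, and single steps elsewhere. -/
lemma sum_indicator_le_of_cover {a : ℕ → Ω → ℝ≥0∞}
    (hsup : ∀ m n ω, a m ω + a n (S^[m] ω) ≤ a (m + n) ω)
    {h : Ω → ℝ≥0∞} (hh : ∀ ω, h (S ω) ≤ h ω) {A : Set Ω} {N : ℕ}
    (hA : ∀ ω ∈ A, ∃ l, 1 ≤ l ∧ l ≤ N ∧ l * h ω ≤ a l ω) (n : ℕ) (ω : Ω) :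
    ∑ k ∈ Finset.range (n - N), A.indicator h (S^[k] ω) ≤ a n ω := by
  have hit : ∀ k ω, h (S^[k] ω) ≤ h ω := by
    intro k
    induction k with
    | zero => intro ω; simp
    | succ k ih => intro ω; rw [Function.iterate_succ_apply]; exact (ih _).trans (hh ω)
  induction n using Nat.strong_induction_on generalizing ω with
  | _ n ih =>
    rcases le_or_gt n N with hn | hn
    · simp [Nat.sub_eq_zero_of_le hn]
    obtain ⟨l, hl1, hln, hl⟩ : ∃ l, 1 ≤ l ∧ l ≤ n ∧
        ∑ k ∈ Finset.range l, A.indicator h (S^[k] ω) ≤ a l ω := by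
      by_cases hω : ω ∈ A
      · obtain ⟨l, hl1, hlN, hl⟩ := hA ω hω
        refine ⟨l, hl1, by omega, le_trans ?_ hl⟩
        calc ∑ k ∈ Finset.range l, A.indicator h (S^[k] ω)
            ≤ ∑ k ∈ Finset.range l, h ω :=
              Finset.sum_le_sum fun k _ => (indicator_le_self' (by simp) _).trans (hit k ω)
          _ = l * h ω := by simp
      · exact ⟨1, le_rfl, by omega, by simp [hω]⟩
    calc ∑ k ∈ Finset.range (n - N), A.indicator h (S^[k] ω)
        ≤ ∑ k ∈ Finset.range (l + (n - l - N)), A.indicator h (S^[k] ω) :=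
          Finset.sum_le_sum_of_subset (Finset.range_mono (by omega))
      _ = ∑ k ∈ Finset.range l, A.indicator h (S^[k] ω) +
          ∑ k ∈ Finset.range (n - l - N), A.indicator h (S^[k] (S^[l] ω)) := by
          rw [Finset.sum_range_add]
          congr 1
          refine Finset.sum_congr rfl fun k _ => ?_
          rw [← Function.iterate_add_apply, add_comm]
      _ ≤ a l ω + a (n - l) (S^[l] ω) := add_le_add hl (ih (n - l) (by omega) _)
      _ ≤ a n ω := by
          have := hsup l (n - l) ω
          rwa [Nat.add_sub_cancel' hln] at this

/-- The upper growth rate of a superadditive process does not increase along the orbit. -/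
lemma limsup_div_comp_le {a : ℕ → Ω → ℝ≥0∞}
    (hsup : ∀ m n ω, a m ω + a n (S^[m] ω) ≤ a (m + n) ω) (ω : Ω) :
    limsup (fun n : ℕ => a n (S ω) / n) atTop ≤ limsup (fun n : ℕ => a n ω / n) atTop := by
  refine ENNReal.le_of_forall_lt_one_mul_le fun θ hθ => ?_
  rw [← ENNReal.limsup_const_mul_of_ne_top hθ.ne_top,
    ← limsup_nat_add (fun n : ℕ => a n ω / n) 1]
  refine limsup_le_limsup ?_
  filter_upwards [eventually_mul_div_le hθ] with n hn
  refine (hn _).trans ?_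
  gcongr
  have := hsup 1 n ω
  rw [add_comm 1 n] at this
  exact le_trans le_add_self this

lemma sum_iterate_add {φ : Ω → ℝ≥0∞} (m n : ℕ) (ω : Ω) :
    ∑ i ∈ Finset.range m, φ (S^[i] ω) + ∑ i ∈ Finset.range n, φ (S^[i] (S^[m] ω)) =
      ∑ i ∈ Finset.range (m + n), φ (S^[i] ω) := by
  rw [Finset.sum_range_add]
  congr 1
  refine Finset.sum_congr rfl fun k _ => ?_
  rw [← Function.iterate_add_apply, add_comm]

variable [MeasurableSpace Ω] {P : Measure Ω}

/-- The mean of the upper growth rate is at most any linear bound of the means: the process is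
bounded below by the sums of the (truncated) upper growth rate over the part of the orbit that
lies in a large set. -/
lemma lintegral_limsup_div_le [IsProbabilityMeasure P] (hS : MeasurePreserving S P P)
    {a : ℕ → Ω → ℝ≥0∞} (hm : ∀ n, Measurable (a n))
    (hsup : ∀ m n ω, a m ω + a n (S^[m] ω) ≤ a (m + n) ω) {C : ℝ≥0∞}
    (hC : ∀ n, ∫⁻ ω, a n ω ∂P ≤ n * C) :
    ∫⁻ ω, limsup (fun n : ℕ => a n ω / n) atTop ∂P ≤ C := by
  set f : Ω → ℝ≥0∞ := fun ω => limsup (fun n : ℕ => a n ω / n) atTop with hf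
  have hfm : Measurable f := Measurable.limsup fun n => (hm n).div_const _
  refine ENNReal.le_of_forall_lt_one_mul_le fun θ hθ => ?_
  have hfM : ∀ ω, f ω = ⨆ M : ℕ, min (f ω) M := by
    intro ω
    refine le_antisymm ?_ (iSup_le fun M => min_le_left _ _)
    refine ENNReal.le_of_forall_nnreal_lt fun r hr => ?_
    obtain ⟨M, hM⟩ := exists_nat_ge r
    refine le_iSup_of_le M (le_min hr.le (by exact_mod_cast hM))
  have hint : ∫⁻ ω, f ω ∂P = ⨆ M : ℕ, ∫⁻ ω, min (f ω) M ∂P := by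
    rw [← lintegral_iSup (fun M => hfm.min measurable_const)
      (fun M M' h ω => min_le_min_left _ (by exact_mod_cast h))]
    exact lintegral_congr hfM
  rw [hint, ENNReal.mul_iSup]
  refine iSup_le fun M => ?_
  rw [← lintegral_const_mul _ (hfm.min measurable_const)]
  set h : Ω → ℝ≥0∞ := fun ω => θ * min (f ω) M with hhd
  have hhm : Measurable h := (hfm.min measurable_const).const_mul _
  have hh : ∀ ω, h (S ω) ≤ h ω := fun ω => by
    simp only [hhd]; gcongr; exact limsup_div_comp_le hsup ω
  let A : ℕ → Set Ω := fun N => ⋃ l ∈ Finset.Icc 1 N, {ω | l * h ω ≤ a l ω}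
  have hAm : ∀ N, MeasurableSet (A N) := fun N =>
    Finset.measurableSet_biUnion _ fun l _ => measurableSet_le (hhm.const_mul _) (hm l)
  have hAmono : Monotone A := fun N N' hN =>
    biUnion_subset_biUnion_left fun l hl => by
      simp only [Finset.mem_Icc, SetLike.mem_coe] at hl ⊢; exact ⟨hl.1, hl.2.trans hN⟩
  have hAuniv : ∀ ω, ∃ N, ω ∈ A N := by
    intro ω
    obtain ⟨l, hl1, hl⟩ : ∃ l : ℕ, 1 ≤ l ∧ l * h ω ≤ a l ω := by
      by_cases h0 : h ω = 0
      · exact ⟨1, le_rfl, by simp [h0]⟩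
      have hlt : h ω < f ω := by
        have h1 : min (f ω) M ≠ 0 := fun h => h0 (by simp [hhd, h])
        have h2 : min (f ω) M ≠ ∞ := ne_top_of_le_ne_top (by simp) (min_le_right _ _)
        calc h ω < 1 * min (f ω) M := by
              simp only [hhd]; exact (ENNReal.mul_lt_mul_iff_left h1 h2).2 hθ
          _ ≤ f ω := by rw [one_mul]; exact min_le_left _ _
      obtain ⟨l, hl, hl1⟩ := ((frequently_lt_of_lt_limsup (by isBoundedDefault) hlt).and_eventually
        (eventually_ge_atTop 1)).exists
      refine ⟨l, hl1, ?_⟩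
      have := ENNReal.mul_le_of_le_div hl.le
      rwa [mul_comm] at this
    exact ⟨l, mem_biUnion (by simpa using hl1) hl⟩
  have hbound : ∀ N, ∫⁻ ω, (A N).indicator h ω ∂P ≤ C := by
    intro N
    set c := ∫⁻ ω, (A N).indicator h ω ∂P
    have h1 : ∀ n : ℕ, n * c ≤ ((n + N : ℕ) : ℝ≥0∞) * C := by
      intro n
      refine le_trans ?_ (hC (n + N))
      calc n * c = ∑ k ∈ Finset.range n, ∫⁻ ω, (A N).indicator h (S^[k] ω) ∂P := by
            rw [Finset.sum_congr rfl fun k _ =>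
              (hS.iterate k).lintegral_comp (hhm.indicator (hAm N))]
            simp [c]
        _ = ∫⁻ ω, ∑ k ∈ Finset.range n, (A N).indicator h (S^[k] ω) ∂P :=
            (lintegral_finsetSum _ fun k _ =>
              (hhm.indicator (hAm N)).comp (hS.iterate k).measurable).symm
        _ ≤ ∫⁻ ω, a (n + N) ω ∂P := by
            refine lintegral_mono fun ω => ?_
            have := sum_indicator_le_of_cover hsup hh (A := A N) (N := N) (fun ω hω => by
              simp only [A, mem_iUnion, Finset.mem_Icc] at hω
              obtain ⟨l, hl, h⟩ := hω
              exact ⟨l, hl.1, hl.2, h⟩) (n + N) ω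
            rwa [Nat.add_sub_cancel] at this
    by_cases hCtop : C = ∞
    · simp [hCtop]
    have hlim : Tendsto (fun n : ℕ => (((n + N : ℕ) : ℝ≥0∞) / n) * C) atTop (𝓝 (1 * C)) := by
      refine ENNReal.Tendsto.mul_const ?_ (Or.inl one_ne_zero)
      have hR : Tendsto (fun n : ℕ => ((n + N : ℕ) : ℝ) / n) atTop (𝓝 1) := by
        have := (tendsto_const_div_atTop_nhds_zero_nat (N : ℝ)).const_add 1
        rw [add_zero] at this
        refine this.congr' ?_
        filter_upwards [eventually_ge_atTop 1] with n hn
        have : (n : ℝ) ≠ 0 := by positivity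
        push_cast; field_simp
      have := ENNReal.tendsto_ofReal hR
      rw [ENNReal.ofReal_one] at this
      refine this.congr' ?_
      filter_upwards [eventually_ge_atTop 1] with n hn
      rw [ENNReal.ofReal_div_of_pos (by positivity), ENNReal.ofReal_natCast, ENNReal.ofReal_natCast]
    rw [one_mul] at hlim
    refine ge_of_tendsto hlim ?_
    filter_upwards [eventually_ge_atTop 1] with n hn
    have hn0 : (n : ℝ≥0∞) ≠ 0 := by simp; omega
    rw [← ENNReal.mul_div_right_comm, ENNReal.le_div_iff_mul_le (by simp [hn0]) (by simp), mul_comm]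
    exact h1 n
  calc ∫⁻ ω, h ω ∂P = ∫⁻ ω, ⨆ N, (A N).indicator h ω ∂P := by
        refine lintegral_congr fun ω => le_antisymm ?_ (iSup_le fun N => indicator_le_self' (by simp) _)
        obtain ⟨N, hN⟩ := hAuniv ω
        exact le_iSup_of_le N (by rw [indicator_of_mem hN])
    _ = ⨆ N, ∫⁻ ω, (A N).indicator h ω ∂P :=
        lintegral_iSup (fun N => hhm.indicator (hAm N)) fun N N' hN ω =>
          indicator_le_indicator_of_subset (hAmono hN) (by simp) ω
    _ ≤ C := iSup_le hbound

lemma lintegral_sum_comp_iterate (hS : MeasurePreserving S P P) {φ : Ω → ℝ≥0∞}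
    (hφ : Measurable φ) (n : ℕ) :
    ∫⁻ ω, ∑ i ∈ Finset.range n, φ (S^[i] ω) ∂P = n * ∫⁻ ω, φ ω ∂P := by
  rw [lintegral_finsetSum (f := fun i ω => φ (S^[i] ω)) _
    fun k _ => hφ.comp (hS.iterate k).measurable,
    Finset.sum_congr rfl fun k _ => (hS.iterate k).lintegral_comp hφ]
  simp

/-- One half of the pointwise ergodic theorem: the integral is at most that of the lower limit of
the ergodic averages. Bounded functions are treated by complementation. -/
lemma lintegral_le_lintegral_liminf_average [IsProbabilityMeasure P]
    (hS : MeasurePreserving S P P) {φ : Ω → ℝ≥0∞} (hφ : Measurable φ) :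
    ∫⁻ ω, φ ω ∂P ≤
      ∫⁻ ω, liminf (fun n : ℕ => (∑ i ∈ Finset.range n, φ (S^[i] ω)) / n) atTop ∂P := by
  have bdd : ∀ (ψ : Ω → ℝ≥0∞) (M : ℕ), Measurable ψ → (∀ ω, ψ ω ≤ M) → ∫⁻ ω, ψ ω ∂P ≤
      ∫⁻ ω, liminf (fun n : ℕ => (∑ i ∈ Finset.range n, ψ (S^[i] ω)) / n) atTop ∂P := by
    intro ψ M hψ hM
    set L : Ω → ℝ≥0∞ := fun ω =>
      liminf (fun n : ℕ => (∑ i ∈ Finset.range n, ψ (S^[i] ω)) / n) atTop with hL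
    have hLm : Measurable L := Measurable.liminf fun n =>
      (Finset.measurable_sum _ fun k _ => hψ.comp (hS.iterate k).measurable).div_const _
    have hLM : ∀ ω, L ω ≤ M := by
      intro ω
      refine liminf_le_of_le (by isBoundedDefault) fun b hb => ?_
      obtain ⟨n, hn, hn1⟩ := (hb.and (eventually_ge_atTop 1)).exists
      refine hn.trans (ENNReal.div_le_of_le_mul ?_)
      calc ∑ i ∈ Finset.range n, ψ (S^[i] ω) ≤ ∑ i ∈ Finset.range n, (M : ℝ≥0∞) :=
            Finset.sum_le_sum fun i _ => hM _
        _ = M * n := by simp [mul_comm]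
    have hMψ : ∫⁻ ω, (M - ψ ω) ∂P = M - ∫⁻ ω, ψ ω ∂P := by
      have hfin : ∫⁻ ω, ψ ω ∂P ≠ ∞ := ne_top_of_le_ne_top (b := (M : ℝ≥0∞)) (by simp)
        ((lintegral_mono hM).trans (by simp))
      rw [lintegral_sub hψ hfin (Eventually.of_forall hM)]; simp
    have hML : ∫⁻ ω, (M - L ω) ∂P = M - ∫⁻ ω, L ω ∂P := by
      have hfin : ∫⁻ ω, L ω ∂P ≠ ∞ := ne_top_of_le_ne_top (b := (M : ℝ≥0∞)) (by simp)
        ((lintegral_mono hLM).trans (by simp))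
      rw [lintegral_sub hLm hfin (Eventually.of_forall hLM)]; simp
    have key := lintegral_limsup_div_le (C := ∫⁻ ω, (M - ψ ω) ∂P) hS
      (a := fun n ω => ∑ i ∈ Finset.range n, (M - ψ (S^[i] ω)))
      (fun n => Finset.measurable_sum _ fun k _ =>
        (measurable_const.sub hψ).comp (hS.iterate k).measurable)
      (fun m n ω => (sum_iterate_add (φ := fun ω => M - ψ ω) m n ω).le)
      (fun n => (lintegral_sum_comp_iterate hS (φ := fun ω => M - ψ ω)
        (measurable_const.sub hψ) n).le)
    have hls : ∀ ω, M - L ω ≤ limsup (fun n : ℕ =>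
        (∑ i ∈ Finset.range n, (M - ψ (S^[i] ω))) / (n : ℝ≥0∞)) atTop := by
      intro ω
      simp only [hL]
      rw [← ENNReal.limsup_const_sub _ _ (by simp)]
      refine limsup_le_limsup ?_
      filter_upwards [eventually_ge_atTop 1] with n hn
      have hn0 : (n : ℝ≥0∞) ≠ 0 := by simp; omega
      rw [tsub_le_iff_right, ← ENNReal.add_div, ← Finset.sum_add_distrib,
        ENNReal.le_div_iff_mul_le (Or.inl hn0) (by simp)]
      calc (M : ℝ≥0∞) * n = ∑ i ∈ Finset.range n, (M : ℝ≥0∞) := by simp [mul_comm]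
        _ ≤ _ := Finset.sum_le_sum fun i _ => by rw [tsub_add_cancel_of_le (hM _)]
    have h2 : (M : ℝ≥0∞) - ∫⁻ ω, L ω ∂P ≤ M - ∫⁻ ω, ψ ω ∂P := by
      rw [← hML, ← hMψ]
      exact (lintegral_mono hls).trans key
    have hψM : ∫⁻ ω, ψ ω ∂P ≤ M := (lintegral_mono hM).trans (by simp)
    exact (ENNReal.sub_le_sub_iff_left hψM (by simp)).1 h2
  have hφM : ∀ ω, φ ω = ⨆ M : ℕ, min (φ ω) M := by
    intro ω
    refine le_antisymm ?_ (iSup_le fun M => min_le_left _ _)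
    refine ENNReal.le_of_forall_nnreal_lt fun r hr => ?_
    obtain ⟨M, hM⟩ := exists_nat_ge r
    refine le_iSup_of_le M (le_min hr.le (by exact_mod_cast hM))
  rw [lintegral_congr hφM, lintegral_iSup (fun M => hφ.min measurable_const)
      (fun M M' h ω => min_le_min_left _ (by exact_mod_cast h))]
  refine iSup_le fun M => (bdd (fun ω => min (φ ω) M) M (hφ.min measurable_const)
    fun ω => min_le_right _ _).trans (lintegral_mono fun ω => liminf_le_liminf ?_)
  refine Eventually.of_forall fun n => ?_
  gcongr
  exact min_le_left _ _

/-- The means are at most linear with the mean of the lower growth rate as factor; with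
`lintegral_limsup_div_le` it follows that the two growth rates agree. -/
lemma lintegral_le_mul_lintegral_liminf [IsProbabilityMeasure P] (hS : MeasurePreserving S P P)
    {a : ℕ → Ω → ℝ≥0∞} (hm : ∀ n, Measurable (a n)) (h0 : ∀ ω, a 0 ω = 0)
    (hsup : ∀ m n ω, a m ω + a n (S^[m] ω) ≤ a (m + n) ω) (k : ℕ) :
    ∫⁻ ω, a k ω ∂P ≤ k * ∫⁻ ω, liminf (fun n : ℕ => a n ω / n) atTop ∂P := by
  rcases Nat.eq_zero_or_pos k with rfl | hk
  · simp [h0]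
  have hlm : Measurable fun ω => liminf (fun n : ℕ => a n ω / n) atTop :=
    Measurable.liminf fun n => (hm n).div_const _
  rw [← lintegral_const_mul _ hlm]
  refine (lintegral_le_lintegral_liminf_average (hS.iterate k) (hm k)).trans
    (lintegral_mono fun ω => ?_)
  -- along multiples of `k` the process dominates the Birkhoff sums of `a k`
  have hmul : ∀ j, ∑ i ∈ Finset.range j, a k ((S^[k])^[i] ω) ≤ a (k * j) ω := by
    intro j
    induction j with
    | zero => simp
    | succ j ih =>
      rw [Finset.sum_range_succ, mul_add, mul_one]
      refine le_trans ?_ (hsup (k * j) k ω)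
      rw [Function.iterate_mul]
      gcongr
  have hk0 : (k : ℝ≥0∞) ≠ 0 := by simp; omega
  refine ENNReal.le_of_forall_lt_one_mul_le fun θ hθ => ?_
  rw [← ENNReal.liminf_const_mul_of_ne_top hθ.ne_top,
    ← ENNReal.liminf_const_mul_of_ne_top (by simp)]
  have hdiv : Tendsto (fun n : ℕ => n / k) atTop atTop := Nat.tendsto_div_const_atTop hk.ne'
  have hsub : liminf (fun n : ℕ =>
      θ * ((∑ i ∈ Finset.range n, a k ((S^[k])^[i] ω)) / (n : ℝ≥0∞))) atTop ≤
      liminf (fun n : ℕ => θ * ((∑ i ∈ Finset.range (n / k), a k ((S^[k])^[i] ω)) /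
        ((n / k : ℕ) : ℝ≥0∞))) atTop :=
    liminf_le_liminf_of_le (g := Filter.map (fun n : ℕ => n / k) atTop) hdiv
      (by isBoundedDefault) (by isBoundedDefault)
  refine hsub.trans (liminf_le_liminf ?_)
  filter_upwards [hdiv.eventually (eventually_mul_div_le hθ), eventually_ge_atTop 1] with n hn hn1
  refine (hn _).trans ?_
  rw [← mul_div_assoc, ENNReal.le_div_iff_mul_le (by simp; omega) (by simp)]
  set x := ∑ i ∈ Finset.range (n / k), a k ((S^[k])^[i] ω)
  have hx : x ≤ a n ω := by
    refine (hmul (n / k)).trans ?_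
    have := hsup (k * (n / k)) (n % k) ω
    rw [Nat.div_add_mod] at this
    exact le_trans le_self_add this
  have hnk : (n : ℝ≥0∞) ≤ k * ((n / k + 1 : ℕ) : ℝ≥0∞) := by
    exact_mod_cast (Nat.lt_mul_div_succ n hk).le
  calc x / ((n / k + 1 : ℕ) : ℝ≥0∞) * n
      ≤ x / ((n / k + 1 : ℕ) : ℝ≥0∞) * (k * ((n / k + 1 : ℕ) : ℝ≥0∞)) := by gcongr
    _ = k * (x / ((n / k + 1 : ℕ) : ℝ≥0∞) * ((n / k + 1 : ℕ) : ℝ≥0∞)) := by ring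
    _ = k * x := by rw [ENNReal.div_mul_cancel (by simp) (by simp)]
    _ ≤ k * a n ω := by gcongr

/-- The subadditive ergodic theorem, for a nonnegative superadditive process whose lower growth
rate is integrable. The mean of the limit is the optimal constant `C` with `∫ a n ≤ n C`. -/
theorem kingman_of_nonneg [IsProbabilityMeasure P] (hS : MeasurePreserving S P P)
    {a : ℕ → Ω → ℝ≥0∞} (hm : ∀ n, Measurable (a n)) (h0 : ∀ ω, a 0 ω = 0)
    (hsup : ∀ m n ω, a m ω + a n (S^[m] ω) ≤ a (m + n) ω)
    (hfin : ∫⁻ ω, liminf (fun n : ℕ => a n ω / n) atTop ∂P ≠ ∞) :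
    ∃ L : Ω → ℝ≥0∞, Measurable L ∧ (∀ᵐ ω ∂P, L ω ≠ ∞) ∧
      (∀ᵐ ω ∂P, Tendsto (fun n : ℕ => a n ω / n) atTop (𝓝 (L ω))) ∧
      (∀ k, ∫⁻ ω, a k ω ∂P ≤ k * ∫⁻ ω, L ω ∂P) ∧
      ∀ C, (∀ n, ∫⁻ ω, a n ω ∂P ≤ n * C) → ∫⁻ ω, L ω ∂P ≤ C := by
  have hlm : Measurable fun ω => liminf (fun n : ℕ => a n ω / n) atTop :=
    Measurable.liminf fun n => (hm n).div_const _
  have hk := lintegral_le_mul_lintegral_liminf hS hm h0 hsup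
  have hle : ∀ ω, liminf (fun n : ℕ => a n ω / n) atTop ≤
    limsup (fun n : ℕ => a n ω / n) atTop := fun ω => liminf_le_limsup
  have heq := ae_eq_of_ae_le_of_lintegral_le (Eventually.of_forall hle) hfin
    (Measurable.limsup fun n => (hm n).div_const _).aemeasurable
    (lintegral_limsup_div_le hS hm hsup hk)
  refine ⟨_, hlm, ?_, ?_, hk, fun C hC =>
    (lintegral_mono hle).trans (lintegral_limsup_div_le hS hm hsup hC)⟩
  · filter_upwards [ae_lt_top hlm hfin] with ω hω using hω.ne
  · filter_upwards [heq] with ω hω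
    exact tendsto_of_liminf_eq_limsup rfl hω.symm

end Kingman

/-! ### Polytopes are locally conical -/

section Polytope

variable {ι E : Type*} [Fintype ι] [NormedAddCommGroup E] [NormedSpace ℝ E]

/-- Vectors of a finitely generated cone are nonnegative combinations of the generators with
coefficients controlled by the norm: by induction on the set of generators allowed, a linear
relation among them removes one of them. -/
lemma exists_conic_bound_of_support (v : ι → E) (J : Finset ι) :
    ∃ K : ℝ, 0 ≤ K ∧ ∀ c : ι → ℝ, (∀ i, 0 ≤ c i) → (∀ i ∉ J, c i = 0) →
      ∃ c' : ι → ℝ, (∀ i, 0 ≤ c' i) ∧ ∑ i, c' i • v i = ∑ i, c i • v i ∧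
        ∑ i, c' i ≤ K * ‖∑ i, c i • v i‖ := by
  classical
  induction J using Finset.strongInduction with
  | _ J ih =>
  by_cases hdep : ∃ γ : ι → ℝ, (∀ i ∉ J, γ i = 0) ∧ ∑ i, γ i • v i = 0 ∧ ∃ i ∈ J, 0 < γ i
  · obtain ⟨γ, hγJ, hγ, i₁, hi₁, hpos⟩ := hdep
    choose! K hK0 hK using fun i (hi : i ∈ J) => ih (J.erase i) (Finset.erase_ssubset hi)
    refine ⟨∑ i ∈ J, K i, Finset.sum_nonneg hK0, fun c hc hcJ => ?_⟩
    obtain ⟨i₀, hi₀, hmin⟩ := (J.filter (fun i => 0 < γ i)).exists_min_image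
      (fun i => c i / γ i) ⟨i₁, by simp [hi₁, hpos]⟩
    rw [Finset.mem_filter] at hi₀
    obtain ⟨hi₀J, hi₀γ⟩ := hi₀
    set t := c i₀ / γ i₀
    have ht : 0 ≤ t := div_nonneg (hc _) hi₀γ.le
    have hsum : ∑ i, (c i - t * γ i) • v i = ∑ i, c i • v i := by
      simp only [sub_smul, Finset.sum_sub_distrib, mul_smul, ← Finset.smul_sum, hγ, smul_zero,
        sub_zero]
    obtain ⟨c', hc', hs, hle⟩ := hK i₀ hi₀J (fun i => c i - t * γ i) (fun i => by
        by_cases hiγ : 0 < γ i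
        · have hiJ : i ∈ J := by by_contra h; simp [hγJ i h] at hiγ
          have := hmin i (by simp [hiJ, hiγ])
          rw [le_div_iff₀ hiγ] at this
          simpa using this
        · have := mul_nonneg ht (neg_nonneg.2 (not_lt.1 hiγ))
          linarith [hc i]) (fun i hi => by
        rw [Finset.mem_erase, not_and_or, not_not] at hi
        rcases hi with rfl | hi
        · simp [t, div_mul_cancel₀ _ hi₀γ.ne']
        · simp [hcJ i hi, hγJ i hi])
    rw [hsum] at hs hle
    refine ⟨c', hc', hs, hle.trans ?_⟩
    gcongr
    exact Finset.single_le_sum (f := K) hK0 hi₀J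
  · -- the generators are linearly independent, so the coefficients depend boundedly on the vector
    let A : (J → ℝ) →ₗ[ℝ] E := Fintype.linearCombination ℝ fun i : J => v i
    have hext : ∀ c : J → ℝ,
        ∑ i, (if h : i ∈ J then c ⟨i, h⟩ else 0) • v i = A c := by
      intro c
      rw [Fintype.linearCombination_apply, ← Finset.sum_subset (Finset.subset_univ J)
        (fun i _ hi => by simp [hi]), ← Finset.sum_attach]
      exact Finset.sum_congr rfl fun i _ => by simp
    have hker : LinearMap.ker A = ⊥ := by
      rw [LinearMap.ker_eq_bot']
      intro c hc
      have key : ∀ c : J → ℝ, A c = 0 → ∀ i, c i ≤ 0 := by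
        intro c hc i
        by_contra h
        refine hdep ⟨fun i => if h : i ∈ J then c ⟨i, h⟩ else 0, fun i hi => by simp [hi], ?_, i.1,
          i.2, by simpa using h⟩
        rw [hext, hc]
      funext i
      have h1 := key c hc i
      have h2 := key (-c) (by rw [map_neg, hc, neg_zero]) i
      simp only [Pi.neg_apply, Pi.zero_apply] at h2 ⊢
      linarith
    obtain ⟨K, -, hK⟩ := A.exists_antilipschitzWith hker
    refine ⟨J.card * K, by positivity, fun c hc hcJ => ⟨c, hc, rfl, ?_⟩⟩
    have h1 : A (fun i : J => c i) = ∑ i, c i • v i := by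
      rw [← hext]
      refine Finset.sum_congr rfl fun i _ => ?_
      by_cases hi : i ∈ J
      · simp [hi]
      · simp [hi, hcJ i hi]
    have h2 := hK.le_mul_dist (fun i : J => c i) 0
    rw [map_zero, dist_zero_right, dist_zero_right, h1] at h2
    calc ∑ i, c i = ∑ i ∈ J, c i :=
          (Finset.sum_subset (Finset.subset_univ J) fun i _ hi => hcJ i hi).symm
      _ ≤ ∑ i ∈ J, K * ‖∑ i, c i • v i‖ := by
          refine Finset.sum_le_sum fun i hi => ?_
          have h3 := norm_le_pi_norm (fun i : J => c i) ⟨i, hi⟩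
          exact (le_abs_self _).trans (h3.trans h2)
      _ = J.card * K * ‖∑ i, c i • v i‖ := by rw [Finset.sum_const, nsmul_eq_mul, mul_assoc]

/-- Every point of a polytope close to `ζ` is a convex combination of `ζ`, with weight close to
one, and of a point of the polytope. -/
lemma exists_delta_convex_combination (p : ι → E) (ζ : E) {ε : ℝ} (hε : 0 < ε) (hζ : ζ ∈ convexHull ℝ (range p)) :
    ∃ δ > 0, ∀ η ∈ convexHull ℝ (range p), dist η ζ < δ →
      ∃ ξ ∈ convexHull ℝ (range p), η = (1 - ε) • ζ + ε • ξ := by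
  obtain ⟨K, hK0, hK⟩ := exists_conic_bound_of_support (fun i => p i - ζ) Finset.univ
  refine ⟨ε / (K + 1), by positivity, fun η hη hd => ?_⟩
  obtain ⟨α, hα0, hα1, rfl⟩ : ∃ α : ι → ℝ, (∀ i, 0 ≤ α i) ∧ ∑ i, α i = 1 ∧
      ∑ i, α i • p i = η := by
    rw [convexHull_range_eq_exists_affineCombination] at hη
    obtain ⟨s, w, hw0, hw1, rfl⟩ := hη
    classical
    refine ⟨fun i => if i ∈ s then w i else 0, fun i => ?_, ?_, ?_⟩
    · dsimp only
      split_ifs with h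
      exacts [hw0 i h, le_rfl]
    · simpa using hw1
    · rw [s.affineCombination_eq_linear_combination _ _ hw1]
      simp [ite_smul]
  obtain ⟨c, hc0, hcs, hcK⟩ := hK α hα0 (by simp)
  have hdiff : ∑ i, α i • (p i - ζ) = ∑ i, α i • p i - ζ := by
    simp only [smul_sub, Finset.sum_sub_distrib, ← Finset.sum_smul, hα1, one_smul]
  rw [hdiff] at hcs hcK
  rw [dist_eq_norm] at hd
  have hs : ∑ i, c i ≤ ε := by
    refine hcK.trans ?_
    rw [lt_div_iff₀ (by positivity)] at hd
    nlinarith [norm_nonneg (∑ i, α i • p i - ζ)]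
  set s := ∑ i, c i
  have hs0 : 0 ≤ s := Finset.sum_nonneg fun i _ => hc0 i
  refine ⟨(1 - s / ε) • ζ + ∑ i, (c i / ε) • p i, ?_, ?_⟩
  · have hsum : ∑ i, c i / ε = s / ε := by rw [Finset.sum_div]
    have hconv : Convex ℝ (convexHull ℝ (range p)) := convex_convexHull ℝ _
    have := hconv.sum_mem (t := Finset.univ) (w := fun o : Option ι => o.elim (1 - s / ε) fun i => c i / ε)
      (z := fun o : Option ι => o.elim ζ p) (fun o _ => ?_) ?_ (fun o _ => ?_)
    · simpa [Fintype.sum_option] using this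
    · cases o with
      | none => simp only [Option.elim]; rw [sub_nonneg, div_le_one hε]; exact hs
      | some i => exact div_nonneg (hc0 i) hε.le
    · simp [Fintype.sum_option, hsum]
    · cases o with
      | none => exact hζ
      | some i => exact subset_convexHull ℝ _ (mem_range_self i)
  · have h1 : ∑ i, c i • p i = (∑ i, α i • p i - ζ) + s • ζ := by
      rw [← hcs]
      simp only [smul_sub, Finset.sum_sub_distrib, ← Finset.sum_smul, s]
      abel
    have h2 : ε • ∑ i, (c i / ε) • p i = ∑ i, c i • p i := by
      rw [Finset.smul_sum]
      refine Finset.sum_congr rfl fun i _ => ?_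
      rw [smul_smul, mul_div_cancel₀ _ hε.ne']
    rw [smul_add, h2, h1, smul_smul, mul_sub, mul_one, mul_div_cancel₀ _ hε.ne', sub_smul, sub_smul,
      one_smul]
    abel

end Polytope

/-! ### Real valued superadditive processes -/

section RealKingman

variable {Ω : Type*} [MeasurableSpace Ω] {P : Measure Ω} [IsProbabilityMeasure P] {S : Ω → Ω}

lemma kingman_real_of_nonneg (hS : MeasurePreserving S P P) {a : ℕ → Ω → ℝ}
    (hm : ∀ n, Measurable (a n)) (hi : ∀ n, Integrable (a n) P) (hnn : ∀ n ω, 0 ≤ a n ω)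
    (h0 : ∀ ω, a 0 ω = 0)
    (hsup : ∀ m n ω, a m ω + a n (S^[m] ω) ≤ a (m + n) ω) {C : ℝ}
    (hC : ∀ n : ℕ, ∫ ω, a n ω ∂P ≤ n * C) :
    ∃ L : Ω → ℝ, Integrable L P ∧ (∀ᵐ ω ∂P, Tendsto (fun n : ℕ => a n ω / n) atTop (𝓝 (L ω))) ∧
      (∀ n : ℕ, ∫ ω, a n ω ∂P ≤ n * ∫ ω, L ω ∂P) ∧
      ∀ C' : ℝ, (∀ n : ℕ, ∫ ω, a n ω ∂P ≤ n * C') → ∫ ω, L ω ∂P ≤ C' := by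
  have hm' : ∀ n, Measurable fun ω => ENNReal.ofReal (a n ω) := fun n => (hm n).ennreal_ofReal
  have hsup' : ∀ m n ω, ENNReal.ofReal (a m ω) + ENNReal.ofReal (a n (S^[m] ω)) ≤
      ENNReal.ofReal (a (m + n) ω) := fun m n ω => by
    rw [← ENNReal.ofReal_add (hnn _ _) (hnn _ _)]
    exact ENNReal.ofReal_le_ofReal (hsup m n ω)
  have hnonneg : ∀ C' : ℝ, (∀ n : ℕ, ∫ ω, a n ω ∂P ≤ n * C') → 0 ≤ C' := fun C' h => by
    have := h 1
    rw [Nat.cast_one, one_mul] at this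
    exact (integral_nonneg (hnn 1)).trans this
  have hint : ∀ C' : ℝ, (∀ n : ℕ, ∫ ω, a n ω ∂P ≤ n * C') →
      ∀ n : ℕ, ∫⁻ ω, ENNReal.ofReal (a n ω) ∂P ≤ n * ENNReal.ofReal C' := fun C' h n => by
    rw [← ofReal_integral_eq_lintegral_ofReal (hi n) (Eventually.of_forall (hnn n)),
      ← ENNReal.ofReal_natCast, ← ENNReal.ofReal_mul (by positivity)]
    exact ENNReal.ofReal_le_ofReal (h n)
  obtain ⟨L, hLm, hLfin, hLt, hLk, hLC⟩ := kingman_of_nonneg hS hm' (by simp [h0]) hsup' (by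
    refine ne_top_of_le_ne_top (b := ENNReal.ofReal C) (by simp) ?_
    exact (lintegral_mono fun ω => liminf_le_limsup).trans
      (lintegral_limsup_div_le hS hm' hsup' (hint C hC)))
  have hLint : ∫⁻ ω, L ω ∂P ≠ ∞ :=
    ne_top_of_le_ne_top (b := ENNReal.ofReal C) (by simp) (hLC _ (hint C hC))
  refine ⟨fun ω => (L ω).toReal, integrable_toReal_of_lintegral_ne_top hLm.aemeasurable hLint,
    ?_, ?_, ?_⟩
  · filter_upwards [hLfin, hLt] with ω h1 h2
    refine ((ENNReal.tendsto_toReal h1).comp h2).congr fun n => ?_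
    simp [ENNReal.toReal_ofReal (hnn n ω)]
  · intro n
    rw [integral_toReal hLm.aemeasurable (hLfin.mono fun ω h => h.lt_top),
      integral_eq_lintegral_of_nonneg_ae (Eventually.of_forall (hnn n))
        (hm n).aestronglyMeasurable]
    calc _ ≤ ((n : ℝ≥0∞) * ∫⁻ ω, L ω ∂P).toReal :=
          ENNReal.toReal_mono (ENNReal.mul_ne_top (by simp) hLint) (hLk n)
      _ = _ := by simp
  · intro C' hC'
    rw [integral_toReal hLm.aemeasurable (hLfin.mono fun ω h => h.lt_top)]
    exact ENNReal.toReal_le_of_le_ofReal (hnonneg C' hC') (hLC _ (hint C' hC'))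

omit [IsProbabilityMeasure P] in
lemma integrable_sum_iterate (hS : MeasurePreserving S P P) {f : Ω → ℝ} (hf : Integrable f P)
    (n : ℕ) : Integrable (fun ω => ∑ i ∈ Finset.range n, f (S^[i] ω)) P :=
  integrable_finsetSum _ fun i _ => (hS.iterate i).integrable_comp_of_integrable hf

omit [IsProbabilityMeasure P] in
lemma integral_sum_iterate (hS : MeasurePreserving S P P) {f : Ω → ℝ} (hfm : Measurable f)
    (hf : Integrable f P) (n : ℕ) :
    ∫ ω, ∑ i ∈ Finset.range n, f (S^[i] ω) ∂P = n * ∫ ω, f ω ∂P := by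
  rw [integral_finsetSum (f := fun i ω => f (S^[i] ω)) _ fun i _ => (hS.iterate i).integrable_comp_of_integrable hf]
  have : ∀ i, ∫ ω, f (S^[i] ω) ∂P = ∫ ω, f ω ∂P := fun i => by
    rw [← integral_map (hS.iterate i).measurable.aemeasurable
      hfm.aestronglyMeasurable, (hS.iterate i).map_eq]
  simp [this]

omit [MeasurableSpace Ω] in
lemma sum_iterate_add_real {f : Ω → ℝ} (m n : ℕ) (ω : Ω) :
    ∑ i ∈ Finset.range m, f (S^[i] ω) + ∑ i ∈ Finset.range n, f (S^[i] (S^[m] ω)) =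
      ∑ i ∈ Finset.range (m + n), f (S^[i] ω) := by
  rw [Finset.sum_range_add]
  congr 1
  refine Finset.sum_congr rfl fun k _ => ?_
  rw [← Function.iterate_add_apply, add_comm]

/-- The pointwise ergodic theorem. -/
theorem birkhoff (hS : MeasurePreserving S P P) {f : Ω → ℝ} (hfm : Measurable f)
    (hf : Integrable f P) :
    ∃ B : Ω → ℝ, Integrable B P ∧
      (∀ᵐ ω ∂P, Tendsto (fun n : ℕ => (∑ i ∈ Finset.range n, f (S^[i] ω)) / n) atTop
        (𝓝 (B ω))) ∧ ∫ ω, B ω ∂P = ∫ ω, f ω ∂P := by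
  have key : ∀ f : Ω → ℝ, Measurable f → Integrable f P → (∀ ω, 0 ≤ f ω) →
      ∃ B : Ω → ℝ, Integrable B P ∧
      (∀ᵐ ω ∂P, Tendsto (fun n : ℕ => (∑ i ∈ Finset.range n, f (S^[i] ω)) / n) atTop
        (𝓝 (B ω))) ∧ ∫ ω, B ω ∂P = ∫ ω, f ω ∂P := by
    intro f hfm hf hnn
    obtain ⟨B, hB, ht, h1, h2⟩ := kingman_real_of_nonneg hS
      (a := fun n ω => ∑ i ∈ Finset.range n, f (S^[i] ω)) (C := ∫ ω, f ω ∂P)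
      (fun n => Finset.measurable_sum _ fun k _ => hfm.comp (hS.iterate k).measurable)
      (integrable_sum_iterate hS hf) (fun n ω => Finset.sum_nonneg fun i _ => hnn _) (by simp)
      (fun m n ω => (sum_iterate_add_real m n ω).le)
      (fun n => (integral_sum_iterate hS hfm hf n).le)
    refine ⟨B, hB, ht, le_antisymm (h2 _ fun n => (integral_sum_iterate hS hfm hf n).le) ?_⟩
    simpa using h1 1
  obtain ⟨B₁, hB₁, ht₁, hI₁⟩ := key (fun ω => max (f ω) 0) (hfm.max measurable_const)
    hf.pos_part (fun ω => le_max_right _ _)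
  obtain ⟨B₂, hB₂, ht₂, hI₂⟩ := key (fun ω => max (-f ω) 0) (hfm.neg.max measurable_const)
    hf.neg_part (fun ω => le_max_right _ _)
  have hsub : ∀ ω, max (f ω) 0 - max (-f ω) 0 = f ω := fun ω => by
    rcases le_total 0 (f ω) with h | h
    · rw [max_eq_left h, max_eq_right (by linarith), sub_zero]
    · rw [max_eq_right h, max_eq_left (by linarith)]; ring
  refine ⟨fun ω => B₁ ω - B₂ ω, hB₁.sub hB₂, ?_, ?_⟩
  · filter_upwards [ht₁, ht₂] with ω h1 h2
    refine (h1.sub h2).congr fun n => ?_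
    rw [← sub_div, ← Finset.sum_sub_distrib]
    simp only [hsub]
  · rw [integral_sub hB₁ hB₂, hI₁, hI₂, ← integral_sub hf.pos_part hf.neg_part]
    simp only [hsub]

section

variable {a : ℕ → Ω → ℝ}

omit [MeasurableSpace Ω] in
lemma sum_iterate_le_of_superadditive (h0 : ∀ ω, a 0 ω = 0)
    (hsup : ∀ m n ω, a m ω + a n (S^[m] ω) ≤ a (m + n) ω) (n : ℕ) (ω : Ω) :
    ∑ i ∈ Finset.range n, a 1 (S^[i] ω) ≤ a n ω := by
  induction n with
  | zero => simp [h0]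
  | succ n ih => rw [Finset.sum_range_succ]; exact (add_le_add ih le_rfl).trans (hsup n 1 ω)

/-- A deterministic bound for the upper growth rate bounds the means. -/
lemma integral_le_of_eventually_le (hS : MeasurePreserving S P P)
    (hm : ∀ n, Measurable (a n)) (hi : ∀ n, Integrable (a n) P) (h0 : ∀ ω, a 0 ω = 0)
    (hsup : ∀ m n ω, a m ω + a n (S^[m] ω) ≤ a (m + n) ω) {c : ℝ}
    (hc : ∀ᵐ ω ∂P, ∀ᶠ n : ℕ in atTop, a n ω ≤ n * c) (n : ℕ) :
    ∫ ω, a n ω ∂P ≤ n * c := by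
  obtain ⟨B, hB, hBt, hBI⟩ := birkhoff hS (hm 1) (hi 1)
  set a' : ℕ → Ω → ℝ := fun n ω => a n ω - ∑ i ∈ Finset.range n, a 1 (S^[i] ω)
  have hnn : ∀ n ω, 0 ≤ a' n ω := fun n ω =>
    sub_nonneg.2 (sum_iterate_le_of_superadditive h0 hsup n ω)
  have hm' : ∀ n, Measurable (a' n) := fun n =>
    (hm n).sub (Finset.measurable_sum _ fun k _ => (hm 1).comp (hS.iterate k).measurable)
  have hi' : ∀ n, Integrable (a' n) P := fun n => (hi n).sub (integrable_sum_iterate hS (hi 1) n)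
  have hsup' : ∀ m n ω, ENNReal.ofReal (a' m ω) + ENNReal.ofReal (a' n (S^[m] ω)) ≤
      ENNReal.ofReal (a' (m + n) ω) := fun m n ω => by
    rw [← ENNReal.ofReal_add (hnn _ _) (hnn _ _)]
    refine ENNReal.ofReal_le_ofReal ?_
    have h1 := hsup m n ω
    have h2 := sum_iterate_add_real (S := S) (f := a 1) m n ω
    simp only [a']
    linarith
  have hcB : ∀ᵐ ω ∂P, 0 ≤ c - B ω ∧
      liminf (fun n : ℕ => ENNReal.ofReal (a' n ω) / n) atTop ≤ ENNReal.ofReal (c - B ω) := by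
    filter_upwards [hc, hBt] with ω h1 h2
    have h3 : Tendsto (fun n : ℕ => c - (∑ i ∈ Finset.range n, a 1 (S^[i] ω)) / n) atTop
        (𝓝 (c - B ω)) := h2.const_sub c
    have h4 : ∀ᶠ n : ℕ in atTop, a' n ω / n ≤
        c - (∑ i ∈ Finset.range n, a 1 (S^[i] ω)) / n := by
      filter_upwards [h1, eventually_ge_atTop 1] with n hn hn1
      have : (0 : ℝ) < n := by exact_mod_cast hn1
      simp only [a']
      rw [sub_div]
      gcongr
      rw [div_le_iff₀ this]; linarith
    refine ⟨ge_of_tendsto h3 (h4.mono fun n hn => (div_nonneg (hnn n ω) (by positivity)).trans hn),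
      ?_⟩
    rw [← (ENNReal.tendsto_ofReal h3).liminf_eq]
    refine liminf_le_liminf ?_
    filter_upwards [h4, eventually_ge_atTop 1] with n hn hn1
    rw [← ENNReal.ofReal_natCast, ← ENNReal.ofReal_div_of_pos (by exact_mod_cast hn1)]
    exact ENNReal.ofReal_le_ofReal hn
  have hk := lintegral_le_mul_lintegral_liminf hS (fun n => (hm' n).ennreal_ofReal)
    (by simp [a', h0]) hsup' n
  have hle : ∫⁻ ω, ENNReal.ofReal (a' n ω) ∂P ≤ n * ∫⁻ ω, ENNReal.ofReal (c - B ω) ∂P :=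
    hk.trans (mul_le_mul_right (lintegral_mono_ae (hcB.mono fun ω h => h.2)) _)
  have hcBint : Integrable (fun ω => c - B ω) P := (integrable_const c).sub hB
  have hcI : 0 ≤ ∫ ω, (c - B ω) ∂P := integral_nonneg_of_ae (hcB.mono fun ω h => h.1)
  rw [← ofReal_integral_eq_lintegral_ofReal (hi' n) (Eventually.of_forall (hnn n)),
    ← ofReal_integral_eq_lintegral_ofReal hcBint (hcB.mono fun ω h => h.1),
    ← ENNReal.ofReal_natCast, ← ENNReal.ofReal_mul (by positivity),
    ENNReal.ofReal_le_ofReal_iff (by positivity),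
    integral_sub (integrable_const c) hB, hBI,
    integral_sub (hi n) (integrable_sum_iterate hS (hi 1) n),
    integral_sum_iterate hS (hm 1) (hi 1)] at hle
  simp only [integral_const, probReal_univ, one_smul] at hle
  linarith

/-- The subadditive ergodic theorem for a superadditive process of at most linearly growing
means. -/
theorem kingman_real (hS : MeasurePreserving S P P)
    (hm : ∀ n, Measurable (a n)) (hi : ∀ n, Integrable (a n) P) (h0 : ∀ ω, a 0 ω = 0)
    (hsup : ∀ m n ω, a m ω + a n (S^[m] ω) ≤ a (m + n) ω) {C : ℝ}
    (hC : ∀ n : ℕ, ∫ ω, a n ω ∂P ≤ n * C) :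
    ∃ L : Ω → ℝ, Integrable L P ∧ (∀ᵐ ω ∂P, Tendsto (fun n : ℕ => a n ω / n) atTop (𝓝 (L ω))) ∧
      (∀ n : ℕ, ∫ ω, a n ω ∂P ≤ n * ∫ ω, L ω ∂P) ∧
      ∀ C' : ℝ, (∀ n : ℕ, ∫ ω, a n ω ∂P ≤ n * C') → ∫ ω, L ω ∂P ≤ C' := by
  obtain ⟨B, hB, hBt, hBI⟩ := birkhoff hS (hm 1) (hi 1)
  have hI : ∀ n, ∫ ω, (a n ω - ∑ i ∈ Finset.range n, a 1 (S^[i] ω)) ∂P =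
      ∫ ω, a n ω ∂P - n * ∫ ω, B ω ∂P := fun n => by
    rw [integral_sub (hi n) (integrable_sum_iterate hS (hi 1) n),
      integral_sum_iterate hS (hm 1) (hi 1), hBI]
  obtain ⟨L, hL, hLt, h1, h2⟩ := kingman_real_of_nonneg hS
    (a := fun n ω => a n ω - ∑ i ∈ Finset.range n, a 1 (S^[i] ω)) (C := C - ∫ ω, B ω ∂P)
    (fun n => (hm n).sub (Finset.measurable_sum _ fun k _ =>
      (hm 1).comp (hS.iterate k).measurable))
    (fun n => (hi n).sub (integrable_sum_iterate hS (hi 1) n))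
    (fun n ω => sub_nonneg.2 (sum_iterate_le_of_superadditive h0 hsup n ω)) (by simp [h0])
    (fun m n ω => by
      have h1 := hsup m n ω
      have h2 := sum_iterate_add_real (S := S) (f := a 1) m n ω
      linarith)
    (fun n => by rw [hI]; linarith [hC n])
  refine ⟨fun ω => L ω + B ω, hL.add hB, ?_, fun n => ?_, fun C' hC' => ?_⟩
  · filter_upwards [hLt, hBt] with ω h1 h2
    refine (h1.add h2).congr fun n => ?_
    rw [← add_div]; ring_nf
  · have := h1 n
    rw [hI] at this
    rw [integral_add hL hB]
    linarith
  · have := h2 (C' - ∫ ω, B ω ∂P) fun n => by rw [hI]; linarith [hC' n]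
    rw [integral_add hL hB]
    linarith

end

end RealKingman

/-! ### Superadditive fields indexed by step counts -/

section Counts

variable {d : ℕ} {R : Finset (Fin d → ℤ)}

/-- The inclusion of `ℤ^d` in `ℝ^d` as an additive homomorphism. -/
def toEuclidHom (d : ℕ) : (Fin d → ℤ) →+ EuclideanSpace ℝ (Fin d) where
  toFun := toEuclid
  map_zero' := by ext i; simp [toEuclid]
  map_add' x y := by ext i; simp [toEuclid]

lemma toEuclidHom_apply (x : Fin d → ℤ) : toEuclidHom d x = toEuclid x := rfl

/-- The number of steps of a path that uses the step `z` exactly `m z` times. -/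
def stepCount (m : R → ℕ) : ℕ := ∑ z, m z

/-- The displacement of a path that uses the step `z` exactly `m z` times. -/
def displacement (m : R → ℕ) : LatticeGroup R := ∑ z, m z • step z

@[simp] lemma stepCount_zero : stepCount (0 : R → ℕ) = 0 := by simp [stepCount]

@[simp] lemma displacement_zero : displacement (0 : R → ℕ) = 0 := by simp [displacement]

lemma stepCount_add (m m' : R → ℕ) : stepCount (m + m') = stepCount m + stepCount m' := by
  simp [stepCount, Finset.sum_add_distrib]

lemma displacement_add (m m' : R → ℕ) :
    displacement (m + m') = displacement m + displacement m' := by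
  simp [displacement, add_smul, Finset.sum_add_distrib]

lemma stepCount_nsmul (j : ℕ) (m : R → ℕ) : stepCount (j • m) = j * stepCount m := by
  simp [stepCount, Finset.mul_sum]

lemma displacement_nsmul (j : ℕ) (m : R → ℕ) : displacement (j • m) = j • displacement m := by
  simp [displacement, Finset.smul_sum, smul_smul]

lemma stepCount_single (z : R) : stepCount (Pi.single z 1) = 1 := by
  simp [stepCount, Finset.sum_pi_single']

lemma displacement_single (z : R) : displacement (Pi.single z 1) = step z := by
  rw [displacement, Finset.sum_eq_single z]
  · simp
  · intro b _ hb; simp [hb]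
  · simp

lemma toEuclid_displacement (m : R → ℕ) :
    toEuclid (displacement m).1 = ∑ z : R, (m z : ℝ) • toEuclid z.1 := by
  rw [← toEuclidHom_apply, displacement, AddSubgroup.val_finsetSum, map_sum]
  refine Finset.sum_congr rfl fun z _ => ?_
  rw [AddSubgroup.coe_nsmul, map_nsmul, Nat.cast_smul_eq_nsmul]
  rfl

/-- A bound for the length of a step. -/
def stepBound (R : Finset (Fin d → ℤ)) : ℝ := ∑ z : R, ‖toEuclid z.1‖

lemma stepBound_nonneg : 0 ≤ stepBound R := Finset.sum_nonneg fun _ _ => norm_nonneg _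

lemma norm_sum_smul_toEuclid_le (c : R → ℝ) {B : ℝ} (hc : ∀ z, |c z| ≤ B) :
    ‖∑ z : R, c z • toEuclid z.1‖ ≤ B * stepBound R := by
  rw [stepBound, Finset.mul_sum]
  refine norm_sum_le_of_le _ fun z _ => ?_
  rw [norm_smul, Real.norm_eq_abs]
  exact mul_le_mul_of_nonneg_right (hc z) (norm_nonneg _)

lemma le_stepCount (m : R → ℕ) (z : R) : m z ≤ stepCount m :=
  Finset.single_le_sum (f := m) (fun _ _ => Nat.zero_le _) (Finset.mem_univ z)

lemma norm_displacement_le (m : R → ℕ) :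
    ‖toEuclid (displacement m).1‖ ≤ stepBound R * stepCount m := by
  rw [toEuclid_displacement, mul_comm]
  refine norm_sum_smul_toEuclid_le _ fun z => ?_
  rw [abs_of_nonneg (by positivity)]
  exact_mod_cast le_stepCount m z

lemma eq_sum_nsmul_single (m : R → ℕ) : m = ∑ z, m z • (Pi.single z 1 : R → ℕ) := by
  funext y
  rw [Finset.sum_apply, Finset.sum_eq_single y]
  · simp
  · intro b _ hb; simp [hb.symm]
  · simp

variable {Ω : Type*}

/-- The sums of `G` over straight lattice segments of length `o(n)` inside a ball of radius `O(n)`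
are `o(n)`. -/
def SublinearOnLines (T : LatticeGroup R → Ω → Ω) (G : Ω → ℝ) (ω : Ω) : Prop :=
  ∀ C ε : ℝ, 0 < ε → ∃ η > 0, ∃ N : ℕ, ∀ n ≥ N, ∀ x : LatticeGroup R,
    ‖toEuclid x.1‖ ≤ C * n → ∀ z : R, z.1 ≠ 0 → ∀ j : ℕ, (j : ℝ) ≤ η * n →
      ∑ i ∈ Finset.range j, G (T (x + i • step z) ω) ≤ ε * n

/-- A random field, indexed by step counts, that is superadditive along the action, depends on
the counts only through the number of steps and the displacement, and loses at most `G` in a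
single step. -/
structure IsSuperadditiveField [MeasurableSpace Ω] (P : Measure Ω) (T : LatticeGroup R → Ω → Ω)
    (G : Ω → ℝ) (a : (R → ℕ) → Ω → ℝ) : Prop where
  nonneg : ∀ ω, 0 ≤ G ω
  integrable_cost : Integrable G P
  sublinear : ∀ᵐ ω ∂P, SublinearOnLines T G ω
  measurable : ∀ m, Measurable (a m)
  integrable : ∀ m, Integrable (a m) P
  zero : ∀ ω, a 0 ω = 0
  congr : ∀ m m', stepCount m = stepCount m' → displacement m = displacement m' → a m = a m'
  add_le : ∀ m m' ω, a m ω + a m' (T (displacement m) ω) ≤ a (m + m') ω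
  single_ge : ∀ z ω, -G ω ≤ a (Pi.single z 1) ω

variable [MeasurableSpace Ω] {P : Measure Ω} {T : LatticeGroup R → Ω → Ω}

section Cost

variable {G : Ω → ℝ} {a : (R → ℕ) → Ω → ℝ}

lemma IsSuperadditiveField.add_nsmul_single_ge (ha : IsSuperadditiveField P T G a) (m : R → ℕ)
    (z : R) (j : ℕ) (ω : Ω) :
    a m ω - ∑ i ∈ Finset.range j, G (T (displacement m + i • step z) ω) ≤
      a (m + j • Pi.single z 1) ω := by
  induction j with
  | zero => simp
  | succ j ih =>
    rw [Finset.sum_range_succ, succ_nsmul, ← add_assoc]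
    have h1 := ha.add_le (m + j • Pi.single z 1) (Pi.single z 1) ω
    have h2 := ha.single_ge z (T (displacement (m + j • Pi.single z 1)) ω)
    rw [displacement_add, displacement_nsmul, displacement_single] at h1 h2
    linarith

/-- Adding few steps of one kind costs little. A null step is not controlled along a line; it is
taken at the start of the path, at the origin. -/
lemma IsSuperadditiveField.exists_add_single_ge (ha : IsSuperadditiveField P T G a)
    (hT0 : T 0 = id) {ω : Ω} (hω : SublinearOnLines T G ω) (z : R) (C : ℝ) {ε : ℝ} (hε : 0 < ε) :
    ∃ η > 0, ∃ N : ℕ, ∀ n ≥ N, ∀ (m : R → ℕ) (j : ℕ), (stepCount m : ℝ) ≤ C * n →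
      (j : ℝ) ≤ η * n → a m ω - ε * n ≤ a (m + j • Pi.single z 1) ω := by
  by_cases hz : z.1 = 0
  · have hstep : step z = 0 := Subtype.ext hz
    have hG := ha.nonneg ω
    refine ⟨ε / (G ω + 1), by positivity, 0, fun n _ m j _ hj => ?_⟩
    have h1 := ha.add_nsmul_single_ge 0 z j ω
    have h2 := ha.add_le (j • Pi.single z 1) m ω
    have hsum : ∑ i ∈ Finset.range j, G (T (displacement (0 : R → ℕ) + i • step z) ω) = j * G ω := by
      simp [hstep, hT0]
    rw [hsum, ha.zero, zero_add, zero_sub] at h1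
    rw [displacement_nsmul, displacement_single, hstep, smul_zero, hT0, id] at h2
    rw [add_comm m]
    have h3 : (j : ℝ) * G ω ≤ ε * n := by
      rw [div_mul_eq_mul_div, le_div_iff₀ (by positivity)] at hj
      nlinarith [(Nat.cast_nonneg j : (0 : ℝ) ≤ j)]
    linarith
  · obtain ⟨η, hη, N, h⟩ := hω (stepBound R * C) ε hε
    refine ⟨η, hη, N, fun n hn m j hm hj => ?_⟩
    have h1 := ha.add_nsmul_single_ge m z j ω
    have h2 := h n hn (displacement m) (by
      rw [mul_assoc]
      exact (norm_displacement_le m).trans (mul_le_mul_of_nonneg_left hm stepBound_nonneg)) z hz j hj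
    linarith

lemma IsSuperadditiveField.exists_add_ge_of_support (ha : IsSuperadditiveField P T G a)
    (hT0 : T 0 = id) {ω : Ω} (hω : SublinearOnLines T G ω) (s : Finset R) :
    ∀ (C : ℝ) {ε : ℝ}, 0 < ε → ∃ η > 0, ∃ N : ℕ, ∀ n ≥ N, ∀ m r : R → ℕ, (∀ z ∉ s, r z = 0) →
      (stepCount m : ℝ) ≤ C * n → (stepCount r : ℝ) ≤ η * n → a m ω - ε * n ≤ a (m + r) ω := by
  classical
  induction s using Finset.induction_on with
  | empty =>
    intro C ε hε
    refine ⟨1, one_pos, 0, fun n _ m r hr _ _ => ?_⟩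
    have : r = 0 := funext fun z => hr z (by simp)
    rw [this, add_zero]
    have : 0 ≤ ε * n := by positivity
    linarith
  | insert z s hz ih =>
    intro C ε hε
    obtain ⟨η₁, hη₁, N₁, h₁⟩ := ih C (half_pos hε)
    obtain ⟨η₂, hη₂, N₂, h₂⟩ := ha.exists_add_single_ge hT0 hω z (C + η₁) (half_pos hε)
    refine ⟨min η₁ η₂, lt_min hη₁ hη₂, max N₁ N₂, fun n hn m r hr hm hrn => ?_⟩
    set r' : R → ℕ := Function.update r z 0
    have hrr : r = r' + r z • Pi.single z 1 := by
      funext y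
      by_cases hy : y = z
      · subst hy; simp [r']
      · simp [r', hy]
    have hle : stepCount r' ≤ stepCount r := by
      conv_rhs => rw [hrr]
      rw [stepCount_add]; omega
    have hn0 : (0 : ℝ) ≤ n := by positivity
    have h1 : (stepCount r : ℝ) ≤ η₁ * n :=
      hrn.trans (mul_le_mul_of_nonneg_right (min_le_left _ _) hn0)
    have h2 : (stepCount r : ℝ) ≤ η₂ * n :=
      hrn.trans (mul_le_mul_of_nonneg_right (min_le_right _ _) hn0)
    have h3 : (stepCount r' : ℝ) ≤ stepCount r := by exact_mod_cast hle
    have h4 : (r z : ℝ) ≤ stepCount r := by exact_mod_cast le_stepCount r z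
    have h5 := h₁ n (le_trans (le_max_left _ _) hn) m r' (fun y hy => by
      by_cases hyz : y = z
      · simp [r', hyz]
      · simp [r', hyz, hr y (by simp [hyz, hy])]) hm (h3.trans h1)
    have h6 := h₂ n (le_trans (le_max_right _ _) hn) (m + r') (r z) (by
      rw [stepCount_add]; push_cast; linarith) (h4.trans h2)
    rw [add_assoc, ← hrr] at h6
    linarith

/-- The comparison principle: few additional steps cost little, wherever the path is within the
range of the first `O(n)` steps. -/
lemma IsSuperadditiveField.exists_le_of_le (ha : IsSuperadditiveField P T G a)
    (hT0 : T 0 = id) {ω : Ω} (hω : SublinearOnLines T G ω) (C : ℝ) {ε : ℝ} (hε : 0 < ε) :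
    ∃ η > 0, ∃ N : ℕ, ∀ n ≥ N, ∀ m p : R → ℕ, m ≤ p → (stepCount m : ℝ) ≤ C * n →
      (stepCount p : ℝ) ≤ stepCount m + η * n → a m ω ≤ a p ω + ε * n := by
  obtain ⟨η, hη, N, h⟩ := ha.exists_add_ge_of_support hT0 hω Finset.univ C hε
  refine ⟨η, hη, N, fun n hn m p hmp hm hp => ?_⟩
  have hpm : p = m + (p - m) := (add_tsub_cancel_of_le hmp).symm
  have h1 := h n hn m (p - m) (by simp) hm (by
    rw [hpm, stepCount_add] at hp
    push_cast at hp
    linarith)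
  rw [← hpm] at h1
  linarith

/-- A linear lower bound for the field, uniform in the direction. -/
lemma IsSuperadditiveField.exists_ge_neg_mul (ha : IsSuperadditiveField P T G a)
    (hT0 : T 0 = id) {ω : Ω} (hω : SublinearOnLines T G ω) :
    ∃ C : ℝ, 0 ≤ C ∧ ∃ N : ℕ, ∀ m : R → ℕ, N ≤ stepCount m → -(C * stepCount m) ≤ a m ω := by
  obtain ⟨η, hη, N, h⟩ := ha.exists_le_of_le hT0 hω 0 one_pos
  obtain ⟨q, hq⟩ := exists_nat_gt (1 / η)
  have hq1 : 1 ≤ η * q := by rw [div_lt_iff₀ hη] at hq; linarith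
  have hq0 : 1 ≤ q := by
    rcases Nat.eq_zero_or_pos q with rfl | h
    · simp at hq1; linarith
    · exact h
  refine ⟨q, by positivity, N, fun m hm => ?_⟩
  have hs : (0 : ℝ) ≤ stepCount m := by positivity
  have := h (q * stepCount m) (hm.trans (Nat.le_mul_of_pos_left _ hq0)) 0 m (by
    intro z; simp) (by simp) (by
      push_cast; simp only [stepCount_zero, Nat.cast_zero, zero_add]; nlinarith)
  rw [ha.zero] at this
  push_cast at this
  linarith

end Cost

end Counts

/-! ### Ergodicity and the growth rates of a superadditive field -/

section Growth

variable {d : ℕ} {R : Finset (Fin d → ℤ)} {Ω : Type*} [MeasurableSpace Ω] {P : Measure Ω}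
  [IsProbabilityMeasure P] {T : LatticeGroup R → Ω → Ω}

/-- An event that is carried into itself, up to null sets, by every step has probability zero or
one. -/
lemma IsErgodicSystem.measure_eq_zero_or_one (hT : IsErgodicSystem R P T) {A : Set Ω}
    (hA : MeasurableSet A) (hinv : ∀ z : R, ∀ᵐ ω ∂P, ω ∈ A → T (step z) ω ∈ A) :
    P A = 0 ∨ P A = 1 := by
  have hG : ∀ x : LatticeGroup R, T x ⁻¹' A =ᵐ[P] A := by
    rintro ⟨x, hx⟩
    induction hx using AddSubgroup.closure_induction with
    | mem z hz =>
      have h1 : A ≤ᵐ[P] T (step ⟨z, hz⟩) ⁻¹' A := hinv ⟨z, hz⟩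
      exact (ae_eq_of_ae_subset_of_measure_ge h1
        ((hT.measurePreserving _).measure_preimage hA.nullMeasurableSet).le
        hA.nullMeasurableSet (measure_ne_top _ _)).symm
    | zero =>
      have : T ⟨0, zero_mem _⟩ = id := hT.map_zero
      rw [this]; rfl
    | add x y hx hy ihx ihy =>
      have h1 : T ⟨x + y, add_mem hx hy⟩ = T ⟨x, hx⟩ ∘ T ⟨y, hy⟩ := hT.map_add ⟨x, hx⟩ ⟨y, hy⟩
      rw [h1, preimage_comp]
      exact ((hT.measurePreserving ⟨y, hy⟩).quasiMeasurePreserving.preimage_ae_eq ihx).trans ihy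
    | neg x hx ih =>
      have h1 := (hT.measurePreserving (-⟨x, hx⟩)).quasiMeasurePreserving.preimage_ae_eq ih
      rw [← preimage_comp, ← hT.map_add, add_neg_cancel, hT.map_zero, preimage_id] at h1
      exact h1.symm
  set A' : Set Ω := ⋂ x : LatticeGroup R, T x ⁻¹' A
  have hA' : MeasurableSet A' :=
    MeasurableSet.iInter fun x => (hT.measurePreserving x).measurable hA
  have heq : A' =ᵐ[P] A := by
    have h1 : ∀ᵐ ω ∂P, ∀ x : LatticeGroup R, ω ∈ T x ⁻¹' A ↔ ω ∈ A :=
      ae_all_iff.2 fun x => (hG x).mem_iff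
    filter_upwards [h1] with ω hω
    refine propext ⟨fun h => (hω 0).1 (mem_iInter.1 h 0), fun h => mem_iInter.2 fun x => (hω x).2 h⟩
  rw [← measure_congr heq]
  refine hT.ergodic A' hA' fun z => ?_
  ext ω
  simp only [A', mem_preimage, mem_iInter]
  refine ⟨fun h x => ?_, fun h x => ?_⟩
  · have h1 := h (x - step z)
    have h2 := congrFun (hT.map_add (x - step z) (step z)) ω
    rw [sub_add_cancel] at h2
    rwa [h2]
  · have h2 := congrFun (hT.map_add x (step z)) ω
    have h1 := h (x + step z)
    rwa [h2] at h1

omit [IsProbabilityMeasure P] in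
lemma IsErgodicSystem.iterate (hT : IsErgodicSystem R P T) (x : LatticeGroup R) (j : ℕ) :
    (T x)^[j] = T (j • x) := by
  induction j with
  | zero => rw [zero_smul, hT.map_zero]; rfl
  | succ j ih => rw [Function.iterate_succ, ih, succ_nsmul, hT.map_add]

/-- An integrable function all of whose sublevel sets are trivial is constant. -/
lemma ae_eq_integral_of_trivial_sublevel {L : Ω → ℝ} (hL : Integrable L P)
    (h : ∀ c : ℝ, (∀ᵐ ω ∂P, L ω ≤ c) ∨ ∀ᵐ ω ∂P, c < L ω) : ∀ᵐ ω ∂P, L ω = ∫ ω, L ω ∂P := by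
  set μ := ∫ ω, L ω ∂P
  have hge : ∀ᵐ ω ∂P, μ ≤ L ω := by
    have h1 : ∀ n : ℕ, ∀ᵐ ω ∂P, μ - 1 / ((n : ℝ) + 1) < L ω := fun n => by
      refine (h _).resolve_left fun hle => ?_
      have h2 := integral_mono_ae hL (integrable_const _) hle
      simp only [integral_const, probReal_univ, one_smul] at h2
      have : (0 : ℝ) < 1 / ((n : ℝ) + 1) := by positivity
      linarith
    filter_upwards [ae_all_iff.2 h1] with ω hω
    have h3 := (tendsto_one_div_add_atTop_nhds_zero_nat (𝕜 := ℝ)).const_sub μ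
    rw [sub_zero] at h3
    exact le_of_tendsto h3 (Eventually.of_forall fun n => (hω n).le)
  have h0 : ∫ ω, (L ω - μ) ∂P = 0 := by
    rw [integral_sub hL (integrable_const _)]; simp [μ]
  have h4 := (integral_eq_zero_iff_of_nonneg_ae (f := fun ω => L ω - μ)
    (hge.mono fun ω h => sub_nonneg.2 h) (hL.sub (integrable_const _))).1 h0
  filter_upwards [h4] with ω hω
  simpa [sub_eq_zero] using hω

variable {G : Ω → ℝ} {a : (R → ℕ) → Ω → ℝ}

omit [IsProbabilityMeasure P] in
lemma IsSuperadditiveField.superadditive_nsmul (ha : IsSuperadditiveField P T G a)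
    (hT : IsErgodicSystem R P T) (k : R → ℕ) (m n : ℕ) (ω : Ω) :
    a (m • k) ω + a (n • k) ((T (displacement k))^[m] ω) ≤ a ((m + n) • k) ω := by
  rw [hT.iterate, ← displacement_nsmul, add_smul]
  exact ha.add_le _ _ _

omit [IsProbabilityMeasure P] in
lemma IsSuperadditiveField.integral_add_le (ha : IsSuperadditiveField P T G a)
    (hT : IsErgodicSystem R P T) (m m' : R → ℕ) :
    ∫ ω, a m ω ∂P + ∫ ω, a m' ω ∂P ≤ ∫ ω, a (m + m') ω ∂P := by
  have hmp := hT.measurePreserving (displacement m)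
  have h1 : ∫ ω, a m' ω ∂P = ∫ ω, a m' (T (displacement m) ω) ∂P := by
    rw [← integral_map hmp.measurable.aemeasurable (ha.measurable m').aestronglyMeasurable,
      hmp.map_eq]
  have h2 : Integrable (fun ω => a m' (T (displacement m) ω)) P :=
    hmp.integrable_comp_of_integrable (ha.integrable m')
  rw [h1, ← integral_add (ha.integrable m) h2]
  exact integral_mono ((ha.integrable m).add h2) (ha.integrable _) fun ω => ha.add_le m m' ω

omit [IsProbabilityMeasure P] in
lemma IsSuperadditiveField.mul_integral_le (ha : IsSuperadditiveField P T G a)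
    (hT : IsErgodicSystem R P T) (k : R → ℕ) (n : ℕ) :
    n * ∫ ω, a k ω ∂P ≤ ∫ ω, a (n • k) ω ∂P := by
  induction n with
  | zero => simp [ha.zero]
  | succ n ih =>
    rw [succ_nsmul]
    refine le_trans ?_ (ha.integral_add_le hT (n • k) k)
    push_cast; linarith

omit [IsProbabilityMeasure P] in
lemma IsSuperadditiveField.neg_mul_le_integral (ha : IsSuperadditiveField P T G a)
    (hT : IsErgodicSystem R P T) (k : R → ℕ) :
    -(stepCount k * ∫ ω, G ω ∂P) ≤ ∫ ω, a k ω ∂P := by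
  classical
  have hs : ∀ z : R, -∫ ω, G ω ∂P ≤ ∫ ω, a (Pi.single z 1) ω ∂P := fun z => by
    rw [← integral_neg]
    exact integral_mono ha.integrable_cost.neg (ha.integrable _) (ha.single_ge z)
  have key : ∀ s : Finset R, ∑ z ∈ s, -(k z * ∫ ω, G ω ∂P) ≤
      ∫ ω, a (∑ z ∈ s, k z • Pi.single z 1) ω ∂P := by
    intro s
    induction s using Finset.induction_on with
    | empty => simp [ha.zero]
    | insert z s hz ih =>
      rw [Finset.sum_insert hz, Finset.sum_insert hz]
      refine le_trans (add_le_add ?_ ih) (ha.integral_add_le hT _ _)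
      refine le_trans ?_ (ha.mul_integral_le hT _ (k z))
      rw [← mul_neg]
      exact mul_le_mul_of_nonneg_left (hs z) (by positivity)
  have := key Finset.univ
  rw [← eq_sum_nsmul_single, Finset.sum_neg_distrib, ← Finset.sum_mul] at this
  simpa [stepCount] using this

/-- The last term of an ergodic sum is negligible. -/
lemma ae_tendsto_iterate_div_zero {S : Ω → Ω} (hS : MeasurePreserving S P P) {f : Ω → ℝ}
    (hfm : Measurable f) (hf : Integrable f P) :
    ∀ᵐ ω ∂P, Tendsto (fun n : ℕ => f (S^[n] ω) / n) atTop (𝓝 0) := by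
  obtain ⟨B, -, hB, -⟩ := birkhoff hS hfm hf
  filter_upwards [hB] with ω hω
  have h1 := (tendsto_add_atTop_iff_nat 1).2 hω
  have h2 : Tendsto (fun n : ℕ => ((n + 1 : ℕ) : ℝ) / n) atTop (𝓝 1) := by
    have := (tendsto_const_div_atTop_nhds_zero_nat (1 : ℝ)).const_add 1
    rw [add_zero] at this
    refine this.congr' ?_
    filter_upwards [eventually_ge_atTop 1] with n hn
    have : (n : ℝ) ≠ 0 := by positivity
    push_cast; field_simp
  have h3 := (h1.mul h2).sub hω
  rw [mul_one, sub_self] at h3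
  refine h3.congr' ?_
  filter_upwards [eventually_ge_atTop 1] with n hn
  have : (n : ℝ) ≠ 0 := by positivity
  rw [Finset.sum_range_succ]
  push_cast
  field_simp
  ring

/-- The event that the upper growth rate along `k` is at most `c`. -/
def growthLE (a : (R → ℕ) → Ω → ℝ) (k : R → ℕ) (c : ℝ) : Set Ω :=
  ⋂ i : ℕ, {ω | ∀ᶠ j : ℕ in atTop, a (j • k) ω ≤ (c + 1 / ((i : ℝ) + 1)) * j}

omit [IsProbabilityMeasure P] in
lemma IsSuperadditiveField.measurableSet_growthLE (ha : IsSuperadditiveField P T G a)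
    (k : R → ℕ) (c : ℝ) : MeasurableSet (growthLE a k c) := by
  refine MeasurableSet.iInter fun i => ?_
  simp only [eventually_atTop, ofPred_exists, ofPred_forall]
  exact MeasurableSet.iUnion fun N => MeasurableSet.iInter fun j => MeasurableSet.iInter fun _ =>
    measurableSet_le (ha.measurable _) measurable_const

/-- If `k` uses every step, then a path along `k` may start with any given step, so that its
growth rate is invariant under the action. -/
lemma IsSuperadditiveField.measure_growthLE (ha : IsSuperadditiveField P T G a)
    (hT : IsErgodicSystem R P T) {k : R → ℕ} (hk : ∀ z, 1 ≤ k z) (c : ℝ) :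
    P (growthLE a k c) = 0 ∨ P (growthLE a k c) = 1 := by
  refine hT.measure_eq_zero_or_one (ha.measurableSet_growthLE k c) fun z => ?_
  set e : R → ℕ := Pi.single z 1
  have hek : e ≤ k := fun y => by
    by_cases hy : y = z
    · subst hy; simp [e, hk y]
    · simp [e, hy]
  have h1 := ae_tendsto_iterate_div_zero (hT.measurePreserving (displacement k))
    (ha.measurable (k - e)) (ha.integrable (k - e))
  have h2 := (hT.measurePreserving (step z)).quasiMeasurePreserving.ae h1
  filter_upwards [h2] with ω hω hmem
  simp only [growthLE, mem_iInter, mem_ofPred_eq] at hmem ⊢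
  intro i
  set ε : ℝ := 1 / ((i : ℝ) + 1)
  have hε : 0 < ε := by positivity
  obtain ⟨i', hi'⟩ : ∃ i' : ℕ, 1 / ((i' : ℝ) + 1) < ε / 3 := exists_nat_one_div_lt (by positivity)
  have hsmall : Tendsto (fun j : ℕ => (c + ε / 3 - a e ω) / (j : ℝ)) atTop (𝓝 0) :=
    tendsto_const_div_atTop_nhds_zero_nat _
  filter_upwards [(tendsto_add_atTop_nat 1).eventually (hmem i'), eventually_ge_atTop 1,
    hω.eventually_const_lt (show -(ε / 3) < 0 by linarith),
    hsmall.eventually_lt_const (show (0 : ℝ) < ε / 3 by linarith)] with j hj hj1 hj2 hj3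
  have hj0 : (0 : ℝ) < j := by exact_mod_cast hj1
  rw [lt_div_iff₀ hj0] at hj2
  rw [div_lt_iff₀ hj0] at hj3
  have h3 := ha.add_le e (j • k) ω
  have h4 := ha.add_le (e + j • k) (k - e) ω
  have h5 : e + j • k + (k - e) = (j + 1) • k := by
    rw [add_right_comm, add_tsub_cancel_of_le hek, succ_nsmul, add_comm]
  have h6 : T (displacement (e + j • k)) ω = (T (displacement k))^[j] (T (step z) ω) := by
    rw [hT.iterate, displacement_add, displacement_single, displacement_nsmul, add_comm, hT.map_add]
    rfl
  rw [h5, h6] at h4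
  rw [displacement_single] at h3
  push_cast at hj
  have h7 : (c + 1 / ((i' : ℝ) + 1)) * (j + 1) ≤ (c + ε / 3) * (j + 1) := by
    refine mul_le_mul_of_nonneg_right (by linarith) (by positivity)
  nlinarith

/-- A pathwise linear upper bound for the field, uniform over the directions. -/
def LinearlyBoundedAbove (a : (R → ℕ) → Ω → ℝ) (ω : Ω) : Prop :=
  ∃ C : ℝ, ∃ N : ℕ, ∀ m : R → ℕ, N ≤ stepCount m → a m ω ≤ C * stepCount m

omit [MeasurableSpace Ω] in
lemma LinearlyBoundedAbove.eventually_le {ω : Ω} {C : ℝ} {N : ℕ}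
    (h : ∀ m : R → ℕ, N ≤ stepCount m → a m ω ≤ C * stepCount m) {k : R → ℕ}
    (hk : 1 ≤ stepCount k) {j : ℕ} (hj : N ≤ j) : a (j • k) ω ≤ C * (j * stepCount k) := by
  have := h (j • k) (by rw [stepCount_nsmul]; nlinarith)
  rw [stepCount_nsmul] at this
  exact_mod_cast this

/-- The growth along `k` is bounded pathwise, hence by a deterministic constant as the events
`growthLE a k c` are trivial; a deterministic bound for the growth bounds the means. -/
lemma IsSuperadditiveField.exists_integral_le_of_pos [Nonempty R]
    (ha : IsSuperadditiveField P T G a)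
    (hT : IsErgodicSystem R P T) (hup : ∀ᵐ ω ∂P, LinearlyBoundedAbove a ω) {k : R → ℕ}
    (hk : ∀ z, 1 ≤ k z) : ∃ c : ℝ, ∀ n : ℕ, ∫ ω, a (n • k) ω ∂P ≤ n * c := by
  have hk1 : 1 ≤ stepCount k := (hk (Classical.arbitrary R)).trans (le_stepCount k _)
  obtain ⟨c, hc⟩ : ∃ c : ℕ, P (growthLE a k c) = 1 := by
    by_contra hcon
    push Not at hcon
    have h0 : ∀ᵐ ω ∂P, ∀ c : ℕ, ω ∉ growthLE a k c := ae_all_iff.2 fun c =>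
      measure_eq_zero_iff_ae_notMem.1 ((ha.measure_growthLE hT hk c).resolve_right (hcon c))
    obtain ⟨ω, hω, C, N, hC⟩ := (h0.and hup).exists
    obtain ⟨c, hc⟩ := exists_nat_ge (C * stepCount k)
    refine hω c (mem_iInter.2 fun i => ?_)
    filter_upwards [eventually_ge_atTop N] with j hj
    have h1 := LinearlyBoundedAbove.eventually_le hC hk1 hj
    have h2 : (0 : ℝ) < 1 / ((i : ℝ) + 1) := by positivity
    have h3 : (0 : ℝ) ≤ j := by positivity
    nlinarith
  refine ⟨c + 1, fun n => ?_⟩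
  refine integral_le_of_eventually_le (a := fun n => a (n • k))
    (hT.measurePreserving (displacement k)) (fun n => ha.measurable _)
    (fun n => ha.integrable _) (fun ω => by simp [ha.zero]) (ha.superadditive_nsmul hT k) ?_ n
  have hc' := (prob_compl_eq_zero_iff (ha.measurableSet_growthLE k c)).2 hc
  filter_upwards [measure_eq_zero_iff_ae_notMem.1 hc'] with ω hω
  rw [notMem_compl_iff, growthLE, mem_iInter] at hω
  filter_upwards [hω 0] with n hn
  simp only [Nat.cast_zero, zero_add, div_one] at hn
  linarith

/-- The general case is reduced to count vectors that use every step, by adding one step of each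
kind. -/
lemma IsSuperadditiveField.exists_integral_le [Nonempty R] (ha : IsSuperadditiveField P T G a)
    (hT : IsErgodicSystem R P T) (hup : ∀ᵐ ω ∂P, LinearlyBoundedAbove a ω) (k : R → ℕ) :
    ∃ c : ℝ, ∀ n : ℕ, ∫ ω, a (n • k) ω ∂P ≤ n * c := by
  obtain ⟨c, hc⟩ := ha.exists_integral_le_of_pos hT hup (k := k + 1) (fun z => by simp)
  refine ⟨c - ∫ ω, a 1 ω ∂P, fun n => ?_⟩
  have h1 := ha.integral_add_le hT (n • k) (n • 1)
  have h2 := ha.mul_integral_le hT 1 n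
  rw [← smul_add] at h1
  have := hc n
  linarith

/-- The growth rate of the mean of the field along `k`. The limit exists for a superadditive field
with a linear upper bound, see `IsSuperadditiveField.tendsto_growthRate`. -/
def growthRate (P : Measure Ω) (a : (R → ℕ) → Ω → ℝ) (k : R → ℕ) : ℝ :=
  limUnder atTop fun n : ℕ => (∫ ω, a (n • k) ω ∂P) / n

section

variable [Nonempty R] (ha : IsSuperadditiveField P T G a) (hT : IsErgodicSystem R P T)
  (hup : ∀ᵐ ω ∂P, LinearlyBoundedAbove a ω)

include ha hT hup

lemma IsSuperadditiveField.tendsto_growthRate (k : R → ℕ) :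
    Tendsto (fun n : ℕ => (∫ ω, a (n • k) ω ∂P) / n) atTop (𝓝 (growthRate P a k)) := by
  obtain ⟨c, hc⟩ := ha.exists_integral_le hT hup k
  have hs : Subadditive fun n : ℕ => -∫ ω, a (n • k) ω ∂P := fun m n => by
    have := ha.integral_add_le hT (m • k) (n • k)
    rw [← add_smul] at this
    linarith
  have hb : BddBelow (range fun n : ℕ => (-∫ ω, a (n • k) ω ∂P) / n) := by
    refine ⟨-|c|, ?_⟩
    rintro _ ⟨n, rfl⟩
    rcases Nat.eq_zero_or_pos n with rfl | hn
    · simp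
    · have : (0 : ℝ) < n := by exact_mod_cast hn
      dsimp only
      rw [le_div_iff₀ this]
      nlinarith [hc n, le_abs_self c]
  have h1 := (hs.tendsto_lim hb).neg
  have h2 : Tendsto (fun n : ℕ => (∫ ω, a (n • k) ω ∂P) / n) atTop (𝓝 (-hs.lim)) :=
    h1.congr fun n => by rw [neg_div, neg_neg]
  exact tendsto_nhds_limUnder ⟨_, h2⟩

lemma IsSuperadditiveField.growthRate_le {k : R → ℕ} {c : ℝ}
    (h : ∀ n : ℕ, ∫ ω, a (n • k) ω ∂P ≤ n * c) : growthRate P a k ≤ c := by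
  refine le_of_tendsto (ha.tendsto_growthRate hT hup k) ?_
  filter_upwards [eventually_ge_atTop 1] with n hn
  rw [div_le_iff₀ (by exact_mod_cast hn)]
  linarith [h n]

lemma IsSuperadditiveField.growthRate_nsmul (k : R → ℕ) {p : ℕ} (hp : 1 ≤ p) :
    growthRate P a (p • k) = p * growthRate P a k := by
  have h1 := (ha.tendsto_growthRate hT hup k).comp
    (tendsto_id.atTop_mul_const' (show 0 < p by omega))
  have h2 := h1.const_mul (p : ℝ)
  refine tendsto_nhds_unique (ha.tendsto_growthRate hT hup (p • k)) (h2.congr fun n => ?_)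
  have : (p : ℝ) ≠ 0 := by positivity
  simp only [Function.comp_apply, id, smul_smul, Nat.cast_mul]
  rcases Nat.eq_zero_or_pos n with rfl | hn
  · simp
  · have : (n : ℝ) ≠ 0 := by positivity
    field_simp

lemma IsSuperadditiveField.integral_le_growthRate (k : R → ℕ) :
    ∫ ω, a k ω ∂P ≤ growthRate P a k := by
  refine ge_of_tendsto (ha.tendsto_growthRate hT hup k) ?_
  filter_upwards [eventually_ge_atTop 1] with n hn
  rw [le_div_iff₀ (by exact_mod_cast hn), mul_comm]
  exact ha.mul_integral_le hT k n

lemma IsSuperadditiveField.growthRate_add_le (k k' : R → ℕ) :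
    growthRate P a k + growthRate P a k' ≤ growthRate P a (k + k') := by
  refine le_of_tendsto_of_tendsto ((ha.tendsto_growthRate hT hup k).add
    (ha.tendsto_growthRate hT hup k')) (ha.tendsto_growthRate hT hup (k + k')) ?_
  refine Eventually.of_forall fun n => ?_
  dsimp only
  rw [← add_div, smul_add]
  gcongr
  exact ha.integral_add_le hT _ _

lemma IsSuperadditiveField.neg_mul_le_growthRate (k : R → ℕ) :
    -(stepCount k * ∫ ω, G ω ∂P) ≤ growthRate P a k :=
  (ha.neg_mul_le_integral hT k).trans (ha.integral_le_growthRate hT hup k)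

/-- Along every count vector the field grows linearly, almost surely. -/
theorem IsSuperadditiveField.ae_exists_tendsto (k : R → ℕ) :
    ∀ᵐ ω ∂P, ∃ L : ℝ, Tendsto (fun n : ℕ => a (n • k) ω / n) atTop (𝓝 L) := by
  obtain ⟨c, hc⟩ := ha.exists_integral_le hT hup k
  obtain ⟨L, -, hL, -, -⟩ := kingman_real (a := fun n => a (n • k))
    (hT.measurePreserving (displacement k)) (fun n => ha.measurable _)
    (fun n => ha.integrable _) (fun ω => by simp [ha.zero]) (ha.superadditive_nsmul hT k) hc
  exact hL.mono fun ω h => ⟨_, h⟩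

/-- If `k` uses every step, then the growth rate along `k` is not random. -/
theorem IsSuperadditiveField.ae_tendsto_growthRate {k : R → ℕ} (hk : ∀ z, 1 ≤ k z) :
    ∀ᵐ ω ∂P, Tendsto (fun n : ℕ => a (n • k) ω / n) atTop (𝓝 (growthRate P a k)) := by
  obtain ⟨c, hc⟩ := ha.exists_integral_le hT hup k
  obtain ⟨L, hLi, hL, h1, h2⟩ := kingman_real (a := fun n => a (n • k))
    (hT.measurePreserving (displacement k)) (fun n => ha.measurable _)
    (fun n => ha.integrable _) (fun ω => by simp [ha.zero]) (ha.superadditive_nsmul hT k) hc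
  have hI : ∫ ω, L ω ∂P = growthRate P a k := by
    refine le_antisymm (h2 _ fun n => ?_) (ha.growthRate_le hT hup h1)
    rcases Nat.eq_zero_or_pos n with rfl | hn
    · simp [ha.zero]
    · rw [← ha.growthRate_nsmul hT hup k hn]
      exact ha.integral_le_growthRate hT hup _
  have hiff : ∀ c : ℝ, ∀ᵐ ω ∂P, ω ∈ growthLE a k c ↔ L ω ≤ c := by
    intro c
    filter_upwards [hL] with ω hω
    simp only [growthLE, mem_iInter, mem_ofPred_eq]
    constructor
    · intro h
      have h3 := (tendsto_one_div_add_atTop_nhds_zero_nat (𝕜 := ℝ)).const_add c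
      rw [add_zero] at h3
      refine ge_of_tendsto h3 (Eventually.of_forall fun i => le_of_tendsto hω ?_)
      filter_upwards [h i, eventually_ge_atTop 1] with j hj hj1
      rwa [div_le_iff₀ (by exact_mod_cast hj1)]
    · intro h i
      have h4 : L ω < c + 1 / ((i : ℝ) + 1) := by
        have : (0 : ℝ) < 1 / ((i : ℝ) + 1) := by positivity
        linarith
      filter_upwards [hω.eventually_lt_const h4, eventually_ge_atTop 1] with j hj hj1
      rw [div_lt_iff₀ (by exact_mod_cast hj1)] at hj
      exact hj.le
  have hconst := ae_eq_integral_of_trivial_sublevel hLi fun c => by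
    rcases ha.measure_growthLE hT hk c with h | h
    · right
      filter_upwards [measure_eq_zero_iff_ae_notMem.1 h, hiff c] with ω h3 h4
      rw [h4] at h3
      exact not_le.1 h3
    · left
      have hc' := (prob_compl_eq_zero_iff (ha.measurableSet_growthLE k c)).2 h
      filter_upwards [measure_eq_zero_iff_ae_notMem.1 hc', hiff c] with ω h3 h4
      rw [notMem_compl_iff] at h3
      exact h4.1 h3
  filter_upwards [hL, hconst] with ω h3 h4
  rwa [h4, hI] at h3

end

end Growth

/-! ### Pathwise comparison along almost parallel count vectors -/

section Pathwise

variable {d : ℕ} {R : Finset (Fin d → ℤ)} {Ω : Type*} [MeasurableSpace Ω] {P : Measure Ω}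
  {T : LatticeGroup R → Ω → Ω} {G : Ω → ℝ} {a : (R → ℕ) → Ω → ℝ}

/-- The sample points at which the field has all the almost sure properties that the pathwise
arguments use. -/
structure IsRegularAt (P : Measure Ω) (T : LatticeGroup R → Ω → Ω) (G : Ω → ℝ)
    (a : (R → ℕ) → Ω → ℝ) (ω : Ω) : Prop where
  sublinear : SublinearOnLines T G ω
  bounded : LinearlyBoundedAbove a ω
  exists_tendsto : ∀ k : R → ℕ, ∃ L : ℝ, Tendsto (fun n : ℕ => a (n • k) ω / n) atTop (𝓝 L)
  tendsto : ∀ k : R → ℕ, (∀ z, 1 ≤ k z) →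
    Tendsto (fun n : ℕ => a (n • k) ω / n) atTop (𝓝 (growthRate P a k))

lemma IsSuperadditiveField.ae_isRegularAt [IsProbabilityMeasure P] [Nonempty R]
    (ha : IsSuperadditiveField P T G a) (hT : IsErgodicSystem R P T)
    (hup : ∀ᵐ ω ∂P, LinearlyBoundedAbove a ω) : ∀ᵐ ω ∂P, IsRegularAt P T G a ω := by
  have h1 : ∀ᵐ ω ∂P, ∀ k : R → ℕ, ∃ L : ℝ,
      Tendsto (fun n : ℕ => a (n • k) ω / n) atTop (𝓝 L) :=
    ae_all_iff.2 fun k => ha.ae_exists_tendsto hT hup k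
  have h2 : ∀ᵐ ω ∂P, ∀ k : R → ℕ, (∀ z, 1 ≤ k z) →
      Tendsto (fun n : ℕ => a (n • k) ω / n) atTop (𝓝 (growthRate P a k)) :=
    ae_all_iff.2 fun k => by
      by_cases hk : ∀ z, 1 ≤ k z
      · filter_upwards [ha.ae_tendsto_growthRate hT hup hk] with ω h _ using h
      · exact Eventually.of_forall fun ω h => absurd h hk
  filter_upwards [ha.sublinear, hup, h1, h2] with ω h3 h4 h5 h6 using ⟨h3, h4, h5, h6⟩

/-- The growth rates are bounded by a multiple of the number of steps, uniformly in the
direction. -/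
lemma IsRegularAt.exists_abs_le {ω : Ω} (hω : IsRegularAt P T G a ω)
    (ha : IsSuperadditiveField P T G a) (hT0 : T 0 = id) :
    ∃ C : ℝ, 0 ≤ C ∧ ∀ (k : R → ℕ) (L : ℝ), 1 ≤ stepCount k →
      Tendsto (fun n : ℕ => a (n • k) ω / n) atTop (𝓝 L) → |L| ≤ C * stepCount k := by
  obtain ⟨C₁, hC₁, N₁, h₁⟩ := ha.exists_ge_neg_mul hT0 hω.sublinear
  obtain ⟨C₂, N₂, h₂⟩ := hω.bounded
  refine ⟨max C₁ |C₂|, le_max_of_le_left hC₁, fun k L hk hL => ?_⟩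
  have hs : (0 : ℝ) ≤ stepCount k := by positivity
  rw [abs_le]
  constructor
  · refine le_trans ?_ (ge_of_tendsto (b := -(C₁ * stepCount k)) hL ?_)
    · rw [neg_le_neg_iff]; gcongr; exact le_max_left _ _
    · filter_upwards [eventually_ge_atTop (max N₁ 1)] with n hn
      have hn1 : 1 ≤ n := (le_max_right _ _).trans hn
      have := h₁ (n • k) (by rw [stepCount_nsmul]; nlinarith [(le_max_left N₁ 1).trans hn])
      rw [le_div_iff₀ (by exact_mod_cast hn1)]
      rw [stepCount_nsmul] at this
      push_cast at this
      linarith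
  · refine le_trans (le_of_tendsto (b := C₂ * stepCount k) hL ?_) ?_
    · filter_upwards [eventually_ge_atTop (max N₂ 1)] with n hn
      have hn1 : 1 ≤ n := (le_max_right _ _).trans hn
      have := LinearlyBoundedAbove.eventually_le h₂ hk ((le_max_left N₂ 1).trans hn)
      rw [div_le_iff₀ (by exact_mod_cast hn1)]
      linarith
    · gcongr
      exact (le_abs_self _).trans (le_max_right _ _)

lemma cauchySeq_of_forall_exists_eventually {u : ℕ → ℝ}
    (h : ∀ ε > 0, ∃ c : ℝ, ∀ᶠ n in atTop, |u n - c| ≤ ε) : CauchySeq u := by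
  refine Metric.cauchySeq_iff'.2 fun ε hε => ?_
  obtain ⟨c, hc⟩ := h (ε / 3) (by positivity)
  obtain ⟨N, hN⟩ := eventually_atTop.1 hc
  refine ⟨N, fun n hn => ?_⟩
  rw [Real.dist_eq]
  have h1 := abs_le.1 (hN n hn)
  have h2 := abs_le.1 (hN N le_rfl)
  rw [abs_lt]
  constructor <;> linarith

set_option maxHeartbeats 1000000 in
/-- Along count vectors that follow a fixed direction `β` the field has a growth rate: such a
vector lies between multiples, by factors close to one another, of an earlier one. -/
theorem IsRegularAt.exists_tendsto_of_direction {ω : Ω} (hω : IsRegularAt P T G a ω)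
    (ha : IsSuperadditiveField P T G a) (hT0 : T 0 = id) {β : R → ℝ} (hβ : ∀ z, 0 ≤ β z)
    {m : ℕ → R → ℕ} (hm : ∀ n, stepCount (m n) = n) (hmβ : ∀ n z, |(m n z : ℝ) - n * β z| ≤ 1)
    (hsupp : ∀ n z, β z = 0 → m n z = 0) :
    ∃ L : ℝ, Tendsto (fun n : ℕ => a (m n) ω / n) atTop (𝓝 L) := by
  refine cauchySeq_tendsto_of_complete (cauchySeq_of_forall_exists_eventually fun ε₀ hε₀ => ?_)
  obtain ⟨C, hC0, hC⟩ := hω.exists_abs_le ha hT0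
  set ε := ε₀ / 3
  have hε : 0 < ε := by positivity
  obtain ⟨η, hη, N₁, hcmp⟩ := ha.exists_le_of_le hT0 hω.sublinear 2 hε
  obtain ⟨θ, hθ0, hθ1, hθη, hθC⟩ : ∃ θ > 0, θ ≤ 1 ∧ θ ≤ η / 2 ∧ θ * C ≤ ε := by
    refine ⟨min 1 (min (η / 2) (ε / (C + 1))), by positivity, min_le_left _ _,
      (min_le_right _ _).trans (min_le_left _ _), ?_⟩
    have : min 1 (min (η / 2) (ε / (C + 1))) ≤ ε / (C + 1) :=
      (min_le_right _ _).trans (min_le_right _ _)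
    calc _ ≤ ε / (C + 1) * C := by gcongr
      _ ≤ ε / (C + 1) * (C + 1) := by gcongr; linarith
      _ = ε := by field_simp
  -- `b` is the smallest positive weight; `N` is so large that, on the support of `β`, the rounding
  -- error of `m N` is small compared with `m N` itself.
  obtain ⟨b, hb0, hb⟩ : ∃ b > 0, ∀ z, β z = 0 ∨ b ≤ β z := by
    by_cases hne : (Finset.univ.filter fun z => β z ≠ 0).Nonempty
    · obtain ⟨z₀, hz₀, hmin⟩ := Finset.exists_min_image _ β hne
      rw [Finset.mem_filter] at hz₀
      refine ⟨β z₀, lt_of_le_of_ne (hβ z₀) (Ne.symm hz₀.2), fun z => ?_⟩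
      by_cases hz : β z = 0
      · exact Or.inl hz
      · exact Or.inr (hmin z (by simp [hz]))
    · rw [Finset.not_nonempty_iff_eq_empty, Finset.filter_eq_empty_iff] at hne
      exact ⟨1, one_pos, fun z => Or.inl (not_not.1 (hne (Finset.mem_univ z)))⟩
  obtain ⟨N₀, hN₀⟩ := exists_nat_gt ((2 / θ + 1) / b)
  set N := max N₀ 1
  have hN1 : 1 ≤ N := le_max_right _ _
  have hNr : (0 : ℝ) < N := by exact_mod_cast hN1
  have hNb : 2 ≤ θ * (N * b - 1) := by
    have h1 : (N₀ : ℝ) ≤ N := by exact_mod_cast le_max_left _ _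
    rw [div_lt_iff₀ hb0] at hN₀
    have h2 : 2 / θ ≤ N * b - 1 := by linarith [mul_le_mul_of_nonneg_right h1 hb0.le]
    rw [div_le_iff₀ hθ0] at h2
    linarith
  set k := m N
  obtain ⟨L, hL⟩ := hω.exists_tendsto k
  have hLC : |L / N| ≤ C := by
    have := hC k L (by rw [hm]; exact hN1) hL
    rw [hm] at this
    rw [abs_div, abs_of_pos hNr, div_le_iff₀ hNr]
    exact this
  have hθL : |θ * (L / N)| ≤ ε := by
    rw [abs_mul, abs_of_pos hθ0]
    exact (mul_le_mul_of_nonneg_left hLC hθ0.le).trans hθC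
  -- growth along real multiples of `k`
  have hlim : ∀ (J : ℕ → ℕ) (t : ℝ), 0 ≤ t → Tendsto J atTop atTop →
      Tendsto (fun n : ℕ => (J n : ℝ) / n) atTop (𝓝 t) →
      Tendsto (fun n : ℕ => a (J n • k) ω / n) atTop (𝓝 (L * t)) := by
    intro J t ht hJ hJt
    refine ((hL.comp hJ).mul hJt).congr' ?_
    filter_upwards [hJ.eventually_ge_atTop 1] with n hn
    have : (J n : ℝ) ≠ 0 := by positivity
    simp only [Function.comp_apply]
    field_simp
  have hJu : Tendsto (fun n : ℕ => ⌈(1 + θ) / N * n⌉₊) atTop atTop :=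
    tendsto_nat_ceil_atTop.comp (tendsto_natCast_atTop_atTop.const_mul_atTop (by positivity))
  have hup := hlim (fun n => ⌈(1 + θ) / N * n⌉₊) ((1 + θ) / N) (by positivity) hJu
    ((tendsto_nat_ceil_mul_div_atTop (by positivity)).comp tendsto_natCast_atTop_atTop)
  have hlo : Tendsto (fun n : ℕ => a (⌊(1 - θ) / N * n⌋₊ • k) ω / n) atTop
      (𝓝 (L * ((1 - θ) / N))) := by
    rcases hθ1.eq_or_lt with h1 | h1
    · simp [h1, ha.zero]
    · have h1' : 0 < 1 - θ := by linarith
      refine hlim (fun n => ⌊(1 - θ) / N * n⌋₊) ((1 - θ) / N) (by positivity) ?_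
        ((tendsto_nat_floor_mul_div_atTop (by positivity)).comp tendsto_natCast_atTop_atTop)
      exact tendsto_nat_floor_atTop.comp
        (tendsto_natCast_atTop_atTop.const_mul_atTop (by positivity))
  obtain ⟨N₂, hN₂⟩ := exists_nat_gt (N / (η / 2))
  refine ⟨L / N, ?_⟩
  have hθL' := abs_le.1 hθL
  have e1 : L * ((1 + θ) / N) = L / N + θ * (L / N) := by ring
  have e2 : L * ((1 - θ) / N) = L / N - θ * (L / N) := by ring
  filter_upwards [hup.eventually_lt_const (show L * ((1 + θ) / N) < L / N + 2 * ε by linarith),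
    hlo.eventually_const_lt (show L / N - 2 * ε < L * ((1 - θ) / N) by linarith),
    eventually_ge_atTop (max (max N N₁) N₂)] with n hn1 hn2 hn3
  have hnN : N ≤ n := ((le_max_left _ _).trans (le_max_left _ _)).trans hn3
  have hnN₁ : N₁ ≤ n := ((le_max_right _ _).trans (le_max_left _ _)).trans hn3
  have hnN' : (N : ℝ) ≤ n := by exact_mod_cast hnN
  have hn0 : (0 : ℝ) < n := lt_of_lt_of_le hNr hnN'
  have hNη : (N : ℝ) ≤ η / 2 * n := by
    have h1 : (N₂ : ℝ) ≤ n := by exact_mod_cast (le_max_right _ _).trans hn3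
    rw [div_lt_iff₀ (by positivity)] at hN₂
    linarith [mul_le_mul_of_nonneg_right h1 (half_pos hη).le]
  have hnN1 : 1 ≤ (n : ℝ) / N := by rwa [one_le_div hNr]
  have hkz := fun z => abs_le.1 (hmβ N z)
  have hmz := fun z => abs_le.1 (hmβ n z)
  -- the two bracketing multiples
  have hu : a (m n) ω ≤ a (⌈(1 + θ) / N * n⌉₊ • k) ω + ε * n := by
    have hj1 := Nat.le_ceil ((1 + θ) / N * n)
    have hj2 := (Nat.ceil_lt_add_one (show 0 ≤ (1 + θ) / N * n by positivity)).le
    set j := ⌈(1 + θ) / N * n⌉₊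
    refine hcmp n hnN₁ _ _ (fun z => ?_) (by rw [hm]; linarith) ?_
    · rcases hb z with hz | hz
      · simp [hsupp n z hz]
      · have h1 : (m n z : ℝ) ≤ j * (k z : ℝ) := by
          have h2 : (N : ℝ) * β z - 1 ≤ k z := by linarith [(hkz z).1]
          have h3 : (N : ℝ) * b ≤ N * β z := by gcongr
          have h5 : θ * (N * b) ≤ θ * (N * β z) := by gcongr
          have h4 : 0 ≤ (N : ℝ) * β z - 1 := by
            have h6 : 0 < N * b - 1 := by
              by_contra h
              linarith [mul_nonpos_of_nonneg_of_nonpos hθ0.le (not_lt.1 h)]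
            linarith
          calc (m n z : ℝ) ≤ n * β z + n / N := by linarith [(hmz z).2]
            _ = (n / N) * (N * β z + 1) := by field_simp
            _ ≤ (n / N) * ((1 + θ) * (N * β z - 1)) := by
                refine mul_le_mul_of_nonneg_left ?_ (by positivity)
                linarith
            _ = (1 + θ) / N * n * (N * β z - 1) := by ring
            _ ≤ j * (k z : ℝ) := by gcongr
        simp only [Pi.smul_apply, smul_eq_mul]
        exact_mod_cast h1
    · rw [stepCount_nsmul, hm, hm]
      push_cast
      calc (j : ℝ) * N ≤ ((1 + θ) / N * n + 1) * N := by gcongr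
        _ = n + θ * n + N := by field_simp
        _ ≤ n + η / 2 * n + η / 2 * n := by gcongr
        _ = n + η * n := by ring
  have hl : a (⌊(1 - θ) / N * n⌋₊ • k) ω ≤ a (m n) ω + ε * n := by
    have h1θ : 0 ≤ 1 - θ := by linarith
    have hj1 := Nat.floor_le (show 0 ≤ (1 - θ) / N * n by positivity)
    have hj2 := (Nat.lt_floor_add_one ((1 - θ) / N * n)).le
    set j := ⌊(1 - θ) / N * n⌋₊
    have hjN : (j : ℝ) * N ≤ (1 - θ) * n := by
      calc (j : ℝ) * N ≤ (1 - θ) / N * n * N := by gcongr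
        _ = (1 - θ) * n := by field_simp
    refine hcmp n hnN₁ _ _ (fun z => ?_) ?_ ?_
    · rcases hb z with hz | hz
      · simp [k, hsupp N z hz]
      · have h1 : (j : ℝ) * (k z : ℝ) ≤ m n z := by
          have h2 : (k z : ℝ) ≤ N * β z + 1 := by linarith [(hkz z).2]
          have h3 : (N : ℝ) * b ≤ N * β z := by gcongr
          have h4 : 0 ≤ (N : ℝ) * β z + 1 := by have := hβ z; positivity
          have h5 : θ * (N * b) ≤ θ * (N * β z) := by gcongr
          calc (j : ℝ) * k z ≤ (1 - θ) / N * n * (N * β z + 1) := by gcongr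
            _ = (n / N) * ((1 - θ) * (N * β z + 1)) := by ring
            _ ≤ (n / N) * (N * β z - 1) := by
                refine mul_le_mul_of_nonneg_left ?_ (by positivity)
                linarith
            _ = n * β z - n / N := by field_simp
            _ ≤ m n z := by linarith [(hmz z).1]
        simp only [Pi.smul_apply, smul_eq_mul]
        exact_mod_cast h1
    · rw [stepCount_nsmul, hm]
      push_cast
      linarith [mul_nonneg hθ0.le hn0.le]
    · rw [stepCount_nsmul, hm, hm]
      push_cast
      have : (1 - θ) * n ≤ j * N + N := by
        calc (1 - θ) * n = (1 - θ) / N * n * N := by field_simp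
          _ ≤ (j + 1) * N := by gcongr
          _ = j * N + N := by ring
      linarith [mul_le_mul_of_nonneg_right hθη hn0.le]
  rw [div_lt_iff₀ hn0] at hn1
  rw [lt_div_iff₀ hn0] at hn2
  have e3 : ε₀ = 3 * ε := by simp only [ε]; ring
  rw [abs_le, e3]
  constructor
  · rw [neg_le_sub_iff_le_add, ← sub_le_iff_le_add, le_div_iff₀ hn0]; linarith
  · rw [sub_le_iff_le_add, div_le_iff₀ hn0]; linarith

/-- The growth rate per step along a count vector. -/
def velocityRate (P : Measure Ω) (a : (R → ℕ) → Ω → ℝ) (k : R → ℕ) : ℝ :=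
  growthRate P a k / stepCount k

/-- The mean velocity of a path with given step counts. -/
def velocity (k : R → ℕ) : EuclideanSpace ℝ (Fin d) :=
  (stepCount k : ℝ)⁻¹ • toEuclid (displacement k).1

set_option maxHeartbeats 1000000 in
/-- The key upper bound: uniformly over all count vectors with `n` steps, the field is at most
`n` times the rate of some direction that uses every step, and which can be taken close to the
given one. -/
theorem IsRegularAt.exists_rate_ge [Nonempty R] {ω : Ω} (hω : IsRegularAt P T G a ω)
    (ha : IsSuperadditiveField P T G a) (hT0 : T 0 = id) {ε₀ : ℝ} (hε₀ : 0 < ε₀) :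
    ∃ N₀ : ℕ, 1 ≤ N₀ ∧ ∀ n ≥ N₀, ∀ m : R → ℕ, stepCount m = n → ∃ k : R → ℕ, (∀ z, 1 ≤ k z) ∧
      a m ω ≤ n * (velocityRate P a k + ε₀) ∧ dist (velocity k) (velocity m) ≤ ε₀ := by
  classical
  obtain ⟨C, hC0, hC⟩ := hω.exists_abs_le ha hT0
  set ε := ε₀ / 5
  have hε : 0 < ε := by positivity
  obtain ⟨η, hη, N₁, hcmp⟩ := ha.exists_le_of_le hT0 hω.sublinear 1 hε
  set r : ℝ := (Fintype.card R : ℝ)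
  have hr0 : 0 ≤ r := by positivity
  set B : ℝ := stepBound R
  have hB0 : 0 ≤ B := stepBound_nonneg
  obtain ⟨N', hN'⟩ := exists_nat_gt (2 * r / η + C * r / ε + (1 + r) * B / ε₀)
  set N := max N' 1
  have hN1 : 1 ≤ N := le_max_right _ _
  have hNr : (1 : ℝ) ≤ N := by exact_mod_cast hN1
  have hN0 : (0 : ℝ) < N := by linarith
  have hNN : 2 * r / η + C * r / ε + (1 + r) * B / ε₀ ≤ N :=
    hN'.le.trans (by exact_mod_cast le_max_left _ _)
  have p1 : 0 ≤ 2 * r / η := by positivity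
  have p2 : 0 ≤ C * r / ε := by positivity
  have p3 : 0 ≤ (1 + r) * B / ε₀ := by positivity
  have hNη : 2 * r ≤ η * N := by
    have : 2 * r / η ≤ N := by linarith
    rw [div_le_iff₀ hη] at this; linarith
  have hNC : C * r ≤ ε * N := by
    have : C * r / ε ≤ N := by linarith
    rw [div_le_iff₀ hε] at this; linarith
  have hNB : (1 + r) * B ≤ ε₀ * N := by
    have : (1 + r) * B / ε₀ ≤ N := by linarith
    rw [div_le_iff₀ hε₀] at this; linarith
  -- The count vector `k` below has entries at most `N + 1`, so that it is one of finitely many.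
  have hfam : ∀ᶠ j : ℕ in atTop, ∀ k ∈ Fintype.piFinset fun _ : R => Finset.Icc 1 (N + 1),
      a (j • k) ω / j < growthRate P a k + ε := by
    rw [Filter.eventually_all_finset]
    intro k hk
    refine (hω.tendsto k fun z => ?_).eventually_lt_const (by linarith)
    exact (Finset.mem_Icc.1 (Fintype.mem_piFinset.1 hk z)).1
  obtain ⟨J, hJ⟩ := eventually_atTop.1 hfam
  obtain ⟨N₂, hN₂⟩ := exists_nat_gt (2 * (N + r) / η + C * (N + r) / ε)
  have q1 : 0 ≤ 2 * (N + r) / η := by positivity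
  have q2 : 0 ≤ C * (N + r) / ε := by positivity
  refine ⟨max (max N₁ N₂) (max (N * J) N), le_max_of_le_right (le_max_of_le_right hN1),
    fun n hn m hm => ?_⟩
  have hnN₁ : N₁ ≤ n := ((le_max_left _ _).trans (le_max_left _ _)).trans hn
  have hnN₂ : (N₂ : ℝ) ≤ n := by
    exact_mod_cast ((le_max_right _ _).trans (le_max_left _ _)).trans hn
  have hnJ : N * J ≤ n := ((le_max_left _ _).trans (le_max_right _ _)).trans hn
  have hnN : N ≤ n := ((le_max_right _ _).trans (le_max_right _ _)).trans hn
  have hn1 : 1 ≤ n := hN1.trans hnN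
  have hnr : (1 : ℝ) ≤ n := by exact_mod_cast hn1
  have hn0 : (0 : ℝ) < n := by linarith
  have hnη : 2 * (N + r) ≤ η * n := by
    have : 2 * (N + r) / η ≤ n := by linarith
    rw [div_le_iff₀ hη] at this; linarith
  have hnC : C * (N + r) ≤ ε * n := by
    have : C * (N + r) / ε ≤ n := by linarith
    rw [div_le_iff₀ hε] at this; linarith
  -- `k` is `N m / n`, rounded up
  set k : R → ℕ := fun z => N * m z / n + 1
  have hk1 : ∀ z, 1 ≤ k z := fun z => Nat.le_add_left _ _
  have hk_gt : ∀ z, (N : ℝ) * m z ≤ n * k z := fun z => by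
    exact_mod_cast (Nat.lt_mul_div_succ (N * m z) (show 0 < n by omega)).le
  have hk_le : ∀ z, (n : ℝ) * k z ≤ N * m z + n := fun z => by
    have : n * k z ≤ N * m z + n := by
      simp only [k, mul_add, mul_one]
      exact Nat.add_le_add_right (Nat.mul_div_le _ _) _
    exact_mod_cast this
  have hmsum : ∑ z, (m z : ℝ) = n := by rw [← hm, stepCount]; push_cast; rfl
  have hksum : ∑ z, (k z : ℝ) = stepCount k := by rw [stepCount]; push_cast; rfl
  have hK1 : (N : ℝ) ≤ stepCount k := by
    have := Finset.sum_le_sum fun z (_ : z ∈ Finset.univ) => hk_gt z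
    rw [← Finset.mul_sum, ← Finset.mul_sum, hmsum, hksum] at this
    nlinarith
  have hK2 : (stepCount k : ℝ) ≤ N + r := by
    have := Finset.sum_le_sum fun z (_ : z ∈ Finset.univ) => hk_le z
    rw [Finset.sum_add_distrib, ← Finset.mul_sum, ← Finset.mul_sum, hmsum, hksum,
      Finset.sum_const, nsmul_eq_mul, Finset.card_univ] at this
    have h2 : (n : ℝ) * stepCount k ≤ n * (N + r) := by simp only [r]; linarith
    exact le_of_mul_le_mul_left h2 hn0
  have hK0 : (0 : ℝ) < stepCount k := by linarith
  have hKone : 1 ≤ stepCount k := by exact_mod_cast hK0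
  have hrate : |growthRate P a k| ≤ C * stepCount k := hC k _ hKone (hω.tendsto k hk1)
  refine ⟨k, hk1, ?_, ?_⟩
  · set j := n / N + 1
    have hj1 : n ≤ j * N := by
      rw [mul_comm]; exact (Nat.lt_mul_div_succ n (show 0 < N by omega)).le
    have hj2 : j * N ≤ n + N := by
      simp only [j, add_mul, one_mul]; exact Nat.add_le_add_right (Nat.div_mul_le_self _ _) _
    have hj1' : (n : ℝ) ≤ j * N := by exact_mod_cast hj1
    have hj2' : (j : ℝ) * N ≤ n + N := by exact_mod_cast hj2
    have hjJ : J ≤ j := by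
      have : J ≤ n / N := (Nat.le_div_iff_mul_le (by omega)).2 (by rw [mul_comm]; exact hnJ)
      omega
    have hj0 : (0 : ℝ) < j := by simp only [j]; positivity
    have hmem : k ∈ Fintype.piFinset fun _ : R => Finset.Icc 1 (N + 1) := by
      rw [Fintype.mem_piFinset]
      intro z
      rw [Finset.mem_Icc]
      refine ⟨hk1 z, Nat.add_le_add_right ?_ _⟩
      have : m z ≤ n := hm ▸ le_stepCount m z
      calc N * m z / n ≤ N * n / n := Nat.div_le_div_right (by gcongr)
        _ = N := Nat.mul_div_cancel _ (by omega)
    have h1 := hJ j hjJ k hmem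
    rw [div_lt_iff₀ hj0] at h1
    have h2 := hcmp n hnN₁ m (j • k) (fun z => by
      have : (m z : ℝ) ≤ j * k z := by
        have h3 : (N : ℝ) * m z ≤ N * (j * k z) := by
          calc (N : ℝ) * m z ≤ n * k z := hk_gt z
            _ ≤ j * N * k z := by gcongr
            _ = N * (j * k z) := by ring
        exact le_of_mul_le_mul_left h3 hN0
      simp only [Pi.smul_apply, smul_eq_mul]
      exact_mod_cast this) (by rw [hm]; linarith) (by
      rw [stepCount_nsmul, hm]
      push_cast
      have h4 : (j : ℝ) * stepCount k * N ≤ (n + η * n) * N := by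
        calc (j : ℝ) * stepCount k * N = j * N * stepCount k := by ring
          _ ≤ (n + N) * (N + r) := by gcongr
          _ ≤ (n + η * n) * N := by
              linarith [mul_le_mul_of_nonneg_left hNη hn0.le, mul_le_mul_of_nonneg_left hnη hN0.le]
      exact le_of_mul_le_mul_right h4 hN0)
    -- replace `j` by `n / N` and `stepCount k / N` by one
    set lam := growthRate P a k
    have hlam := abs_le.1 hrate
    have hCK : C * stepCount k ≤ C * (N + r) := by gcongr
    have h5 : (j : ℝ) * lam ≤ n * (lam / stepCount k) + 2 * ε * n := by
      have h6 : (j : ℝ) * lam * N ≤ n * lam + ε * n * N := by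
        have h7 : (j * N - n) * lam ≤ N * (C * (N + r)) := by
          calc (j * N - n) * lam ≤ (j * N - n) * (C * (N + r)) := by
                refine mul_le_mul_of_nonneg_left (by linarith) (by linarith)
            _ ≤ N * (C * (N + r)) := by
                refine mul_le_mul_of_nonneg_right (by linarith) (by positivity)
        have h8 : N * (C * (N + r)) ≤ N * (ε * n) := by gcongr
        linarith
      have h9 : n * lam ≤ n * (lam / stepCount k) * N + ε * n * N := by
        set q := lam / stepCount k
        have hq : lam = q * stepCount k := (div_mul_cancel₀ _ hK0.ne').symm
        have hqC : q ≤ C := by rw [div_le_iff₀ hK0]; exact hlam.2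
        have h10 : q * (stepCount k - N) ≤ C * r := by
          calc q * (stepCount k - N) ≤ C * (stepCount k - N) :=
                mul_le_mul_of_nonneg_right hqC (by linarith)
            _ ≤ C * r := mul_le_mul_of_nonneg_left (by linarith) hC0
        have h11 : n * (q * (stepCount k - N)) ≤ n * (ε * N) := by
          refine mul_le_mul_of_nonneg_left (h10.trans hNC) hn0.le
        rw [hq]
        linarith
      have h12 : (j : ℝ) * lam * N ≤ (n * (lam / stepCount k) + 2 * ε * n) * N := by linarith
      exact le_of_mul_le_mul_right h12 hN0
    have h13 : (j : ℝ) * ε ≤ 2 * ε * n := by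
      have : (j : ℝ) ≤ 2 * n := by
        have h14 : (j : ℝ) * 1 ≤ j * N := by gcongr
        have h15 : (N : ℝ) ≤ n := by exact_mod_cast hnN
        linarith
      linarith [mul_le_mul_of_nonneg_right this hε.le]
    have e5 : ε₀ = 5 * ε := by simp only [ε]; ring
    rw [velocityRate, e5]
    linarith
  · rw [dist_eq_norm, velocity, velocity, toEuclid_displacement, toEuclid_displacement,
      Finset.smul_sum, Finset.smul_sum, ← Finset.sum_sub_distrib]
    have hco : ∀ z, |(stepCount k : ℝ)⁻¹ * k z - (n : ℝ)⁻¹ * m z| ≤ (1 + r) / N := by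
      intro z
      have hmz : (m z : ℝ) ≤ n := by exact_mod_cast hm ▸ le_stepCount m z
      have hmz0 : (0 : ℝ) ≤ m z := by positivity
      have e : (stepCount k : ℝ)⁻¹ * k z - (n : ℝ)⁻¹ * m z =
          ((n * k z - N * m z) - (stepCount k - N) * m z) / (n * stepCount k) := by
        field_simp
        ring
      have hpos : 0 < n * (stepCount k : ℝ) := by positivity
      have h1 : (stepCount k - N) * (m z : ℝ) ≤ r * n := by
        calc (stepCount k - N) * (m z : ℝ) ≤ r * (m z : ℝ) := by gcongr; linarith
          _ ≤ r * n := by gcongr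
      have h2 : 0 ≤ (stepCount k - N) * (m z : ℝ) := mul_nonneg (by linarith) hmz0
      rw [e, abs_div, abs_of_pos hpos, div_le_div_iff₀ hpos hN0]
      have h3 : |(n * k z - N * m z) - (stepCount k - N) * (m z : ℝ)| ≤ (1 + r) * n := by
        rw [abs_le]
        have h4 : 0 ≤ r * n := by positivity
        constructor <;> linarith [hk_gt z, hk_le z]
      calc _ ≤ (1 + r) * n * N := by gcongr
        _ ≤ (1 + r) * n * stepCount k := by gcongr
        _ = _ := by ring
    have := norm_sum_smul_toEuclid_le (fun z => (stepCount k : ℝ)⁻¹ * k z - (n : ℝ)⁻¹ * m z) hco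
    rw [hm]
    simp only [smul_smul, ← sub_smul]
    refine this.trans ?_
    rw [div_mul_eq_mul_div, div_le_iff₀ hN0]
    exact hNB

end Pathwise

/-! ### Upper semicontinuous regularization -/

section UscReg

variable {E : Type*} [TopologicalSpace E] {f g : E → EReal}

lemma le_uscReg (f : E → EReal) (x : E) : f x ≤ uscReg f x :=
  le_iInf fun _ => le_iInf fun _ => le_iInf fun hx => le_iSup₂_of_le x hx le_rfl

lemma uscReg_le_iSup {B : Set E} (hB : IsOpen B) {x : E} (hx : x ∈ B) :
    uscReg f x ≤ ⨆ y ∈ B, f y := by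
  unfold uscReg
  exact iInf_le_of_le B (iInf_le_of_le hB (iInf_le _ hx))

lemma exists_lt_of_lt_uscReg {x : E} {c : EReal} (h : c < uscReg f x) {B : Set E} (hB : IsOpen B)
    (hx : x ∈ B) : ∃ y ∈ B, c < f y := by
  have h1 : c < ⨆ y ∈ B, f y :=
    h.trans_le (uscReg_le_iSup hB hx)
  simpa [lt_iSup_iff] using h1

lemma exists_open_of_uscReg_lt {x : E} {c : EReal} (h : uscReg f x < c) :
    ∃ B : Set E, IsOpen B ∧ x ∈ B ∧ ∀ y ∈ B, f y < c := by
  simp only [uscReg, iInf_lt_iff] at h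
  obtain ⟨B, hB, hx, h⟩ := h
  exact ⟨B, hB, hx, fun y hy => (le_iSup₂ (f := fun y (_ : y ∈ B) => f y) y hy).trans_lt h⟩

lemma upperSemicontinuous_uscReg (f : E → EReal) : UpperSemicontinuous (uscReg f) := by
  intro x c h
  simp only [uscReg, iInf_lt_iff] at h
  obtain ⟨B, hB, hx, h⟩ := h
  filter_upwards [hB.mem_nhds hx] with y hy
  exact (uscReg_le_iSup hB hy).trans_lt h

lemma uscReg_le_of_le {x : E} (hg : UpperSemicontinuous g) (h : ∀ y, f y ≤ g y) :
    uscReg f x ≤ g x := by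
  refine le_of_forall_gt fun c hc => ?_
  rcases exists_between hc with ⟨c', h1, h2⟩
  obtain ⟨B, hB, hBo, hx⟩ := _root_.mem_nhds_iff.1 (hg x c' h1)
  refine lt_of_le_of_lt ?_ h2
  exact (uscReg_le_iSup hBo hx).trans (iSup₂_le fun y hy => (h y).trans (hB hy).le)

lemma uscReg_mono {x : E} (h : ∀ y, f y ≤ g y) : uscReg f x ≤ uscReg g x :=
  uscReg_le_of_le (upperSemicontinuous_uscReg g) fun y => (h y).trans (le_uscReg g y)

end UscReg

/-! ### Regularity of concave upper semicontinuous functions on polytopes -/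

section Concave

variable {ι E : Type*} [Fintype ι] [NormedAddCommGroup E] [NormedSpace ℝ E]

lemma continuous_coe_sub (Λ : ℝ) : Continuous fun y : EReal => (Λ : EReal) - y := by
  rw [continuous_iff_continuousAt]
  intro y
  have h := EReal.continuousAt_add (p := ((Λ : EReal), -y)) (by simp) (by simp)
  exact h.comp (f := fun y : EReal => ((Λ : EReal), -y))
    (continuous_const.prodMk continuous_neg).continuousAt

lemma antitone_coe_sub (Λ : ℝ) : Antitone fun y : EReal => (Λ : EReal) - y :=
  fun _ _ h => EReal.sub_le_sub le_rfl h

/-- An upper semicontinuous function with values in `[-∞, Λ]` that is concave and bounded below on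
a polytope `U`, and `-∞` elsewhere. -/
structure IsConcaveOn (U : Set E) (F : E → EReal) (c Λ : ℝ) : Prop where
  usc : UpperSemicontinuous F
  eq_bot : ∀ x ∉ U, F x = ⊥
  ge : ∀ x ∈ U, (c : EReal) ≤ F x
  le : ∀ x, F x ≤ Λ
  concave : ∀ x y : E, ∀ s t : ℝ, 0 < s → 0 < t → s + t = 1 → ∀ c₁ c₂ : ℝ,
    (c₁ : EReal) < F x → (c₂ : EReal) < F y → ((s * c₁ + t * c₂ : ℝ) : EReal) ≤ F (s • x + t • y)

variable {U : Set E} {F : E → EReal} {c Λ : ℝ}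

lemma IsConcaveOn.coe_toReal (hF : IsConcaveOn U F c Λ) {x : E} (hx : x ∈ U) :
    ((F x).toReal : EReal) = F x :=
  EReal.coe_toReal (ne_top_of_le_ne_top (EReal.coe_ne_top Λ) (hF.le x))
    (ne_bot_of_le_ne_bot (EReal.coe_ne_bot c) (hF.ge x hx))

lemma IsConcaveOn.toReal_concave (hF : IsConcaveOn U F c Λ) (hU : Convex ℝ U) {x y : E} (hx : x ∈ U)
    (hy : y ∈ U) {s t : ℝ} (hs : 0 < s) (ht : 0 < t) (hst : s + t = 1) :
    s * (F x).toReal + t * (F y).toReal ≤ (F (s • x + t • y)).toReal := by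
  refine le_of_forall_pos_lt_add fun ε hε => ?_
  have h := hF.concave x y s t hs ht hst ((F x).toReal - ε / 2) ((F y).toReal - ε / 2)
    (by rw [← hF.coe_toReal hx]; exact_mod_cast (by simp; linarith))
    (by rw [← hF.coe_toReal hy]; exact_mod_cast (by simp; linarith))
  rw [← hF.coe_toReal (hU hx hy hs.le ht.le hst), EReal.coe_le_coe_iff] at h
  have e : s * ((F x).toReal - ε / 2) + t * ((F y).toReal - ε / 2) =
      s * (F x).toReal + t * (F y).toReal - (s + t) * (ε / 2) := by ring
  rw [e, hst] at h
  linarith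

lemma IsConcaveOn.sub_eq_coe (hF : IsConcaveOn U F c Λ) {x : E} (hx : x ∈ U) :
    (Λ : EReal) - F x = ((Λ - (F x).toReal : ℝ) : EReal) := by
  rw [EReal.coe_sub, hF.coe_toReal hx]

lemma IsConcaveOn.sub_eq_top (hF : IsConcaveOn U F c Λ) {x : E} (hx : x ∉ U) :
    (Λ : EReal) - F x = ⊤ := by
  rw [hF.eq_bot x hx]; exact EReal.coe_sub_bot Λ

lemma IsConcaveOn.sub_nonneg (hF : IsConcaveOn U F c Λ) (x : E) : 0 ≤ (Λ : EReal) - F x := by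
  by_cases hx : x ∈ U
  · rw [hF.sub_eq_coe hx]
    have := hF.le x
    rw [← hF.coe_toReal hx, EReal.coe_le_coe_iff] at this
    exact_mod_cast _root_.sub_nonneg.2 this
  · rw [hF.sub_eq_top hx]; exact le_top

lemma IsConcaveOn.sub_ne_top (hF : IsConcaveOn U F c Λ) {x : E} (hx : x ∈ U) :
    (Λ : EReal) - F x ≠ ⊤ := by
  rw [hF.sub_eq_coe hx]; exact EReal.coe_ne_top _

lemma IsConcaveOn.lowerSemicontinuous_sub (hF : IsConcaveOn U F c Λ) :
    LowerSemicontinuous fun x => (Λ : EReal) - F x :=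
  (continuous_coe_sub Λ).comp_upperSemicontinuous_antitone hF.usc (antitone_coe_sub Λ)

lemma IsConcaveOn.isConvexFun_sub (hF : IsConcaveOn U F c Λ) (hU : Convex ℝ U) :
    IsConvexFun fun x => (Λ : EReal) - F x := by
  intro x y s t hs ht hst
  have hmul : ∀ (r : ℝ) (w : E), 0 ≤ r → 0 ≤ (r : EReal) * ((Λ : EReal) - F w) := fun r w hr =>
    mul_nonneg (by exact_mod_cast hr) (hF.sub_nonneg w)
  rcases hs.eq_or_lt with rfl | hs'
  · have : t = 1 := by linarith
    subst this
    simp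
  rcases ht.eq_or_lt with rfl | ht'
  · have : s = 1 := by linarith
    subst this
    simp
  by_cases hx : x ∈ U
  · by_cases hy : y ∈ U
    · have h := hF.toReal_concave hU hx hy hs' ht' hst
      dsimp only
      rw [hF.sub_eq_coe hx, hF.sub_eq_coe hy, hF.sub_eq_coe (hU hx hy hs ht hst)]
      have h2 : Λ = s * Λ + t * Λ := by rw [← add_mul, hst, one_mul]
      have h3 : Λ - (F (s • x + t • y)).toReal ≤
          s * (Λ - (F x).toReal) + t * (Λ - (F y).toReal) := by linarith
      exact_mod_cast h3
    · dsimp only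
      rw [hF.sub_eq_top hy, EReal.coe_mul_top_of_pos ht', EReal.add_top_of_ne_bot]
      · exact le_top
      · exact (EReal.bot_lt_zero.trans_le (hmul s x hs)).ne'
  · dsimp only
    rw [hF.sub_eq_top hx, EReal.coe_mul_top_of_pos hs', EReal.top_add_of_ne_bot]
    · exact le_top
    · exact (EReal.bot_lt_zero.trans_le (hmul t y ht)).ne'

/-- Concavity gives lower semicontinuity of `F` on a polytope, up to the boundary, because nearby
points are convex combinations of the given point, with weight close to one, and of a point of the
polytope, where `F` is at least `c`. -/
lemma IsConcaveOn.continuousOn_sub {p : ι → E} (hF : IsConcaveOn (convexHull ℝ (range p)) F c Λ) :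
    ContinuousOn (fun x => (Λ : EReal) - F x) (convexHull ℝ (range p)) := by
  set U := convexHull ℝ (range p)
  have hU : Convex ℝ U := convex_convexHull ℝ _
  have hcont : ContinuousOn (fun x => (F x).toReal) U := by
    intro x hx
    rw [ContinuousWithinAt, tendsto_order]
    constructor
    · intro b hb
      set M := (F x).toReal - c
      have hM : 0 ≤ M := by
        have := hF.ge x hx
        rw [← hF.coe_toReal hx, EReal.coe_le_coe_iff] at this
        linarith
      obtain ⟨ε, hε, hε1, hεM⟩ : ∃ ε > 0, ε < 1 ∧ ε * M < (F x).toReal - b := by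
        have h0 : 0 < (F x).toReal - b := by linarith
        refine ⟨min (1 / 2) (((F x).toReal - b) / (M + 1)), by positivity,
          (min_le_left _ _).trans_lt (by norm_num), ?_⟩
        calc _ ≤ ((F x).toReal - b) / (M + 1) * M := by gcongr; exact min_le_right _ _
          _ < ((F x).toReal - b) / (M + 1) * (M + 1) := by gcongr; linarith
          _ = _ := by field_simp
      obtain ⟨δ, hδ, h⟩ := exists_delta_convex_combination p x hε hx
      filter_upwards [self_mem_nhdsWithin, mem_nhdsWithin_of_mem_nhds (Metric.ball_mem_nhds x hδ)]
        with y hy hyd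
      obtain ⟨ξ, hξ, rfl⟩ := h y hy hyd
      have h1 := hF.toReal_concave hU hx hξ (by linarith : 0 < 1 - ε) hε (by ring)
      have h2 := hF.ge ξ hξ
      rw [← hF.coe_toReal hξ, EReal.coe_le_coe_iff] at h2
      have h3 : ε * c ≤ ε * (F ξ).toReal := by gcongr
      have h4 : ε * M = ε * (F x).toReal - ε * c := by simp only [M]; ring
      linarith
    · intro b hb
      have h1 : F x < (b : EReal) := by
        rw [← hF.coe_toReal hx]; exact_mod_cast hb
      filter_upwards [self_mem_nhdsWithin, mem_nhdsWithin_of_mem_nhds (hF.usc x b h1)] with y hy h2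
      have h3 : F y < (b : EReal) := h2
      rw [← hF.coe_toReal hy] at h3
      exact_mod_cast h3
  have h : ContinuousOn (fun x => ((Λ - (F x).toReal : ℝ) : EReal)) U :=
    continuous_coe_real_ereal.comp_continuousOn (continuousOn_const.sub hcont)
  exact h.congr fun x hx => hF.sub_eq_coe hx

end Concave

/-! ### The rate function of a superadditive field -/

section Rate

variable {d : ℕ} {R : Finset (Fin d → ℤ)} {Ω : Type*} [MeasurableSpace Ω] {P : Measure Ω}
  {T : LatticeGroup R → Ω → Ω} {G : Ω → ℝ} {a : (R → ℕ) → Ω → ℝ}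

/-- The largest growth rate per step, at velocity `ζ`, along count vectors that use every step; it
is `-∞` where there are none, in particular at irrational `ζ`. -/
def interiorRate (P : Measure Ω) (a : (R → ℕ) → Ω → ℝ) (ζ : EuclideanSpace ℝ (Fin d)) : EReal :=
  ⨆ k : R → ℕ, ⨆ _ : ∀ z, 1 ≤ k z, ⨆ _ : velocity k = ζ, (velocityRate P a k : EReal)

lemma le_interiorRate {k : R → ℕ} (hk : ∀ z, 1 ≤ k z) :
    (velocityRate P a k : EReal) ≤ interiorRate P a (velocity k) :=
  le_iSup_of_le k (le_iSup_of_le hk (le_iSup_of_le rfl le_rfl))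

lemma exists_of_lt_interiorRate {ζ : EuclideanSpace ℝ (Fin d)} {c : EReal}
    (h : c < interiorRate P a ζ) :
    ∃ k : R → ℕ, (∀ z, 1 ≤ k z) ∧ velocity k = ζ ∧ c < velocityRate P a k := by
  simp only [interiorRate, lt_iSup_iff] at h
  obtain ⟨k, hk, hv, h⟩ := h
  exact ⟨k, hk, hv, h⟩

lemma velocitySet_eq_range :
    velocitySet R = convexHull ℝ (range fun z : R => toEuclid z.1) := by
  rw [velocitySet]
  congr 1
  ext x
  simp

lemma isCompact_velocitySet : IsCompact (velocitySet R) :=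
  (R.finite_toSet.image toEuclid).isCompact_convexHull (𝕜 := ℝ)

lemma sum_smul_mem_velocitySet {β : R → ℝ} (h0 : ∀ z, 0 ≤ β z) (h1 : ∑ z, β z = 1) :
    ∑ z : R, β z • toEuclid z.1 ∈ velocitySet R :=
  (convex_convexHull ℝ _).sum_mem (fun z _ => h0 z) h1 fun z _ =>
    subset_convexHull ℝ _ (mem_image_of_mem _ z.2)

lemma velocity_mem {m : R → ℕ} (hm : 1 ≤ stepCount m) : velocity m ∈ velocitySet R := by
  have h0 : (0 : ℝ) < stepCount m := by exact_mod_cast hm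
  rw [velocity, toEuclid_displacement, Finset.smul_sum]
  simp only [smul_smul]
  refine sum_smul_mem_velocitySet (fun z => by positivity) ?_
  rw [← Finset.mul_sum, stepCount]
  push_cast
  rw [inv_mul_cancel₀]
  rw [stepCount] at h0
  push_cast at h0
  exact h0.ne'

lemma one_le_stepCount [Nonempty R] {k : R → ℕ} (hk : ∀ z, 1 ≤ k z) : 1 ≤ stepCount k :=
  (hk (Classical.arbitrary R)).trans (le_stepCount k _)

lemma tendsto_ceil_ratio {s t : ℝ} (hs : 0 < s) (ht : 0 < t) (hst : s + t = 1) :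
    Tendsto (fun M : ℕ => (⌈s * M⌉₊ : ℝ) / (⌈s * M⌉₊ + ⌈t * M⌉₊)) atTop (𝓝 s) ∧
    Tendsto (fun M : ℕ => (⌈t * M⌉₊ : ℝ) / (⌈s * M⌉₊ + ⌈t * M⌉₊)) atTop (𝓝 t) := by
  have h1 : Tendsto (fun M : ℕ => (⌈s * M⌉₊ : ℝ) / M) atTop (𝓝 s) :=
    (tendsto_nat_ceil_mul_div_atTop hs.le).comp tendsto_natCast_atTop_atTop
  have h2 : Tendsto (fun M : ℕ => (⌈t * M⌉₊ : ℝ) / M) atTop (𝓝 t) :=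
    (tendsto_nat_ceil_mul_div_atTop ht.le).comp tendsto_natCast_atTop_atTop
  have h3 := h1.add h2
  rw [hst] at h3
  have h4 := h1.div h3 one_ne_zero
  have h5 := h2.div h3 one_ne_zero
  rw [div_one] at h4 h5
  refine ⟨h4.congr' ?_, h5.congr' ?_⟩
  all_goals
    filter_upwards [eventually_ge_atTop 1] with M hM
    have : (M : ℝ) ≠ 0 := by positivity
    rw [Pi.div_apply, ← add_div, div_div_div_cancel_right₀ this]

section

variable [IsProbabilityMeasure P] [Nonempty R] (ha : IsSuperadditiveField P T G a) (hT : IsErgodicSystem R P T)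
  (hup : ∀ᵐ ω ∂P, LinearlyBoundedAbove a ω)

include ha hT hup

lemma IsSuperadditiveField.neg_le_velocityRate {k : R → ℕ} (hk : ∀ z, 1 ≤ k z) :
    -∫ ω, G ω ∂P ≤ velocityRate P a k := by
  have h0 : (0 : ℝ) < stepCount k := by exact_mod_cast one_le_stepCount hk
  rw [velocityRate, le_div_iff₀ h0]
  linarith [ha.neg_mul_le_growthRate hT hup k]

lemma IsSuperadditiveField.exists_velocityRate_le :
    ∃ C : ℝ, ∀ k : R → ℕ, (∀ z, 1 ≤ k z) → velocityRate P a k ≤ C := by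
  obtain ⟨ω, hω⟩ := (ha.ae_isRegularAt hT hup).exists
  obtain ⟨C, -, hC⟩ := hω.exists_abs_le ha hT.map_zero
  refine ⟨C, fun k hk => ?_⟩
  have h0 : (0 : ℝ) < stepCount k := by exact_mod_cast one_le_stepCount hk
  rw [velocityRate, div_le_iff₀ h0]
  exact (le_abs_self _).trans (hC k _ (one_le_stepCount hk) (hω.tendsto k hk))

/-- Superadditivity of the growth rates, as concavity of the rates per step. -/
lemma IsSuperadditiveField.exists_combination {k₁ k₂ : R → ℕ} (hk₁ : ∀ z, 1 ≤ k₁ z)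
    (hk₂ : ∀ z, 1 ≤ k₂ z) {p q : ℕ} (hp : 1 ≤ p) (hq : 1 ≤ q) :
    ∃ k : R → ℕ, (∀ z, 1 ≤ k z) ∧
      velocity k = ((p : ℝ) / (p + q)) • velocity k₁ + ((q : ℝ) / (p + q)) • velocity k₂ ∧
      (p : ℝ) / (p + q) * velocityRate P a k₁ + (q : ℝ) / (p + q) * velocityRate P a k₂ ≤
        velocityRate P a k := by
  have h1 := one_le_stepCount hk₁
  have h2 := one_le_stepCount hk₂
  have h1' : (0 : ℝ) < stepCount k₁ := by exact_mod_cast h1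
  have h2' : (0 : ℝ) < stepCount k₂ := by exact_mod_cast h2
  have hp' : (0 : ℝ) < p := by exact_mod_cast hp
  have hq' : (0 : ℝ) < q := by exact_mod_cast hq
  have e1 : stepCount ((p * stepCount k₂) • k₁ + (q * stepCount k₁) • k₂) =
      (p + q) * (stepCount k₁ * stepCount k₂) := by
    rw [stepCount_add, stepCount_nsmul, stepCount_nsmul]; ring
  refine ⟨(p * stepCount k₂) • k₁ + (q * stepCount k₁) • k₂, fun z => ?_, ?_, ?_⟩
  · have h3 : 1 ≤ p * stepCount k₂ * k₁ z := Nat.mul_pos (Nat.mul_pos hp h2) (hk₁ z)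
    simp only [Pi.add_apply, Pi.smul_apply, smul_eq_mul]
    omega
  · rw [velocity, e1, velocity, velocity, displacement_add, displacement_nsmul,
      displacement_nsmul, ← toEuclidHom_apply, AddSubgroup.coe_add, map_add, AddSubgroup.coe_nsmul,
      AddSubgroup.coe_nsmul, map_nsmul, map_nsmul, ← Nat.cast_smul_eq_nsmul ℝ,
      ← Nat.cast_smul_eq_nsmul ℝ, smul_add, smul_smul, smul_smul, smul_smul, smul_smul,
      toEuclidHom_apply, toEuclidHom_apply]
    push_cast
    congr 2 <;> field_simp
  · have h3 := ha.growthRate_add_le hT hup ((p * stepCount k₂) • k₁) ((q * stepCount k₁) • k₂)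
    rw [ha.growthRate_nsmul hT hup _ (Nat.mul_pos hp h2),
      ha.growthRate_nsmul hT hup _ (Nat.mul_pos hq h1)] at h3
    push_cast at h3
    rw [velocityRate, velocityRate, velocityRate, e1]
    push_cast
    rw [le_div_iff₀ (by positivity)]
    refine le_trans (le_of_eq ?_) h3
    field_simp

/-- The regularized rate is concave: approximants of `x` and `y` are combined with rational weights
that converge to `s` and `t`. -/
lemma IsSuperadditiveField.interiorRate_concave (x y : EuclideanSpace ℝ (Fin d)) {s t : ℝ}
    (hs : 0 < s) (ht : 0 < t) (hst : s + t = 1) {c₁ c₂ : ℝ}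
    (hx : (c₁ : EReal) < uscReg (interiorRate P a) x)
    (hy : (c₂ : EReal) < uscReg (interiorRate P a) y) :
    ((s * c₁ + t * c₂ : ℝ) : EReal) ≤ uscReg (interiorRate P a) (s • x + t • y) := by
  refine le_iInf fun B => le_iInf fun hB => le_iInf fun hmem => ?_
  have hcont : Continuous fun w : EuclideanSpace ℝ (Fin d) × EuclideanSpace ℝ (Fin d) =>
      s • w.1 + t • w.2 := by fun_prop
  obtain ⟨B₁, B₂, hB₁, hB₂, hx₁, hy₂, hsub⟩ :=
    isOpen_prod_iff.1 (hB.preimage hcont) x y hmem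
  obtain ⟨x', hx', h1⟩ := exists_lt_of_lt_uscReg hx hB₁ hx₁
  obtain ⟨y', hy', h2⟩ := exists_lt_of_lt_uscReg hy hB₂ hy₂
  obtain ⟨k₁, hk₁, rfl, g1⟩ := exists_of_lt_interiorRate h1
  obtain ⟨k₂, hk₂, rfl, g2⟩ := exists_of_lt_interiorRate h2
  have h1' : c₁ < velocityRate P a k₁ := by exact_mod_cast g1
  have h2' : c₂ < velocityRate P a k₂ := by exact_mod_cast g2
  have hmem' : s • velocity k₁ + t • velocity k₂ ∈ B := hsub (mk_mem_prod hx' hy')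
  obtain ⟨l1, l2⟩ := tendsto_ceil_ratio hs ht hst
  have hv := ((l1.smul_const (velocity k₁)).add (l2.smul_const (velocity k₂))).eventually
    (hB.mem_nhds hmem')
  have hr := ((l1.mul_const (velocityRate P a k₁)).add
    (l2.mul_const (velocityRate P a k₂))).eventually_const_lt
    (show s * c₁ + t * c₂ < s * velocityRate P a k₁ + t * velocityRate P a k₂ by gcongr)
  obtain ⟨M, hMv, hMr, hM1⟩ := (hv.and (hr.and (eventually_ge_atTop 1))).exists
  have hM0 : (0 : ℝ) < M := by exact_mod_cast hM1
  obtain ⟨k, hk, hkv, hkr⟩ := ha.exists_combination hT hup hk₁ hk₂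
    (p := ⌈s * M⌉₊) (q := ⌈t * M⌉₊) (Nat.ceil_pos.2 (by positivity)) (Nat.ceil_pos.2 (by positivity))
  refine le_iSup₂_of_le (velocity k) (hkv ▸ hMv) (le_trans ?_ (le_interiorRate hk))
  exact_mod_cast (hMr.trans_le hkr).le

end

end Rate

/-! ### Rounded counts of a velocity -/

section Rounding

variable {d : ℕ} {R : Finset (Fin d → ℤ)} {β : EuclideanSpace ℝ (Fin d) → R → ℝ}
  {b : ℕ → EuclideanSpace ℝ (Fin d) → R → ℕ}

/-- The step counts of the lattice point `x̂_n(ζ)`. -/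
def roundedCounts (β : EuclideanSpace ℝ (Fin d) → R → ℝ)
    (b : ℕ → EuclideanSpace ℝ (Fin d) → R → ℕ) (ζ : EuclideanSpace ℝ (Fin d)) (n : ℕ) : R → ℕ :=
  fun z => ⌊(n : ℝ) * β ζ z⌋₊ + b n ζ z

lemma displacement_roundedCounts (ζ : EuclideanSpace ℝ (Fin d)) (n : ℕ) :
    (displacement (roundedCounts β b ζ n) : Fin d → ℤ) = latticePoint β b n ζ := by
  rw [displacement, AddSubgroup.val_finsetSum, latticePoint]
  rfl

variable {ζ : EuclideanSpace ℝ (Fin d)}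

lemma IsVelocityChoice.stepCount_roundedCounts (hβ : IsVelocityChoice R β b)
    (hζ : ζ ∈ velocitySet R) (n : ℕ) : stepCount (roundedCounts β b ζ n) = n := by
  have := hβ.sum_round n ζ hζ
  rw [stepCount]
  simp only [roundedCounts]
  rw [Finset.sum_add_distrib, add_comm, this]

lemma IsVelocityChoice.abs_roundedCounts_sub_le (hβ : IsVelocityChoice R β b)
    (hζ : ζ ∈ velocitySet R) (n : ℕ) (z : R) :
    |(roundedCounts β b ζ n z : ℝ) - n * β ζ z| ≤ 1 := by
  have h0 : 0 ≤ (n : ℝ) * β ζ z := mul_nonneg (by positivity) (hβ.nonneg ζ hζ z)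
  have h1 := Nat.floor_le h0
  have h2 := Nat.lt_floor_add_one ((n : ℝ) * β ζ z)
  have h3 : (b n ζ z : ℝ) ≤ 1 := by exact_mod_cast hβ.round_le_one n ζ hζ z
  have h4 : (0 : ℝ) ≤ b n ζ z := by positivity
  simp only [roundedCounts]
  push_cast
  rw [abs_le]
  constructor <;> linarith

lemma IsVelocityChoice.roundedCounts_eq_zero (hβ : IsVelocityChoice R β b)
    (hζ : ζ ∈ velocitySet R) (n : ℕ) (z : R) (h : β ζ z = 0) : roundedCounts β b ζ n z = 0 := by
  simp [roundedCounts, h, hβ.round_eq_zero n ζ hζ z h]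

lemma IsVelocityChoice.tendsto_velocity (hβ : IsVelocityChoice R β b) (hζ : ζ ∈ velocitySet R) :
    Tendsto (fun n => velocity (roundedCounts β b ζ n)) atTop (𝓝 ζ) := by
  have hco : ∀ z, Tendsto (fun n : ℕ => (n : ℝ)⁻¹ * (roundedCounts β b ζ n z : ℝ)) atTop
      (𝓝 (β ζ z)) := by
    intro z
    rw [tendsto_iff_norm_sub_tendsto_zero]
    refine squeeze_zero' (Eventually.of_forall fun _ => norm_nonneg _) ?_
      (tendsto_one_div_atTop_nhds_zero_nat (𝕜 := ℝ))
    filter_upwards [eventually_ge_atTop 1] with n hn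
    have hn0 : (0 : ℝ) < n := by exact_mod_cast hn
    have e : (n : ℝ)⁻¹ * (roundedCounts β b ζ n z : ℝ) - β ζ z =
        ((roundedCounts β b ζ n z : ℝ) - n * β ζ z) / n := by field_simp
    rw [e, norm_div, Real.norm_eq_abs, Real.norm_eq_abs, abs_of_pos hn0]
    gcongr
    exact hβ.abs_roundedCounts_sub_le hζ n z
  have h := tendsto_finsetSum Finset.univ fun z _ => (hco z).smul_const (toEuclid z.1)
  rw [hβ.mean_eq ζ hζ] at h
  refine h.congr fun n => ?_
  rw [velocity, toEuclid_displacement, hβ.stepCount_roundedCounts hζ, Finset.smul_sum]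
  simp only [smul_smul]

lemma toEuclid_injective : Function.Injective (toEuclid (d := d)) := by
  intro x y h
  funext i
  have := congrArg (fun v : EuclideanSpace ℝ (Fin d) => v i) h
  simpa [toEuclid] using this

lemma exists_common_denominator (w : R → ℝ) (h0 : ∀ z, 0 ≤ w z)
    (hq : ∀ z, ∃ q : ℚ, w z = (q : ℝ)) :
    ∃ Q : ℕ, 1 ≤ Q ∧ ∀ z, ∃ c : ℕ, (Q : ℝ) * w z = c := by
  choose q hq using hq
  refine ⟨∏ z, (q z).den, Nat.succ_le_of_lt (Finset.prod_pos fun z _ => (q z).den_pos),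
    fun z => ?_⟩
  obtain ⟨e, he⟩ := Finset.dvd_prod_of_mem (fun z => (q z).den) (Finset.mem_univ z)
  have hqz : 0 ≤ q z := by
    have := h0 z
    rw [hq z] at this
    exact_mod_cast this
  refine ⟨e * (q z).num.toNat, ?_⟩
  have h1 : ((q z).num.toNat : ℤ) = (q z).num := Int.toNat_of_nonneg (Rat.num_nonneg.2 hqz)
  have h2 : ((q z).den : ℚ) * q z = ((q z).num.toNat : ℚ) := by
    rw [Rat.den_mul_eq_num]; exact_mod_cast h1.symm
  have h3 : ((q z).den : ℝ) * (q z : ℝ) = ((q z).num.toNat : ℝ) := by exact_mod_cast h2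
  rw [he, hq z]
  push_cast
  rw [← h3]; ring

variable {Ω : Type*} [MeasurableSpace Ω] {P : Measure Ω} {T : LatticeGroup R → Ω → Ω}
  {G : Ω → ℝ} {a : (R → ℕ) → Ω → ℝ}

/-- At a rational velocity the rounded counts are exact along multiples of a common denominator,
which identifies the limit of the field. -/
lemma IsRegularAt.tendsto_roundedCounts_velocity [Nonempty R] {ω : Ω}
    (hω : IsRegularAt P T G a ω) (ha : IsSuperadditiveField P T G a) (hT0 : T 0 = id)
    (hβ : IsVelocityChoice R β b) {k : R → ℕ} (hk : ∀ z, 1 ≤ k z) :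
    Tendsto (fun n : ℕ => a (roundedCounts β b (velocity k) n) ω / n) atTop
      (𝓝 (velocityRate P a k)) := by
  set ξ := velocity k
  have hk1 := one_le_stepCount hk
  have hk0 : (0 : ℝ) < stepCount k := by exact_mod_cast hk1
  have hξ : ξ ∈ velocitySet R := velocity_mem hk1
  obtain ⟨L, hL⟩ := hω.exists_tendsto_of_direction ha hT0 (hβ.nonneg ξ hξ)
    (hβ.stepCount_roundedCounts hξ) (hβ.abs_roundedCounts_sub_le hξ)
    (hβ.roundedCounts_eq_zero hξ)
  have hrat : ∀ i, ∃ q : ℚ, ξ i = (q : ℝ) := fun i =>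
    ⟨(stepCount k : ℚ)⁻¹ * ((displacement k).1 i : ℚ), by simp [ξ, velocity, toEuclid]⟩
  obtain ⟨Q, hQ, hc⟩ := exists_common_denominator (β ξ) (hβ.nonneg ξ hξ) (hβ.rational ξ hξ hrat)
  have hexact : ∀ j : ℕ, a (roundedCounts β b ξ (Q * j * stepCount k)) ω = a ((Q * j) • k) ω := by
    intro j
    set n := Q * j * stepCount k
    have hfl : ∀ z, ((⌊(n : ℝ) * β ξ z⌋₊ : ℕ) : ℝ) = n * β ξ z := by
      intro z
      obtain ⟨c, hc⟩ := hc z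
      have : (n : ℝ) * β ξ z = ((j * stepCount k * c : ℕ) : ℝ) := by
        simp only [n]; push_cast; rw [← hc]; ring
      rw [this, Nat.floor_natCast]
    have hfs : ∑ z, ⌊(n : ℝ) * β ξ z⌋₊ = n := by
      have : ∑ z, ((⌊(n : ℝ) * β ξ z⌋₊ : ℕ) : ℝ) = n := by
        rw [Finset.sum_congr rfl fun z _ => hfl z, ← Finset.mul_sum, hβ.sum_eq_one ξ hξ, mul_one]
      exact_mod_cast this
    have hb0 : ∀ z, b n ξ z = 0 := by
      have := hβ.sum_round n ξ hξ
      rw [hfs] at this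
      have h0 : ∑ z, b n ξ z = 0 := by omega
      exact fun z => Finset.sum_eq_zero_iff.1 h0 z (Finset.mem_univ z)
    refine congrFun (ha.congr _ _ ?_ (Subtype.ext (toEuclid_injective ?_))) ω
    · rw [hβ.stepCount_roundedCounts hξ, stepCount_nsmul]
    · rw [toEuclid_displacement, displacement_nsmul, AddSubgroup.coe_nsmul, ← toEuclidHom_apply,
        map_nsmul, toEuclidHom_apply]
      simp only [roundedCounts, hb0, add_zero, hfl, mul_smul]
      rw [← Finset.smul_sum, hβ.mean_eq ξ hξ]
      simp only [ξ, velocity, n]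
      rw [smul_smul, ← Nat.cast_smul_eq_nsmul ℝ]
      push_cast
      rw [mul_assoc, mul_inv_cancel₀ hk0.ne', mul_one, mul_smul, ← Nat.cast_smul_eq_nsmul ℝ j]
  have hmul : Tendsto (fun j : ℕ => Q * j) atTop atTop :=
    tendsto_id.const_mul_atTop' (show 0 < Q by omega)
  have hmul' : Tendsto (fun j : ℕ => Q * j * stepCount k) atTop atTop :=
    hmul.atTop_mul_const' (show 0 < stepCount k by omega)
  have h1 := hL.comp hmul'
  have h2 := ((hω.tendsto k hk).comp hmul).div_const (stepCount k : ℝ)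
  have h3 : L = velocityRate P a k := by
    refine tendsto_nhds_unique h1 (h2.congr fun j => ?_)
    simp only [Function.comp_apply]
    rw [hexact]
    push_cast
    rw [div_div]
  rwa [h3] at hL

/-- Every velocity is approximated by those of counts that use every step. -/
lemma IsRegularAt.exists_velocity_mem [Nonempty R] {ω : Ω} (hω : IsRegularAt P T G a ω)
    (ha : IsSuperadditiveField P T G a) (hT0 : T 0 = id) (hβ : IsVelocityChoice R β b)
    (hζ : ζ ∈ velocitySet R) {B : Set (EuclideanSpace ℝ (Fin d))} (hB : IsOpen B) (hmem : ζ ∈ B) :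
    ∃ k : R → ℕ, (∀ z, 1 ≤ k z) ∧ velocity k ∈ B := by
  obtain ⟨ε, hε, hball⟩ := Metric.isOpen_iff.1 hB ζ hmem
  obtain ⟨N, -, hN⟩ := hω.exists_rate_ge ha hT0 (show 0 < ε / 2 by positivity)
  obtain ⟨n, hn, hnN⟩ := (((Metric.tendsto_nhds.1 (hβ.tendsto_velocity hζ)) (ε / 2)
    (by positivity)).and (eventually_ge_atTop N)).exists
  obtain ⟨k, hk, -, hd⟩ := hN n hnN _ (hβ.stepCount_roundedCounts hζ n)
  refine ⟨k, hk, hball ?_⟩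
  rw [Metric.mem_ball]
  calc dist (velocity k) ζ ≤ dist (velocity k) (velocity (roundedCounts β b ζ n)) +
        dist (velocity (roundedCounts β b ζ n)) ζ := dist_triangle _ _ _
    _ < ε := by linarith

end Rounding

/-! ### Concatenation of random walk paths -/

section Walk

variable {d : ℕ} {R : Finset (Fin d → ℤ)}

/-- The step sequence that follows `s` for `m` steps and `t` afterwards. -/
def concat (m : ℕ) (s t : ℕ → R) : ℕ → R := fun i => if i < m then s i else t (i - m)

lemma concat_of_lt {m i : ℕ} (h : i < m) (s t : ℕ → R) : concat m s t i = s i := if_pos h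

lemma concat_add (m i : ℕ) (s t : ℕ → R) : concat m s t (m + i) = t i := by
  simp [concat]

lemma position_congr {n : ℕ} {s s' : ℕ → R} (h : ∀ i < n, s i = s' i) :
    position n s = position n s' :=
  Finset.sum_congr rfl fun i hi => by rw [h i (Finset.mem_range.1 hi)]

lemma position_concat_of_le {m k : ℕ} (h : k ≤ m) (s t : ℕ → R) :
    position k (concat m s t) = position k s :=
  position_congr fun _ hi => concat_of_lt (hi.trans_le h) s t

lemma position_concat_add (m k : ℕ) (s t : ℕ → R) :
    position (m + k) (concat m s t) = position m s + position k t := by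
  rw [← position_concat_of_le le_rfl s t, position, Finset.sum_range_add]
  congr 1
  exact Finset.sum_congr rfl fun i _ => by rw [concat_add]

/-- The numbers of uses of the steps among the first `n` steps. -/
lemma exists_counts_eq_position (n : ℕ) (s : ℕ → R) :
    ∃ m : R → ℕ, stepCount m = n ∧ displacement m = position n s := by
  induction n with
  | zero => exact ⟨0, by simp, by simp [position]⟩
  | succ n ih =>
    obtain ⟨m, h1, h2⟩ := ih
    refine ⟨m + Pi.single (s n) 1, ?_, ?_⟩
    · rw [stepCount_add, h1, stepCount_single]
    · rw [displacement_add, h2, displacement_single, position, position, Finset.sum_range_succ]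

/-- A function of finitely many steps is measurable, jointly with a further variable. -/
lemma measurable_prod_of_finite_steps {Ω δ : Type*} [MeasurableSpace Ω] [MeasurableSpace δ]
    {f : Ω × (ℕ → R) → δ} (n : ℕ) (hf : ∀ s, Measurable fun ω => f (ω, s))
    (hn : ∀ ω s s', (∀ i < n, s i = s' i) → f (ω, s) = f (ω, s')) [Nonempty R] :
    Measurable f := by
  let e : (Fin n → R) → ℕ → R := fun w i =>
    if h : i < n then w ⟨i, h⟩ else Classical.arbitrary R
  let f' : Ω × (Fin n → R) → δ := fun p => f (p.1, e p.2)
  have hf' : Measurable f' := measurable_from_prod_countable_left fun w => hf (e w)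
  have heq : f = f' ∘ fun p : Ω × (ℕ → R) => (p.1, fun i : Fin n => p.2 i) := by
    funext p
    refine hn p.1 p.2 _ fun i hi => ?_
    simp [e, hi]
  rw [heq]
  exact hf'.comp (measurable_fst.prodMk
    (measurable_pi_lambda _ fun i => (measurable_pi_apply _).comp measurable_snd))

lemma measurable_of_finite_steps {δ : Type*} [MeasurableSpace δ] [Nonempty R]
    {f : (ℕ → R) → δ} (n : ℕ) (hn : ∀ s s', (∀ i < n, s i = s' i) → f s = f s') :
    Measurable f :=
  (measurable_prod_of_finite_steps (Ω := Unit) (f := fun p : Unit × (ℕ → R) => f p.2) n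
    (fun s => (measurable_const : Measurable fun _ : Unit => f s)) fun _ => hn).comp
    (measurable_const.prodMk measurable_id : Measurable fun s : ℕ → R => ((), s))

lemma measurableSet_position_eq [Nonempty R] (n : ℕ) (x : LatticeGroup R) :
    MeasurableSet {s : ℕ → R | position n s = x} :=
  measurableSet_eq_fun (measurable_of_finite_steps n fun _ _ h => position_congr h)
    measurable_const

variable [Nonempty R]

instance isProbabilityMeasure_uniformOn_steps :
    IsProbabilityMeasure (uniformOn (Set.univ : Set R)) :=
  isProbabilityMeasure_uniformOn finite_univ univ_nonempty

instance isProbabilityMeasure_walkLaw : IsProbabilityMeasure (walkLaw R) := by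
  unfold walkLaw; infer_instance

/-- The concatenation of two independent walks is a walk. -/
lemma measurePreserving_concat (m : ℕ) :
    MeasurePreserving (fun p : (ℕ → R) × (ℕ → R) => concat m p.1 p.2)
      ((walkLaw R).prod (walkLaw R)) (walkLaw R) := by
  have hmeas : Measurable fun p : (ℕ → R) × (ℕ → R) => concat m p.1 p.2 := by
    refine measurable_pi_lambda _ fun i => ?_
    by_cases h : i < m
    · simp only [concat, h, if_true]
      exact (measurable_pi_apply _).comp measurable_fst
    · simp only [concat, h, if_false]
      exact (measurable_pi_apply _).comp measurable_snd
  refine ⟨hmeas, Measure.eq_infinitePi _ fun s t ht => ?_⟩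
  rw [Measure.map_apply hmeas (MeasurableSet.pi s.countable_toSet fun i _ => ht i)]
  have hpre : (fun p : (ℕ → R) × (ℕ → R) => concat m p.1 p.2) ⁻¹' (Set.pi s t) =
      (Set.pi (s.filter (· < m) : Finset ℕ) t) ×ˢ
        (Set.pi ((s.filter (¬ · < m)).image (· - m) : Finset ℕ) fun j => t (m + j)) := by
    ext ⟨u, v⟩
    simp only [mem_preimage, Set.mem_pi, Finset.mem_coe, mem_prod, Finset.mem_filter,
      Finset.mem_image, and_imp, forall_exists_index]
    constructor
    · refine fun h => ⟨fun i hi him => by simpa [concat, him] using h i hi, ?_⟩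
      rintro _ i hi him rfl
      have := h i hi
      rw [concat, if_neg him] at this
      rwa [Nat.add_sub_cancel' (not_lt.1 him)]
    · rintro ⟨h1, h2⟩ i hi
      by_cases him : i < m
      · rw [concat_of_lt him]; exact h1 i hi him
      · have := h2 _ i hi him rfl
        rw [Nat.add_sub_cancel' (not_lt.1 him)] at this
        rwa [concat, if_neg him]
  rw [hpre, Measure.prod_prod, walkLaw, Measure.infinitePi_pi _ (fun i _ => ht i),
    Measure.infinitePi_pi _ (fun i _ => ht _), Finset.prod_image]
  · rw [← Finset.prod_filter_mul_prod_filter_not s (· < m)]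
    congr 1
    refine Finset.prod_congr rfl fun i hi => ?_
    rw [Nat.add_sub_cancel' (not_lt.1 (Finset.mem_filter.1 hi).2)]
  · intro i hi j hj hij
    simp only [Finset.coe_filter, mem_ofPred_eq, not_lt] at hi hj
    dsimp only at hij
    omega

lemma walkLaw_first_step (z : R) :
    walkLaw R {s | s 0 = z} = ENNReal.ofReal (Fintype.card R : ℝ)⁻¹ := by
  have h1 : walkLaw R {s | s 0 = z} = uniformOn (Set.univ : Set R) {z} := by
    have := (measurePreserving_eval_infinitePi
      (fun _ : ℕ => uniformOn (Set.univ : Set R)) 0).measure_preimage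
      (MeasurableSet.singleton z).nullMeasurableSet
    exact this
  rw [h1, uniformOn_univ, Measure.count_singleton, one_div,
    ENNReal.ofReal_inv_of_pos (by exact_mod_cast Fintype.card_pos), ENNReal.ofReal_natCast]

end Walk

/-! ### The superadditive field of point-to-point weights -/

section Weights

variable {d : ℕ} {R : Finset (Fin d → ℤ)} {Ω : Type*} {T : LatticeGroup R → Ω → Ω} {ℓ : ℕ}
  {g : Ω × (Fin ℓ → R) → ℝ}

/-- The sum of the absolute values of the potential over its step arguments. -/
def absCost (g : Ω × (Fin ℓ → R) → ℝ) (ω : Ω) : ℝ := ∑ zt, |g (ω, zt)|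

lemma absCost_nonneg (g : Ω × (Fin ℓ → R) → ℝ) (ω : Ω) : 0 ≤ absCost g ω :=
  Finset.sum_nonneg fun _ _ => abs_nonneg _

lemma abs_le_absCost (g : Ω × (Fin ℓ → R) → ℝ) (ω : Ω) (zt : Fin ℓ → R) :
    |g (ω, zt)| ≤ absCost g ω :=
  Finset.single_le_sum (f := fun zt => |g (ω, zt)|) (fun _ _ => abs_nonneg _) (Finset.mem_univ zt)

open Classical in
/-- The contribution of time `k` to a lower bound of the energy of a path of length `n`: a term
of the energy that looks beyond time `n` is replaced by the smallest value it might have. -/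
def lowerTerm (T : LatticeGroup R → Ω → Ω) (g : Ω × (Fin ℓ → R) → ℝ) (ω : Ω) (n k : ℕ)
    (s : ℕ → R) : ℝ :=
  if k + ℓ ≤ n then g (T (position k s) ω, fun i : Fin ℓ => s (k + i))
  else -absCost g (T (position k s) ω)

/-- A lower bound of the energy that depends on the first `n` steps only, and is superadditive
under concatenation. -/
def lowerEnergy (T : LatticeGroup R → Ω → Ω) (g : Ω × (Fin ℓ → R) → ℝ) (ω : Ω) (n : ℕ)
    (s : ℕ → R) : ℝ :=
  ∑ k ∈ Finset.range n, lowerTerm T g ω n k s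

lemma lowerTerm_congr {ω : Ω} {n k : ℕ} (hk : k < n) {s s' : ℕ → R} (h : ∀ i < n, s i = s' i) :
    lowerTerm T g ω n k s = lowerTerm T g ω n k s' := by
  have hp : position k s = position k s' := position_congr fun i hi => h i (hi.trans hk)
  rw [lowerTerm, lowerTerm, hp]
  split_ifs with hkn
  · congr 2
    funext i
    exact h _ (by omega)
  · rfl

lemma lowerEnergy_congr {ω : Ω} {n : ℕ} {s s' : ℕ → R} (h : ∀ i < n, s i = s' i) :
    lowerEnergy T g ω n s = lowerEnergy T g ω n s' :=
  Finset.sum_congr rfl fun _ hk => lowerTerm_congr (Finset.mem_range.1 hk) h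

lemma neg_absCost_le_lowerTerm (ω : Ω) (n k : ℕ) (s : ℕ → R) :
    -absCost g (T (position k s) ω) ≤ lowerTerm T g ω n k s := by
  rw [lowerTerm]
  split_ifs with h
  · exact (abs_le.1 (abs_le_absCost g _ _)).1
  · exact le_rfl

lemma lowerTerm_le (ω : Ω) (n k : ℕ) (s : ℕ → R) :
    lowerTerm T g ω n k s ≤ g (T (position k s) ω, fun i : Fin ℓ => s (k + i)) := by
  rw [lowerTerm]
  split_ifs with h
  · exact le_rfl
  · exact (abs_le.1 (abs_le_absCost g _ _)).1

lemma lowerEnergy_le_energy (ω : Ω) (n : ℕ) (s : ℕ → R) :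
    lowerEnergy T g ω n s ≤ energy T g ω n s :=
  Finset.sum_le_sum fun k _ => lowerTerm_le ω n k s

lemma abs_lowerTerm_le (ω : Ω) (n k : ℕ) (s : ℕ → R) :
    |lowerTerm T g ω n k s| ≤ absCost g (T (position k s) ω) :=
  abs_le.2 ⟨neg_absCost_le_lowerTerm ω n k s,
    (lowerTerm_le ω n k s).trans (abs_le.1 (abs_le_absCost g _ _)).2⟩

/-- Only the last `ℓ` terms of the energy are changed. -/
lemma energy_le_lowerEnergy_add {ω : Ω} {n : ℕ} {s : ℕ → R} {c : ℝ} (hc : 0 ≤ c)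
    (h : ∀ k < n, absCost g (T (position k s) ω) ≤ c) :
    energy T g ω n s ≤ lowerEnergy T g ω n s + ℓ * (2 * c) := by
  classical
  have hterm : ∀ k ∈ Finset.range n, g (T (position k s) ω, fun i : Fin ℓ => s (k + i)) ≤
      lowerTerm T g ω n k s + if k + ℓ ≤ n then 0 else 2 * c := by
    intro k hk
    have h1 := h k (Finset.mem_range.1 hk)
    rw [lowerTerm]
    split_ifs with hkn
    · simp
    · have := (abs_le.1 (abs_le_absCost g (T (position k s) ω) fun i : Fin ℓ => s (k + i))).2
      linarith
  refine (Finset.sum_le_sum hterm).trans ?_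
  rw [Finset.sum_add_distrib, Finset.sum_ite, Finset.sum_const_zero, zero_add, Finset.sum_const,
    nsmul_eq_mul]
  have hcard : ((Finset.range n).filter fun k => ¬k + ℓ ≤ n).card ≤ ℓ := by
    calc _ ≤ (Finset.Ico (n - ℓ) n).card := Finset.card_le_card fun k hk => by
          simp only [Finset.mem_filter, Finset.mem_range, Finset.mem_Ico] at hk ⊢; omega
      _ ≤ ℓ := by rw [Nat.card_Ico]; omega
  have hcard' : (((Finset.range n).filter fun k => ¬k + ℓ ≤ n).card : ℝ) ≤ ℓ := by
    exact_mod_cast hcard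
  refine add_le_add le_rfl (mul_le_mul_of_nonneg_right hcard' (by positivity))

lemma lowerEnergy_add_le (hadd : ∀ x y, T (x + y) = T x ∘ T y) (ω : Ω) (m n : ℕ) (s t : ℕ → R) :
    lowerEnergy T g ω m s + lowerEnergy T g (T (position m s) ω) n t ≤
      lowerEnergy T g ω (m + n) (concat m s t) := by
  rw [lowerEnergy, lowerEnergy, lowerEnergy, Finset.sum_range_add]
  refine add_le_add (Finset.sum_le_sum fun k hk => ?_) (le_of_eq ?_)
  · rw [Finset.mem_range] at hk
    by_cases hkm : k + ℓ ≤ m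
    · rw [lowerTerm, if_pos hkm, lowerTerm, if_pos (by omega), position_concat_of_le hk.le]
      refine le_of_eq (congrArg g (Prod.ext rfl (funext fun i => ?_)))
      exact (concat_of_lt (by have := i.2; omega) s t).symm
    · have h := neg_absCost_le_lowerTerm (T := T) (g := g) ω (m + n) k (concat m s t)
      rw [position_concat_of_le hk.le] at h
      rwa [lowerTerm, if_neg hkm]
  · refine Finset.sum_congr rfl fun k _ => ?_
    have hT : T (position (m + k) (concat m s t)) ω = T (position k t) (T (position m s) ω) := by
      rw [position_concat_add, add_comm, hadd]; rfl
    rw [lowerTerm, lowerTerm, hT]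
    by_cases hk : k + ℓ ≤ n
    · rw [if_pos hk, if_pos (by omega)]
      refine congrArg g (Prod.ext rfl (funext fun i => ?_))
      dsimp only
      rw [add_assoc, concat_add]
    · rw [if_neg hk, if_neg (by omega)]

/-- The mean of the exponential of the lower energy, over the paths from `0` to `x` in `n`
steps. -/
def pathWeight (T : LatticeGroup R → Ω → Ω) (g : Ω × (Fin ℓ → R) → ℝ) (n : ℕ)
    (x : LatticeGroup R) (ω : Ω) : ℝ≥0∞ :=
  ∫⁻ s in {s | position n s = x}, ENNReal.ofReal (Real.exp (lowerEnergy T g ω n s)) ∂(walkLaw R)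

/-- The logarithms of the path weights, as a field indexed by step counts. -/
def logWeight (T : LatticeGroup R → Ω → Ω) (g : Ω × (Fin ℓ → R) → ℝ) (m : R → ℕ) (ω : Ω) : ℝ :=
  Real.log (pathWeight T g (stepCount m) (displacement m) ω).toReal

/-- A bound for the potential along all paths of `n` steps from the origin. -/
def maxCost (T : LatticeGroup R → Ω → Ω) (g : Ω × (Fin ℓ → R) → ℝ) (n : ℕ) (ω : Ω) : ℝ :=
  ∑ m ∈ Fintype.piFinset fun _ : R => Finset.range (n + 1), absCost g (T (displacement m) ω)

lemma absCost_position_le (ω : Ω) {n k : ℕ} (hk : k ≤ n) (s : ℕ → R) :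
    absCost g (T (position k s) ω) ≤ maxCost T g n ω := by
  obtain ⟨m, h1, h2⟩ := exists_counts_eq_position k s
  rw [← h2]
  refine Finset.single_le_sum (f := fun m => absCost g (T (displacement m) ω))
    (fun _ _ => absCost_nonneg _ _) (Fintype.mem_piFinset.2 fun z => ?_)
  have := le_stepCount m z
  rw [Finset.mem_range]
  omega

lemma abs_lowerEnergy_le (ω : Ω) (n : ℕ) (s : ℕ → R) :
    |lowerEnergy T g ω n s| ≤ n * maxCost T g n ω := by
  refine (Finset.abs_sum_le_sum_abs _ _).trans ?_
  calc ∑ k ∈ Finset.range n, |lowerTerm T g ω n k s|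
      ≤ ∑ k ∈ Finset.range n, maxCost T g n ω := Finset.sum_le_sum fun k hk =>
        (abs_lowerTerm_le ω n k s).trans (absCost_position_le ω (Finset.mem_range.1 hk).le s)
    _ = n * maxCost T g n ω := by simp

section

variable [Nonempty R]

lemma measurable_lowerWeight (ω : Ω) (n : ℕ) :
    Measurable fun s => ENNReal.ofReal (Real.exp (lowerEnergy T g ω n s)) :=
  measurable_of_finite_steps n fun _ _ h => by rw [lowerEnergy_congr h]

lemma pathWeight_le (ω : Ω) (n : ℕ) (x : LatticeGroup R) :
    pathWeight T g n x ω ≤ ENNReal.ofReal (Real.exp (n * maxCost T g n ω)) := by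
  calc pathWeight T g n x ω
      ≤ ∫⁻ s, ENNReal.ofReal (Real.exp (n * maxCost T g n ω)) ∂(walkLaw R) :=
        (setLIntegral_le_lintegral _ _).trans (lintegral_mono fun s =>
          ENNReal.ofReal_le_ofReal (Real.exp_le_exp.2 (abs_le.1 (abs_lowerEnergy_le ω n s)).2))
    _ = _ := by simp

lemma pathWeight_ne_top (ω : Ω) (n : ℕ) (x : LatticeGroup R) : pathWeight T g n x ω ≠ ∞ :=
  ne_top_of_le_ne_top ENNReal.ofReal_ne_top (pathWeight_le ω n x)

/-- Supermultiplicativity of the path weights. -/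
lemma pathWeight_mul_le (hadd : ∀ x y, T (x + y) = T x ∘ T y) (ω : Ω) (m n : ℕ)
    (x y : LatticeGroup R) :
    pathWeight T g m x ω * pathWeight T g n y (T x ω) ≤ pathWeight T g (m + n) (x + y) ω := by
  set f₁ : (ℕ → R) → ℝ≥0∞ := {s | position m s = x}.indicator fun s =>
    ENNReal.ofReal (Real.exp (lowerEnergy T g ω m s))
  set f₂ : (ℕ → R) → ℝ≥0∞ := {s | position n s = y}.indicator fun s =>
    ENNReal.ofReal (Real.exp (lowerEnergy T g (T x ω) n s))
  set f : (ℕ → R) → ℝ≥0∞ := {s | position (m + n) s = x + y}.indicator fun s =>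
    ENNReal.ofReal (Real.exp (lowerEnergy T g ω (m + n) s))
  have hf₁ : Measurable f₁ :=
    (measurable_lowerWeight ω m).indicator (measurableSet_position_eq m x)
  have hf₂ : Measurable f₂ :=
    (measurable_lowerWeight (T x ω) n).indicator (measurableSet_position_eq n y)
  have hf : Measurable f :=
    (measurable_lowerWeight ω (m + n)).indicator (measurableSet_position_eq (m + n) (x + y))
  rw [pathWeight, pathWeight, pathWeight, ← lintegral_indicator (measurableSet_position_eq _ _),
    ← lintegral_indicator (measurableSet_position_eq _ _),
    ← lintegral_indicator (measurableSet_position_eq _ _),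
    ← (measurePreserving_concat (R := R) m).lintegral_comp hf,
    ← lintegral_prod_mul hf₁.aemeasurable hf₂.aemeasurable]
  refine lintegral_mono fun p => ?_
  by_cases h1 : position m p.1 = x
  · by_cases h2 : position n p.2 = y
    · have h3 : position (m + n) (concat m p.1 p.2) = x + y := by
        rw [position_concat_add, h1, h2]
      have h4 := lowerEnergy_add_le (g := g) hadd ω m n p.1 p.2
      rw [h1] at h4
      simp only [f₁, f₂, f]
      rw [indicator_of_mem (show p.1 ∈ {s | position m s = x} from h1),
        indicator_of_mem (show p.2 ∈ {s | position n s = y} from h2),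
        indicator_of_mem (show concat m p.1 p.2 ∈ {s | position (m + n) s = x + y} from h3),
        ← ENNReal.ofReal_mul (Real.exp_pos _).le, ← Real.exp_add]
      exact ENNReal.ofReal_le_ofReal (Real.exp_le_exp.2 h4)
    · simp only [f₂]
      rw [indicator_of_notMem (show p.2 ∉ {s | position n s = y} from h2), mul_zero]
      exact zero_le
  · simp only [f₁]
    rw [indicator_of_notMem (show p.1 ∉ {s | position m s = x} from h1), zero_mul]
    exact zero_le

lemma pathWeight_zero (ω : Ω) : pathWeight T g 0 0 ω = 1 := by
  simp [pathWeight, position, lowerEnergy]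

/-- The cost of a single step, including its probability. -/
def stepCost (g : Ω × (Fin ℓ → R) → ℝ) (ω : Ω) : ℝ := absCost g ω + Real.log (Fintype.card R)

lemma exp_neg_stepCost_le_pathWeight (hT0 : T 0 = id) (z : R) (ω : Ω) :
    ENNReal.ofReal (Real.exp (-stepCost g ω)) ≤ pathWeight T g 1 (step z) ω := by
  have hc : (0 : ℝ) < Fintype.card R := by exact_mod_cast Fintype.card_pos
  have hle : {s : ℕ → R | s 0 = z} ⊆ {s | position 1 s = step z} := fun s hs => by
    have hs' : s 0 = z := hs
    simp [position, hs']
  calc ENNReal.ofReal (Real.exp (-stepCost g ω))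
      = ENNReal.ofReal (Real.exp (-absCost g ω)) * walkLaw R {s | s 0 = z} := by
        rw [walkLaw_first_step, ← ENNReal.ofReal_mul (Real.exp_pos _).le, stepCost, neg_add,
          Real.exp_add, Real.exp_neg (Real.log _), Real.exp_log hc]
    _ = ∫⁻ s in {s | s 0 = z}, ENNReal.ofReal (Real.exp (-absCost g ω)) ∂(walkLaw R) := by
        rw [setLIntegral_const]
    _ ≤ ∫⁻ s in {s | s 0 = z}, ENNReal.ofReal (Real.exp (lowerEnergy T g ω 1 s)) ∂(walkLaw R) := by
        refine lintegral_mono fun s => ENNReal.ofReal_le_ofReal (Real.exp_le_exp.2 ?_)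
        have := neg_absCost_le_lowerTerm (T := T) (g := g) ω 1 0 s
        rw [show position 0 s = 0 from rfl, hT0] at this
        simpa [lowerEnergy] using this
    _ ≤ _ := lintegral_mono_set hle

lemma pathWeight_pos (hT0 : T 0 = id) (hadd : ∀ x y, T (x + y) = T x ∘ T y) (m : R → ℕ) (ω : Ω) :
    0 < pathWeight T g (stepCount m) (displacement m) ω := by
  classical
  have hsingle : ∀ (z : R) (j : ℕ) (ω : Ω),
      0 < pathWeight T g (stepCount (j • Pi.single z 1 : R → ℕ))
        (displacement (j • Pi.single z 1)) ω := by
    intro z j ω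
    induction j with
    | zero => simp [pathWeight_zero]
    | succ j ih =>
      rw [succ_nsmul, stepCount_add, displacement_add]
      refine lt_of_lt_of_le ?_ (pathWeight_mul_le hadd ω _ _ _ _)
      refine ENNReal.mul_pos ih.ne' ?_
      rw [stepCount_single, displacement_single]
      refine (lt_of_lt_of_le ?_ (exp_neg_stepCost_le_pathWeight hT0 z _)).ne'
      exact ENNReal.ofReal_pos.2 (Real.exp_pos _)
  have key : ∀ (S : Finset R) (ω : Ω),
      0 < pathWeight T g (stepCount (∑ z ∈ S, m z • Pi.single z 1 : R → ℕ))
        (displacement (∑ z ∈ S, m z • Pi.single z 1)) ω := by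
    intro S
    induction S using Finset.induction_on with
    | empty => intro ω; simp [pathWeight_zero]
    | insert z S hz ih =>
      intro ω
      rw [Finset.sum_insert hz, stepCount_add, displacement_add]
      exact lt_of_lt_of_le (ENNReal.mul_pos (hsingle z _ ω).ne' (ih _).ne')
        (pathWeight_mul_le hadd ω _ _ _ _)
  have := key Finset.univ ω
  rwa [← eq_sum_nsmul_single] at this

lemma ofReal_exp_logWeight (hT0 : T 0 = id) (hadd : ∀ x y, T (x + y) = T x ∘ T y) (m : R → ℕ)
    (ω : Ω) :
    ENNReal.ofReal (Real.exp (logWeight T g m ω)) =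
      pathWeight T g (stepCount m) (displacement m) ω := by
  rw [logWeight, Real.exp_log, ENNReal.ofReal_toReal (pathWeight_ne_top _ _ _)]
  exact ENNReal.toReal_pos (pathWeight_pos hT0 hadd m ω).ne' (pathWeight_ne_top _ _ _)

lemma le_logWeight (hT0 : T 0 = id) (hadd : ∀ x y, T (x + y) = T x ∘ T y) {m : R → ℕ}
    {ω : Ω} {c : ℝ}
    (h : ENNReal.ofReal (Real.exp c) ≤ pathWeight T g (stepCount m) (displacement m) ω) :
    c ≤ logWeight T g m ω := by
  rw [← ofReal_exp_logWeight hT0 hadd, ENNReal.ofReal_le_ofReal_iff (Real.exp_pos _).le,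
    Real.exp_le_exp] at h
  exact h

lemma logWeight_le (hT0 : T 0 = id) (hadd : ∀ x y, T (x + y) = T x ∘ T y) {m : R → ℕ}
    {ω : Ω} {c : ℝ}
    (h : pathWeight T g (stepCount m) (displacement m) ω ≤ ENNReal.ofReal (Real.exp c)) :
    logWeight T g m ω ≤ c := by
  rw [← ofReal_exp_logWeight hT0 hadd, ENNReal.ofReal_le_ofReal_iff (Real.exp_pos _).le,
    Real.exp_le_exp] at h
  exact h

lemma logWeight_add_le (hT0 : T 0 = id) (hadd : ∀ x y, T (x + y) = T x ∘ T y) (m m' : R → ℕ)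
    (ω : Ω) :
    logWeight T g m ω + logWeight T g m' (T (displacement m) ω) ≤ logWeight T g (m + m') ω := by
  refine le_logWeight hT0 hadd ?_
  rw [Real.exp_add, ENNReal.ofReal_mul (Real.exp_pos _).le, ofReal_exp_logWeight hT0 hadd,
    ofReal_exp_logWeight hT0 hadd, stepCount_add, displacement_add]
  exact pathWeight_mul_le hadd ω _ _ _ _

lemma abs_logWeight_le (hT0 : T 0 = id) (hadd : ∀ x y, T (x + y) = T x ∘ T y) (m : R → ℕ) :
    ∃ C : ℝ, ∀ ω, |logWeight T g m ω| ≤ stepCount m * maxCost T g (stepCount m) ω + C := by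
  set n := stepCount m
  set p := walkLaw R {s | position n s = displacement m}
  refine ⟨|Real.log p.toReal|, fun ω => ?_⟩
  have hlow : ENNReal.ofReal (Real.exp (-(n * maxCost T g n ω))) * p ≤
      pathWeight T g n (displacement m) ω := by
    rw [← setLIntegral_const]
    exact lintegral_mono fun s =>
      ENNReal.ofReal_le_ofReal (Real.exp_le_exp.2 (abs_le.1 (abs_lowerEnergy_le ω n s)).1)
  have hp0 : p ≠ 0 := by
    intro h0
    have := pathWeight_pos (g := g) hT0 hadd m ω
    rw [pathWeight, Measure.restrict_eq_zero.2 h0, lintegral_zero_measure] at this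
    exact lt_irrefl _ this
  have hp1 : p ≠ ∞ := measure_ne_top _ _
  have hpos : 0 < p.toReal := ENNReal.toReal_pos hp0 hp1
  rw [abs_le]
  constructor
  · have h1 : -(n * maxCost T g n ω) + Real.log p.toReal ≤ logWeight T g m ω := by
      refine le_logWeight hT0 hadd ?_
      rwa [Real.exp_add, Real.exp_log hpos, ENNReal.ofReal_mul (Real.exp_pos _).le,
        ENNReal.ofReal_toReal hp1]
    linarith [neg_abs_le (Real.log p.toReal)]
  · have h1 := logWeight_le hT0 hadd (pathWeight_le (T := T) (g := g) ω n (displacement m))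
    linarith [abs_nonneg (Real.log p.toReal)]

variable [MeasurableSpace Ω]

omit [Nonempty R] in
lemma measurable_absCost (hgm : Measurable g) : Measurable (absCost g) :=
  Finset.measurable_sum _ fun _ _ => (hgm.comp (measurable_id.prodMk measurable_const)).abs

omit [Nonempty R] in
lemma measurable_lowerEnergy (hTm : ∀ x, Measurable (T x)) (hgm : Measurable g) (n : ℕ)
    (s : ℕ → R) : Measurable fun ω => lowerEnergy T g ω n s := by
  refine Finset.measurable_sum _ fun k _ => ?_
  unfold lowerTerm
  split_ifs with h
  · exact hgm.comp ((hTm _).prodMk measurable_const)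
  · exact ((measurable_absCost hgm).comp (hTm _)).neg

lemma measurable_pathWeight (hTm : ∀ x, Measurable (T x)) (hgm : Measurable g) (n : ℕ)
    (x : LatticeGroup R) : Measurable (pathWeight T g n x) := by
  have h : Measurable fun p : Ω × (ℕ → R) =>
      ENNReal.ofReal (Real.exp (lowerEnergy T g p.1 n p.2)) :=
    measurable_prod_of_finite_steps n
      (fun s => (Real.measurable_exp.comp (measurable_lowerEnergy hTm hgm n s)).ennreal_ofReal)
      fun ω s s' h => by dsimp only; rw [lowerEnergy_congr h]
  exact h.lintegral_prod_right'

end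

end Weights

/-! ### Exponential rates -/

lemma logRate_mono {n : ℕ} {x y : ℝ≥0∞} (h : x ≤ y) : logRate n x ≤ logRate n y :=
  mul_le_mul_of_nonneg_left (ENNReal.log_le_log h) (by exact_mod_cast inv_nonneg.2 n.cast_nonneg)

lemma logRate_ofReal_exp (n : ℕ) (t : ℝ) :
    logRate n (ENNReal.ofReal (Real.exp t)) = ((t / n : ℝ) : EReal) := by
  rw [logRate, ENNReal.log_ofReal_of_pos (Real.exp_pos t), Real.log_exp, ← EReal.coe_mul,
    inv_mul_eq_div]

lemma le_ofReal_exp_of_logRate_lt {n : ℕ} {x : ℝ≥0∞} {c : ℝ} (hn : 1 ≤ n)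
    (h : logRate n x < c) : x ≤ ENNReal.ofReal (Real.exp (n * c)) := by
  by_contra hx
  have h1 := logRate_mono (n := n) (not_le.1 hx).le
  have hn' : (n : ℝ) ≠ 0 := by positivity
  rw [logRate_ofReal_exp, mul_div_cancel_left₀ _ hn'] at h1
  exact absurd h (not_lt.2 h1)

lemma tendsto_logRate_of_le {t : ℕ → ℝ} {L : ℝ} {Y : ℕ → ℝ≥0∞}
    (ht : Tendsto (fun n => t n / n) atTop (𝓝 L))
    (hlow : ∀ n, ENNReal.ofReal (Real.exp (t n)) ≤ Y n)
    (hup : ∀ ε > 0, ∀ᶠ n : ℕ in atTop, Y n ≤ ENNReal.ofReal (Real.exp (t n + ε * n))) :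
    Tendsto (fun n => logRate n (Y n)) atTop (𝓝 (L : EReal)) := by
  have ht' : Tendsto (fun n => ((t n / n : ℝ) : EReal)) atTop (𝓝 (L : EReal)) :=
    (continuous_coe_real_ereal.tendsto L).comp ht
  refine tendsto_order.2 ⟨fun c hc => ?_, fun c hc => ?_⟩
  · filter_upwards [(tendsto_order.1 ht').1 c hc] with n hn
    refine hn.trans_le ?_
    rw [← logRate_ofReal_exp]
    exact logRate_mono (hlow n)
  · obtain ⟨r, hr1, hr2⟩ := EReal.lt_iff_exists_real_btwn.1 hc
    have hr1' : L < r := EReal.coe_lt_coe_iff.1 hr1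
    filter_upwards [(tendsto_order.1 ht).2 ((L + r) / 2) (by linarith),
      hup ((r - L) / 2) (by linarith), eventually_ge_atTop 1] with n h1 h2 h3
    have hn : (n : ℝ) ≠ 0 := by positivity
    refine lt_of_le_of_lt ((logRate_mono h2).trans ?_) hr2
    rw [logRate_ofReal_exp, EReal.coe_le_coe_iff, add_div, mul_div_cancel_right₀ _ hn]
    linarith

/-! ### Potentials of the class `L` -/

section Lines

variable {d : ℕ} {R : Finset (Fin d → ℤ)} {Ω : Type*} {T : LatticeGroup R → Ω → Ω} {ω : Ω}

lemma SublinearOnLines.add {G G' : Ω → ℝ} (h : SublinearOnLines T G ω)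
    (h' : SublinearOnLines T G' ω) : SublinearOnLines T (fun ω => G ω + G' ω) ω := by
  intro C ε hε
  obtain ⟨η, hη, N, h1⟩ := h C (ε / 2) (half_pos hε)
  obtain ⟨η', hη', N', h2⟩ := h' C (ε / 2) (half_pos hε)
  refine ⟨min η η', lt_min hη hη', max N N', fun n hn x hx z hz j hj => ?_⟩
  have hn0 : (0 : ℝ) ≤ n := n.cast_nonneg
  have h3 := h1 n (le_trans (le_max_left _ _) hn) x hx z hz j
    (hj.trans (mul_le_mul_of_nonneg_right (min_le_left _ _) hn0))
  have h4 := h2 n (le_trans (le_max_right _ _) hn) x hx z hz j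
    (hj.trans (mul_le_mul_of_nonneg_right (min_le_right _ _) hn0))
  rw [Finset.sum_add_distrib]
  linarith

lemma sublinearOnLines_const {c : ℝ} (hc : 0 ≤ c) : SublinearOnLines T (fun _ => c) ω := by
  intro C ε hε
  refine ⟨ε / (c + 1), by positivity, 0, fun n _ x _ z _ j hj => ?_⟩
  rw [div_mul_eq_mul_div, le_div_iff₀ (by positivity)] at hj
  simp only [Finset.sum_const, Finset.card_range, nsmul_eq_mul]
  nlinarith [(Nat.cast_nonneg j : (0 : ℝ) ≤ j)]

lemma SublinearOnLines.sum {ι : Type*} (s : Finset ι) {G : ι → Ω → ℝ}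
    (h : ∀ i, SublinearOnLines T (G i) ω) :
    SublinearOnLines T (fun ω => ∑ i ∈ s, G i ω) ω := by
  classical
  induction s using Finset.induction_on with
  | empty => simpa using sublinearOnLines_const (T := T) (ω := ω) le_rfl
  | insert i s hi ih => simpa only [Finset.sum_insert hi] using (h i).add ih

/-- The defining condition of the class, freed of its upper limits. -/
lemma eventually_sum_le_of_limsup_eq_zero {f : Ω → ℝ} {z : R}
    (h : limsup (fun ε : ℝ =>
        limsup (fun n : ℕ =>
          ⨆ x : LatticeGroup R, ⨆ _ : ‖toEuclid x.1‖ ≤ (n : ℝ),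
            (n : ℝ≥0∞)⁻¹ * ∑ k ∈ Finset.range (⌊ε * n⌋₊ + 1),
              ENNReal.ofReal |f (T (x + k • step z) ω)|) atTop) (𝓝[>] 0) = 0)
    {δ : ℝ} (hδ : 0 < δ) :
    ∀ᶠ ε : ℝ in 𝓝[>] 0, ∀ᶠ n : ℕ in atTop, ∀ x : LatticeGroup R, ‖toEuclid x.1‖ ≤ n →
      ∑ k ∈ Finset.range (⌊ε * n⌋₊ + 1), |f (T (x + k • step z) ω)| ≤ δ * n := by
  have h1 := eventually_lt_of_limsup_lt (h.trans_lt (ENNReal.ofReal_pos.2 hδ))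
  filter_upwards [h1] with ε hε
  filter_upwards [eventually_lt_of_limsup_lt hε, eventually_ge_atTop 1] with n hn hn1 x hx
  have h2 := (le_iSup₂ (f := fun (x : LatticeGroup R) (_ : ‖toEuclid x.1‖ ≤ (n : ℝ)) =>
    (n : ℝ≥0∞)⁻¹ * ∑ k ∈ Finset.range (⌊ε * n⌋₊ + 1),
      ENNReal.ofReal |f (T (x + k • step z) ω)|) x hx).trans hn.le
  rw [ENNReal.inv_mul_le_iff (by simp; omega) (by simp),
    ← ENNReal.ofReal_sum_of_nonneg fun _ _ => abs_nonneg _, ← ENNReal.ofReal_natCast,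
    ← ENNReal.ofReal_mul n.cast_nonneg, ENNReal.ofReal_le_ofReal_iff (by positivity)] at h2
  linarith

lemma sublinearOnLines_abs {f : Ω → ℝ}
    (h : ∀ z : R, z.1 ≠ 0 → ∀ δ > 0, ∀ᶠ ε : ℝ in 𝓝[>] 0, ∀ᶠ n : ℕ in atTop,
      ∀ x : LatticeGroup R, ‖toEuclid x.1‖ ≤ n →
      ∑ k ∈ Finset.range (⌊ε * n⌋₊ + 1), |f (T (x + k • step z) ω)| ≤ δ * n) :
    SublinearOnLines T (fun ω => |f ω|) ω := by
  intro C δ hδ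
  obtain ⟨c, hc⟩ := exists_nat_ge (max C 1)
  have hc1 : 1 ≤ c := by exact_mod_cast (le_max_right C 1).trans hc
  have hcC : C ≤ c := (le_max_left C 1).trans hc
  have hc0 : (0 : ℝ) < c := by exact_mod_cast hc1
  have h1 : ∀ᶠ ε : ℝ in 𝓝[>] 0, ∀ z : R, z.1 ≠ 0 → ∀ᶠ n : ℕ in atTop,
      ∀ x : LatticeGroup R, ‖toEuclid x.1‖ ≤ n →
      ∑ k ∈ Finset.range (⌊ε * n⌋₊ + 1), |f (T (x + k • step z) ω)| ≤ δ / c * n := by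
    refine eventually_all.2 fun z => ?_
    by_cases hz : z.1 = 0
    · simp [hz]
    · filter_upwards [h z hz (δ / c) (by positivity)] with ε hε _ using hε
  obtain ⟨ε, hε, hε0⟩ := (h1.and self_mem_nhdsWithin).exists
  have hε0' : 0 < ε := hε0
  have h2 : ∀ᶠ n : ℕ in atTop, ∀ z : R, z.1 ≠ 0 → ∀ x : LatticeGroup R, ‖toEuclid x.1‖ ≤ n →
      ∑ k ∈ Finset.range (⌊ε * n⌋₊ + 1), |f (T (x + k • step z) ω)| ≤ δ / c * n := by
    refine eventually_all.2 fun z => ?_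
    by_cases hz : z.1 = 0
    · simp [hz]
    · filter_upwards [hε z hz] with n hn _ using hn
  obtain ⟨N, hN⟩ := eventually_atTop.1 h2
  refine ⟨ε, hε0', N, fun n hn x hx z hz j hj => ?_⟩
  -- The ball of radius `C * n` lies in the ball of radius `c * n`.
  have h3 := hN (c * n) (hn.trans (Nat.le_mul_of_pos_left n hc1)) z hz x (by
    push_cast
    exact hx.trans (mul_le_mul_of_nonneg_right hcC n.cast_nonneg))
  have hjn : j ≤ ⌊ε * ((c * n : ℕ) : ℝ)⌋₊ + 1 := by
    refine (Nat.le_floor (hj.trans ?_)).trans (Nat.le_succ _)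
    have : (n : ℝ) ≤ ((c * n : ℕ) : ℝ) := by exact_mod_cast Nat.le_mul_of_pos_left n hc1
    exact mul_le_mul_of_nonneg_left this hε0'.le
  calc ∑ i ∈ Finset.range j, |f (T (x + i • step z) ω)|
      ≤ _ := Finset.sum_le_sum_of_subset_of_nonneg (Finset.range_mono hjn)
        fun _ _ _ => abs_nonneg _
    _ ≤ _ := h3
    _ = δ * n := by push_cast; field_simp

/-- The potential along all paths of `n` steps is `o(n)`. -/
lemma SublinearOnLines.eventually_position_le {G : Ω → ℝ} (h : SublinearOnLines T G ω)
    (hT0 : T 0 = id) {ε : ℝ} (hε : 0 < ε) :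
    ∀ᶠ n : ℕ in atTop, ∀ k ≤ n, ∀ s : ℕ → R, G (T (position k s) ω) ≤ ε * n := by
  by_cases hz : ∃ z : R, z.1 ≠ 0
  · obtain ⟨z, hz⟩ := hz
    obtain ⟨η, hη, N, h1⟩ := h (stepBound R) ε hε
    obtain ⟨M, hM⟩ := exists_nat_gt (1 / η)
    filter_upwards [eventually_ge_atTop (max N M)] with n hn k hk s
    obtain ⟨m, hm1, hm2⟩ := exists_counts_eq_position k s
    have h2 := h1 n (le_trans (le_max_left _ _) hn) (position k s) (by
      rw [← hm2]
      refine (norm_displacement_le m).trans (mul_le_mul_of_nonneg_left ?_ stepBound_nonneg)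
      rw [hm1]
      exact_mod_cast hk) z hz 1 (by
      have : (M : ℝ) ≤ n := by exact_mod_cast le_trans (le_max_right _ _) hn
      rw [div_lt_iff₀ hη] at hM
      push_cast
      nlinarith)
    simpa using h2
  · push Not at hz
    have hstep : ∀ z : R, step z = 0 := fun z => Subtype.ext (hz z)
    obtain ⟨M, hM⟩ := exists_nat_gt (G ω / ε)
    filter_upwards [eventually_ge_atTop M] with n hn k _ s
    have : (M : ℝ) ≤ n := by exact_mod_cast hn
    rw [div_lt_iff₀ hε] at hM
    simp only [position, hstep, Finset.sum_const_zero, hT0, id]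
    nlinarith

end Lines

/-! ### The point-to-point weights as a superadditive field -/

section Field

variable {d : ℕ} {R : Finset (Fin d → ℤ)} {Ω : Type*} {T : LatticeGroup R → Ω → Ω} {ℓ : ℕ}
  {g : Ω × (Fin ℓ → R) → ℝ} [MeasurableSpace Ω] {P : Measure Ω} [Nonempty R]

omit [Nonempty R] in
lemma InClassL.integrable_absCost (hg : InClassL P T g) : Integrable (absCost g) P :=
  integrable_finsetSum _ fun zt _ => (hg zt).1.abs

omit [Nonempty R] in
lemma log_card_nonneg : 0 ≤ Real.log (Fintype.card R) := Real.log_natCast_nonneg _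

omit [Nonempty R] in
lemma InClassL.ae_sublinearOnLines (hg : InClassL P T g) :
    ∀ᵐ ω ∂P, SublinearOnLines T (stepCost g) ω := by
  have h1 : ∀ᵐ ω ∂P, ∀ zt : Fin ℓ → R, ∀ z : R, z.1 ≠ 0 →
      limsup (fun ε : ℝ =>
        limsup (fun n : ℕ =>
          ⨆ x : LatticeGroup R, ⨆ _ : ‖toEuclid x.1‖ ≤ (n : ℝ),
            (n : ℝ≥0∞)⁻¹ * ∑ k ∈ Finset.range (⌊ε * n⌋₊ + 1),
              ENNReal.ofReal |g (T (x + k • step z) ω, zt)|) atTop) (𝓝[>] 0) = 0 := by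
    refine ae_all_iff.2 fun zt => ae_all_iff.2 fun z => ?_
    by_cases hz : z.1 = 0
    · exact ae_of_all _ fun _ h => absurd hz h
    · filter_upwards [(hg zt).2 z hz] with ω hω _ using hω
  filter_upwards [h1] with ω hω
  exact (SublinearOnLines.sum Finset.univ fun zt => sublinearOnLines_abs fun z hz δ hδ =>
    eventually_sum_le_of_limsup_eq_zero (f := fun ω => g (ω, zt)) (hω zt z hz) hδ).add
    (sublinearOnLines_const log_card_nonneg)

theorem InClassL.isSuperadditiveField [IsProbabilityMeasure P] (hg : InClassL P T g)
    (hgm : Measurable g) (hT : IsErgodicSystem R P T) :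
    IsSuperadditiveField P T (stepCost g) (logWeight T g) where
  nonneg ω := add_nonneg (absCost_nonneg g ω) log_card_nonneg
  integrable_cost := hg.integrable_absCost.add (integrable_const _)
  sublinear := hg.ae_sublinearOnLines
  measurable m := Real.measurable_log.comp
    (measurable_pathWeight (fun x => (hT.measurePreserving x).measurable) hgm _ _).ennreal_toReal
  integrable m := by
    obtain ⟨C, hC⟩ := abs_logWeight_le (g := g) hT.map_zero hT.map_add m
    have hmax : Integrable (maxCost T g (stepCount m)) P := integrable_finsetSum _ fun k _ =>
      (hT.measurePreserving (displacement k)).integrable_comp_of_integrable hg.integrable_absCost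
    refine Integrable.mono' ((hmax.const_mul (stepCount m : ℝ)).add (integrable_const C))
      (Real.measurable_log.comp (measurable_pathWeight
        (fun x => (hT.measurePreserving x).measurable) hgm _ _).ennreal_toReal).aestronglyMeasurable
      (ae_of_all _ hC)
  zero ω := by simp [logWeight, pathWeight_zero]
  congr m m' h1 h2 := by funext ω; rw [logWeight, logWeight, h1, h2]
  add_le m m' ω := logWeight_add_le hT.map_zero hT.map_add m m' ω
  single_ge z ω := by
    refine le_logWeight hT.map_zero hT.map_add ?_
    rw [stepCount_single, displacement_single]
    exact exp_neg_stepCost_le_pathWeight hT.map_zero z ω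

omit [MeasurableSpace Ω] [Nonempty R] in
lemma pathWeight_le_lintegral_weight (ω : Ω) (n : ℕ) (x : LatticeGroup R) :
    pathWeight T g n x ω ≤ ∫⁻ s in {s | position n s = x}, weight T g ω n s ∂(walkLaw R) :=
  lintegral_mono fun s =>
    ENNReal.ofReal_le_ofReal (Real.exp_le_exp.2 (lowerEnergy_le_energy ω n s))

omit [MeasurableSpace Ω] in
lemma linearlyBoundedAbove_logWeight (hT0 : T 0 = id) (hadd : ∀ x y, T (x + y) = T x ∘ T y)
    {ω : Ω} (h : freeEnergy T g ω ≠ ⊤) : LinearlyBoundedAbove (logWeight T g) ω := by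
  obtain ⟨C, hC, -⟩ := EReal.lt_iff_exists_real_btwn.1 (lt_top_iff_ne_top.2 h)
  obtain ⟨N, hN⟩ := eventually_atTop.1 (eventually_lt_of_limsup_lt hC)
  refine ⟨C, max N 1, fun m hm => ?_⟩
  have h1 := le_ofReal_exp_of_logRate_lt (le_trans (le_max_right _ _) hm)
    (hN _ (le_trans (le_max_left _ _) hm))
  rw [mul_comm]
  exact logWeight_le hT0 hadd (((pathWeight_le_lintegral_weight ω _ _).trans
    (setLIntegral_le_lintegral _ _)).trans h1)

omit [MeasurableSpace Ω] in
/-- The terms of the energy that look beyond time `n` are exponentially negligible. -/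
lemma eventually_lintegral_weight_le (hT0 : T 0 = id) (hadd : ∀ x y, T (x + y) = T x ∘ T y)
    {ω : Ω} (hω : SublinearOnLines T (stepCost g) ω) {ε : ℝ} (hε : 0 < ε) :
    ∀ᶠ n : ℕ in atTop, ∀ m : R → ℕ, stepCount m = n →
      ∫⁻ s in {s | position n s = displacement m}, weight T g ω n s ∂(walkLaw R) ≤
        ENNReal.ofReal (Real.exp (logWeight T g m ω + ε * n)) := by
  have hδ : 0 < ε / (2 * ℓ + 1) := by positivity
  filter_upwards [hω.eventually_position_le hT0 hδ] with n hn m hm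
  have h1 : ∀ s, energy T g ω n s ≤ ε * n + lowerEnergy T g ω n s := by
    intro s
    refine (energy_le_lowerEnergy_add (c := ε / (2 * ℓ + 1) * n) (by positivity) fun k hk =>
      (le_add_of_nonneg_right log_card_nonneg).trans (hn k hk.le s)).trans ?_
    have h2 : (ℓ : ℝ) * (2 * (ε / (2 * ℓ + 1) * n)) ≤ ε * n := by
      have : (ℓ : ℝ) * (2 * (ε / (2 * ℓ + 1) * n)) = ε * n * ((2 * ℓ) / (2 * ℓ + 1)) := by ring
      rw [this]
      refine mul_le_of_le_one_right (by positivity) ((div_le_one (by positivity)).2 (by linarith))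
    linarith
  rw [add_comm (logWeight T g m ω), Real.exp_add, ENNReal.ofReal_mul (Real.exp_pos _).le,
    ofReal_exp_logWeight hT0 hadd, hm, pathWeight,
    ← lintegral_const_mul _ (measurable_lowerWeight ω n)]
  refine lintegral_mono fun s => ?_
  rw [← ENNReal.ofReal_mul (Real.exp_pos _).le, ← Real.exp_add]
  exact ENNReal.ofReal_le_ofReal (Real.exp_le_exp.2 (h1 s))

omit [MeasurableSpace Ω] in
lemma tendsto_logRate_pointPartitionFunction (hT0 : T 0 = id)
    (hadd : ∀ x y, T (x + y) = T x ∘ T y) {ω : Ω} (hω : SublinearOnLines T (stepCost g) ω)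
    {m : ℕ → R → ℕ} (hm : ∀ n, stepCount (m n) = n) {L : ℝ}
    (hL : Tendsto (fun n => logWeight T g (m n) ω / n) atTop (𝓝 L)) :
    Tendsto (fun n => logRate n (pointPartitionFunction T g ω n (displacement (m n)).1)) atTop
      (𝓝 (L : EReal)) := by
  have hset : ∀ n, pointPartitionFunction T g ω n (displacement (m n)).1 =
      ∫⁻ s in {s | position n s = displacement (m n)}, weight T g ω n s ∂(walkLaw R) := by
    intro n
    simp only [pointPartitionFunction, SetLike.coe_eq_coe]
  refine tendsto_logRate_of_le hL (fun n => ?_) fun ε hε => ?_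
  · rw [hset, ofReal_exp_logWeight hT0 hadd, hm]
    exact pathWeight_le_lintegral_weight ω n _
  · filter_upwards [eventually_lintegral_weight_le hT0 hadd hω hε] with n hn
    rw [hset]
    exact hn (m n) (hm n)

end Field

/-! ### Exponential rates of sets of velocities -/

lemma logRate_inv_mul (n : ℕ) (x y : ℝ≥0∞) :
    logRate n (x⁻¹ * y) = -logRate n x + logRate n y := by
  have h0 : (0 : EReal) ≤ (((n : ℝ)⁻¹ : ℝ) : EReal) := by
    exact_mod_cast inv_nonneg.2 n.cast_nonneg
  rw [logRate, ENNReal.log_mul_add, ENNReal.log_inv,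
    EReal.left_distrib_of_nonneg_of_ne_top h0 (EReal.coe_ne_top _), mul_neg]
  rfl

lemma eventually_mul_log_succ_le (K : ℕ) {ε : ℝ} (hε : 0 < ε) :
    ∀ᶠ n : ℕ in atTop, (K : ℝ) * Real.log (n + 1) ≤ ε * n := by
  have h1 : Tendsto (fun n : ℕ => Real.log ((n : ℝ) + 1) / ((n : ℝ) + 1)) atTop (𝓝 0) := by
    have := (Real.tendsto_pow_log_div_mul_add_atTop 1 0 1 one_ne_zero).comp
      (tendsto_atTop_add_const_right atTop (1 : ℝ) tendsto_natCast_atTop_atTop)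
    simpa [Function.comp_def] using this
  have hδ : 0 < ε / (2 * (K + 1)) := by positivity
  filter_upwards [(tendsto_order.1 h1).2 _ hδ, eventually_ge_atTop 1] with n hn hn1
  have hn1' : (1 : ℝ) ≤ n := by exact_mod_cast hn1
  rw [div_lt_iff₀ (by positivity)] at hn
  calc (K : ℝ) * Real.log (n + 1) ≤ K * (ε / (2 * (K + 1)) * (n + 1)) := by gcongr
    _ ≤ (K + 1) * (ε / (2 * (K + 1)) * (n + n)) := by gcongr; linarith
    _ = ε * n := by field_simp; ring

section LargeDeviations

variable {d : ℕ} {R : Finset (Fin d → ℤ)} {Ω : Type*} {T : LatticeGroup R → Ω → Ω} {ℓ : ℕ}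
  {g : Ω × (Fin ℓ → R) → ℝ}

/-- The part of the partition function that comes from the paths whose mean velocity lies in a
given set. -/
def endpointWeight (T : LatticeGroup R → Ω → Ω) (g : Ω × (Fin ℓ → R) → ℝ) (ω : Ω) (n : ℕ)
    (A : Set (EuclideanSpace ℝ (Fin d))) : ℝ≥0∞ :=
  (walkLaw R).withDensity (weight T g ω n) {s | (n : ℝ)⁻¹ • toEuclid (position n s).1 ∈ A}

lemma velocity_eq_of_position {m : R → ℕ} {n : ℕ} (hm : stepCount m = n) {s : ℕ → R}
    (hs : position n s = displacement m) :
    (n : ℝ)⁻¹ • toEuclid (position n s).1 = velocity m := by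
  rw [velocity, hm, hs]

lemma endpointWeight_univ (ω : Ω) (n : ℕ) :
    endpointWeight T g ω n univ = partitionFunction T g ω n := by
  simp [endpointWeight, partitionFunction]

variable [Nonempty R]

lemma endpointLaw_apply (ω : Ω) (n : ℕ) {A : Set (EuclideanSpace ℝ (Fin d))}
    (hA : MeasurableSet A) :
    endpointLaw T g ω n A = (partitionFunction T g ω n)⁻¹ * endpointWeight T g ω n A := by
  have hm : Measurable fun s : ℕ → R => (n : ℝ)⁻¹ • toEuclid (position n s).1 :=
    measurable_of_finite_steps n fun _ _ h => by rw [position_congr h]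
  rw [endpointLaw, Measure.map_apply hm hA, polymerMeasure, Measure.smul_apply, smul_eq_mul]
  rfl

lemma lintegral_weight_le_endpointWeight {ω : Ω} {n : ℕ} {m : R → ℕ} (hm : stepCount m = n)
    {A : Set (EuclideanSpace ℝ (Fin d))} (hA : velocity m ∈ A) :
    ∫⁻ s in {s | position n s = displacement m}, weight T g ω n s ∂(walkLaw R) ≤
      endpointWeight T g ω n A := by
  rw [← withDensity_apply _ (measurableSet_position_eq _ _)]
  refine measure_mono fun s hs => ?_
  have hs' : position n s = displacement m := hs
  rw [mem_ofPred_eq, velocity_eq_of_position hm hs']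
  exact hA

/-- Only polynomially many endpoints can be reached. -/
lemma endpointWeight_le {ω : Ω} {n : ℕ} {A : Set (EuclideanSpace ℝ (Fin d))} {c : ℝ≥0∞}
    (h : ∀ m : R → ℕ, stepCount m = n → velocity m ∈ A →
      ∫⁻ s in {s | position n s = displacement m}, weight T g ω n s ∂(walkLaw R) ≤ c) :
    endpointWeight T g ω n A ≤ ((n + 1 : ℕ) : ℝ≥0∞) ^ Fintype.card R * c := by
  classical
  set S := (Fintype.piFinset fun _ : R => Finset.range (n + 1)).filter fun m =>
    stepCount m = n ∧ velocity m ∈ A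
  have hsub : {s : ℕ → R | (n : ℝ)⁻¹ • toEuclid (position n s).1 ∈ A} ⊆
      ⋃ m ∈ S, {s | position n s = displacement m} := by
    intro s hs
    obtain ⟨m, h1, h2⟩ := exists_counts_eq_position n s
    rw [mem_ofPred_eq, velocity_eq_of_position h1 h2.symm] at hs
    refine mem_iUnion₂.2 ⟨m, Finset.mem_filter.2 ⟨Fintype.mem_piFinset.2 fun z => ?_, h1, hs⟩,
      h2.symm⟩
    have := le_stepCount m z
    rw [Finset.mem_range]
    omega
  calc endpointWeight T g ω n A
      ≤ ∑ m ∈ S, (walkLaw R).withDensity (weight T g ω n) {s | position n s = displacement m} :=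
        (measure_mono hsub).trans (measure_biUnion_finset_le _ _)
    _ ≤ ∑ _m ∈ S, c := Finset.sum_le_sum fun m hm => by
        rw [withDensity_apply _ (measurableSet_position_eq _ _)]
        exact h m (Finset.mem_filter.1 hm).2.1 (Finset.mem_filter.1 hm).2.2
    _ = (S.card : ℝ≥0∞) * c := by rw [Finset.sum_const, nsmul_eq_mul]
    _ ≤ _ := by
        gcongr
        refine (Nat.cast_le.2 (Finset.card_filter_le _ _)).trans (le_of_eq ?_)
        simp

variable [MeasurableSpace Ω] {P : Measure Ω}

/-- A strict bound for the regularized rate on a closed set bounds the field, uniformly over all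
count vectors with velocity in that set: the closed set of velocities is compact, so that a
direction near it still has a small rate. -/
lemma IsRegularAt.eventually_le_of_uscReg_lt {G : Ω → ℝ} {a : (R → ℕ) → Ω → ℝ} {ω : Ω}
    (hω : IsRegularAt P T G a ω) (ha : IsSuperadditiveField P T G a) (hT0 : T 0 = id)
    {A : Set (EuclideanSpace ℝ (Fin d))} (hA : IsClosed A) {c : ℝ}
    (hc : ∀ ζ ∈ A ∩ velocitySet R, uscReg (interiorRate P a) ζ < c) {ε : ℝ} (hε : 0 < ε) :
    ∀ᶠ n : ℕ in atTop, ∀ m : R → ℕ, stepCount m = n → velocity m ∈ A → a m ω ≤ n * (c + ε) := by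
  have hK : IsCompact (A ∩ velocitySet R) := isCompact_velocitySet.inter_left hA
  choose! B hB hmem hlt using fun ζ (hζ : ζ ∈ A ∩ velocitySet R) =>
    exists_open_of_uscReg_lt (hc ζ hζ)
  obtain ⟨δ, hδ, hball⟩ := lebesgue_number_lemma_of_metric
    (c := fun ζ : ↥(A ∩ velocitySet R) => B ζ) hK (fun ζ => hB ζ ζ.2)
    fun ζ hζ => mem_iUnion.2 ⟨⟨ζ, hζ⟩, hmem ζ hζ⟩
  have hε₀ : 0 < min ε (δ / 2) := lt_min hε (half_pos hδ)
  obtain ⟨N, hN1, hN⟩ := hω.exists_rate_ge ha hT0 hε₀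
  filter_upwards [eventually_ge_atTop N] with n hn m hm hmA
  obtain ⟨k, hk, hle, hdist⟩ := hN n hn m hm
  obtain ⟨ζ, hζ⟩ := hball (velocity m) ⟨hmA, velocity_mem (by omega)⟩
  have h1 : velocity k ∈ B ζ :=
    hζ (Metric.mem_ball.2 (hdist.trans_lt ((min_le_right _ _).trans_lt (half_lt_self hδ))))
  have h2 := (le_interiorRate (P := P) (a := a) hk).trans_lt (hlt ζ ζ.2 _ h1)
  refine hle.trans (mul_le_mul_of_nonneg_left ?_ n.cast_nonneg)
  exact add_le_add (EReal.coe_lt_coe_iff.1 h2).le (min_le_left _ _)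

variable {ω : Ω} (hω : IsRegularAt P T (stepCost g) (logWeight T g) ω)
  (ha : IsSuperadditiveField P T (stepCost g) (logWeight T g)) (hT : IsErgodicSystem R P T)
include hω ha hT

lemma IsRegularAt.limsup_logRate_endpointWeight_le {A : Set (EuclideanSpace ℝ (Fin d))}
    (hA : IsClosed A) :
    limsup (fun n : ℕ => logRate n (endpointWeight T g ω n A)) atTop ≤
      ⨆ ζ ∈ A, uscReg (interiorRate P (logWeight T g)) ζ := by
  refine le_of_forall_gt fun c' hc' => ?_
  obtain ⟨c, hc, hcc'⟩ := EReal.lt_iff_exists_real_btwn.1 hc'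
  obtain ⟨r, hr, hrc'⟩ := EReal.lt_iff_exists_real_btwn.1 hcc'
  have hr' : c < r := EReal.coe_lt_coe_iff.1 hr
  have hε : 0 < (r - c) / 3 := by linarith
  refine lt_of_le_of_lt (b := (r : EReal)) ?_ hrc'
  refine limsup_le_of_le (h := ?_)
  filter_upwards [hω.eventually_le_of_uscReg_lt ha hT.map_zero hA (c := c)
      (fun ζ hζ => (le_iSup₂ (f := fun ζ (_ : ζ ∈ A) =>
        uscReg (interiorRate P (logWeight T g)) ζ) ζ hζ.1).trans_lt hc) hε,
    eventually_lintegral_weight_le hT.map_zero hT.map_add hω.sublinear hε,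
    eventually_mul_log_succ_le (Fintype.card R) hε, eventually_ge_atTop 1] with n h1 h2 h3 h4
  have h5 := endpointWeight_le (T := T) (g := g) (ω := ω) (n := n) (A := A)
    (c := ENNReal.ofReal (Real.exp (n * (c + (r - c) / 3) + (r - c) / 3 * n)))
    fun m hm hmA => (h2 m hm).trans (ENNReal.ofReal_le_ofReal (Real.exp_le_exp.2
      (add_le_add (h1 m hm hmA) le_rfl)))
  have hpow : (((n + 1 : ℕ) : ℝ≥0∞)) ^ Fintype.card R =
      ENNReal.ofReal (Real.exp (Fintype.card R * Real.log (n + 1))) := by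
    rw [mul_comm, Real.exp_mul, Real.exp_log (by positivity), Real.rpow_natCast,
      ENNReal.ofReal_pow (by positivity)]
    congr 1
    rw [← Nat.cast_add_one, ENNReal.ofReal_natCast]
  rw [hpow, ← ENNReal.ofReal_mul (Real.exp_pos _).le, ← Real.exp_add] at h5
  refine (logRate_mono h5).trans ?_
  rw [logRate_ofReal_exp, EReal.coe_le_coe_iff, div_le_iff₀ (by exact_mod_cast h4)]
  linarith

variable {β : EuclideanSpace ℝ (Fin d) → R → ℝ} {b : ℕ → EuclideanSpace ℝ (Fin d) → R → ℕ}
  (hβ : IsVelocityChoice R β b)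
include hβ

lemma IsRegularAt.iSup_le_liminf_logRate_endpointWeight {O : Set (EuclideanSpace ℝ (Fin d))}
    (hO : IsOpen O) :
    ⨆ ζ ∈ O, uscReg (interiorRate P (logWeight T g)) ζ ≤
      liminf (fun n : ℕ => logRate n (endpointWeight T g ω n O)) atTop := by
  refine iSup₂_le fun ζ hζ => le_of_forall_lt fun c hc => ?_
  obtain ⟨y, hy, hcy⟩ := exists_lt_of_lt_uscReg hc hO hζ
  obtain ⟨k, hk, rfl, hck⟩ := exists_of_lt_interiorRate hcy
  have hkU : velocity k ∈ velocitySet R := velocity_mem (one_le_stepCount hk)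
  have hm : ∀ n, stepCount (roundedCounts β b (velocity k) n) = n :=
    hβ.stepCount_roundedCounts hkU
  refine hck.trans_le ?_
  have h1 := hω.tendsto_roundedCounts_velocity ha hT.map_zero hβ hk
  have h2 : Tendsto (fun n : ℕ => ((logWeight T g (roundedCounts β b (velocity k) n) ω / n : ℝ) :
      EReal)) atTop (𝓝 (velocityRate P (logWeight T g) k : EReal)) :=
    (continuous_coe_real_ereal.tendsto _).comp h1
  rw [← h2.liminf_eq]
  refine liminf_le_liminf ?_
  filter_upwards [(hβ.tendsto_velocity hkU).eventually_mem (hO.mem_nhds hy)] with n hn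
  rw [← logRate_ofReal_exp, ofReal_exp_logWeight hT.map_zero hT.map_add, hm]
  exact logRate_mono ((pathWeight_le_lintegral_weight ω n _).trans
    (lintegral_weight_le_endpointWeight (hm n) hn))

omit ha in
/-- The point-to-point free energy is the limit of the field along the rounded counts. -/
lemma IsRegularAt.tendsto_pointFreeEnergy {ζ : EuclideanSpace ℝ (Fin d)} (hζ : ζ ∈ velocitySet R)
    {L : ℝ} (hL : Tendsto (fun n => logWeight T g (roundedCounts β b ζ n) ω / n) atTop (𝓝 L)) :
    pointFreeEnergy T g β b ω ζ = L ∧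
    Tendsto (fun n : ℕ => logRate n (pointPartitionFunction T g ω n (latticePoint β b n ζ))) atTop
      (𝓝 (L : EReal)) := by
  have h := tendsto_logRate_pointPartitionFunction hT.map_zero hT.map_add hω.sublinear
    (hβ.stepCount_roundedCounts hζ) hL
  simp only [displacement_roundedCounts] at h
  exact ⟨by rw [pointFreeEnergy, if_pos hζ]; exact h.limsup_eq, h⟩

omit [Nonempty R] in
lemma IsRegularAt.exists_tendsto_roundedCounts {ζ : EuclideanSpace ℝ (Fin d)}
    (hζ : ζ ∈ velocitySet R) :
    ∃ L : ℝ, Tendsto (fun n => logWeight T g (roundedCounts β b ζ n) ω / n) atTop (𝓝 L) :=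
  hω.exists_tendsto_of_direction ha hT.map_zero (hβ.nonneg ζ hζ) (hβ.stepCount_roundedCounts hζ)
    (hβ.abs_roundedCounts_sub_le hζ) (hβ.roundedCounts_eq_zero hζ)

lemma IsRegularAt.pointFreeEnergy_le (ζ : EuclideanSpace ℝ (Fin d)) :
    pointFreeEnergy T g β b ω ζ ≤ uscReg (interiorRate P (logWeight T g)) ζ := by
  by_cases hζ : ζ ∈ velocitySet R
  · obtain ⟨L, hL⟩ := hω.exists_tendsto_roundedCounts ha hT hβ hζ
    rw [(hω.tendsto_pointFreeEnergy hT hβ hζ hL).1]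
    refine EReal.le_of_forall_lt_iff_le.1 fun c hc => ?_
    obtain ⟨r, hr, hball⟩ := Metric.nhds_basis_closedBall.mem_iff.1
      (upperSemicontinuous_uscReg (interiorRate P (logWeight T g)) ζ c hc)
    refine EReal.coe_le_coe_iff.2 (le_of_forall_pos_le_add fun ε hε => ?_)
    refine le_of_tendsto hL ?_
    filter_upwards [hω.eventually_le_of_uscReg_lt ha hT.map_zero Metric.isClosed_closedBall
        (fun y hy => hball hy.1) hε,
      (hβ.tendsto_velocity hζ).eventually_mem (Metric.closedBall_mem_nhds ζ hr),
      eventually_ge_atTop 1] with n h1 h2 h3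
    rw [div_le_iff₀ (by exact_mod_cast h3), mul_comm]
    exact h1 _ (hβ.stepCount_roundedCounts hζ n) h2
  · rw [pointFreeEnergy, if_neg hζ]
    exact bot_le

lemma IsRegularAt.interiorRate_le_pointFreeEnergy (ζ : EuclideanSpace ℝ (Fin d)) :
    interiorRate P (logWeight T g) ζ ≤ pointFreeEnergy T g β b ω ζ := by
  refine le_of_forall_lt fun c hc => ?_
  obtain ⟨k, hk, rfl, hck⟩ := exists_of_lt_interiorRate hc
  rwa [(hω.tendsto_pointFreeEnergy hT hβ (velocity_mem (one_le_stepCount hk))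
    (hω.tendsto_roundedCounts_velocity ha hT.map_zero hβ hk)).1]

/-- The random point-to-point free energy has a nonrandom regularization. -/
lemma IsRegularAt.uscReg_pointFreeEnergy (ζ : EuclideanSpace ℝ (Fin d)) :
    uscReg (pointFreeEnergy T g β b ω) ζ = uscReg (interiorRate P (logWeight T g)) ζ :=
  le_antisymm
    (uscReg_le_of_le (upperSemicontinuous_uscReg _) (hω.pointFreeEnergy_le ha hT hβ))
    (uscReg_mono (hω.interiorRate_le_pointFreeEnergy ha hT hβ))

lemma IsRegularAt.tendsto_logRate_partitionFunction :
    Tendsto (fun n : ℕ => logRate n (partitionFunction T g ω n)) atTop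
      (𝓝 (⨆ ζ, uscReg (interiorRate P (logWeight T g)) ζ)) := by
  have h1 := hω.limsup_logRate_endpointWeight_le ha hT isClosed_univ
  have h2 := hω.iSup_le_liminf_logRate_endpointWeight ha hT hβ isOpen_univ
  simp only [endpointWeight_univ, mem_univ, iSup_pos] at h1 h2
  exact tendsto_of_le_liminf_of_limsup_le h2 h1

/-- The large deviation principle, with the rate function given by the nonrandom regularized
rate. -/
theorem IsRegularAt.satisfiesLDP {Λ : ℝ}
    (hΛ : ⨆ ζ, uscReg (interiorRate P (logWeight T g)) ζ = (Λ : EReal)) {c : ℝ}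
    (hF : IsConcaveOn (velocitySet R) (uscReg (interiorRate P (logWeight T g))) c Λ) :
    SatisfiesLDP (endpointLaw T g ω)
      fun ζ => (Λ : EReal) - uscReg (interiorRate P (logWeight T g)) ζ := by
  set F := uscReg (interiorRate P (logWeight T g))
  have hZ := hω.tendsto_logRate_partitionFunction ha hT hβ
  rw [hΛ] at hZ
  have hnegZ : Tendsto (fun n : ℕ => -logRate n (partitionFunction T g ω n)) atTop
      (𝓝 (-(Λ : EReal))) := (continuous_neg.tendsto _).comp hZ
  have hΛ1 : -(Λ : EReal) ≠ ⊥ := by rw [← EReal.coe_neg]; exact EReal.coe_ne_bot _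
  have hΛ2 : -(Λ : EReal) ≠ ⊤ := by rw [← EReal.coe_neg]; exact EReal.coe_ne_top _
  refine ⟨hF.sub_nonneg, hF.lowerSemicontinuous_sub, fun A hA => ?_, fun O hO => ?_⟩
  · have h1 : (fun n : ℕ => logRate n (endpointLaw T g ω n A)) =
        (fun n : ℕ => -logRate n (partitionFunction T g ω n)) +
          fun n : ℕ => logRate n (endpointWeight T g ω n A) := by
      funext n
      rw [endpointLaw_apply ω n hA.measurableSet, logRate_inv_mul, Pi.add_apply]
    have h2 := EReal.limsup_add_le (u := fun n : ℕ => -logRate n (partitionFunction T g ω n))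
      (v := fun n : ℕ => logRate n (endpointWeight T g ω n A)) (f := atTop)
      (Or.inl (by rwa [hnegZ.limsup_eq])) (Or.inl (by rwa [hnegZ.limsup_eq]))
    rw [hnegZ.limsup_eq] at h2
    rw [h1]
    refine h2.trans ((add_le_add le_rfl (hω.limsup_logRate_endpointWeight_le ha hT hA)).trans ?_)
    rw [add_comm, ← sub_eq_add_neg]
    refine EReal.sub_le_of_le_add (iSup₂_le fun ζ hζ => ?_)
    have h3 : -((Λ : EReal) - F ζ) ≤ -⨅ ζ ∈ A, ((Λ : EReal) - F ζ) :=
      EReal.neg_le_neg_iff.2 (iInf₂_le ζ hζ)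
    rw [EReal.neg_sub (Or.inl (EReal.coe_ne_bot _)) (Or.inl (EReal.coe_ne_top _)), add_comm,
      ← sub_eq_add_neg] at h3
    calc F ζ = F ζ - Λ + Λ := EReal.sub_add_cancel.symm
      _ ≤ _ := add_le_add h3 le_rfl
  · have h1 : (fun n : ℕ => logRate n (endpointLaw T g ω n O)) =
        (fun n : ℕ => -logRate n (partitionFunction T g ω n)) +
          fun n : ℕ => logRate n (endpointWeight T g ω n O) := by
      funext n
      rw [endpointLaw_apply ω n hO.measurableSet, logRate_inv_mul, Pi.add_apply]
    have h2 := EReal.le_liminf_add (u := fun n : ℕ => -logRate n (partitionFunction T g ω n))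
      (v := fun n : ℕ => logRate n (endpointWeight T g ω n O)) (f := atTop)
    rw [hnegZ.liminf_eq] at h2
    rw [h1]
    refine le_trans ?_ ((add_le_add le_rfl
      (hω.iSup_le_liminf_logRate_endpointWeight ha hT hβ hO)).trans h2)
    rw [EReal.neg_le]
    refine le_iInf₂ fun ζ hζ => ?_
    rw [add_comm, ← sub_eq_add_neg, EReal.neg_sub (Or.inr (EReal.coe_ne_bot _))
      (Or.inr (EReal.coe_ne_top _)), add_comm, ← sub_eq_add_neg]
    exact antitone_coe_sub Λ (le_iSup₂ (f := fun ζ (_ : ζ ∈ O) => F ζ) ζ hζ)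

omit hω in
/-- The nonrandom regularized rate is a concave function with compact effective domain. -/
theorem IsSuperadditiveField.exists_isConcaveOn [IsProbabilityMeasure P]
    (hup : ∀ᵐ ω ∂P, LinearlyBoundedAbove (logWeight T g) ω) :
    ∃ Λ c : ℝ, ⨆ ζ, uscReg (interiorRate P (logWeight T g)) ζ = (Λ : EReal) ∧
      IsConcaveOn (velocitySet R) (uscReg (interiorRate P (logWeight T g))) c Λ := by
  set F := uscReg (interiorRate P (logWeight T g))
  obtain ⟨ω, hω⟩ := (ha.ae_isRegularAt hT hup).exists
  obtain ⟨C, hC⟩ := ha.exists_velocityRate_le hT hup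
  set c : ℝ := -∫ ω, stepCost g ω ∂P
  have hge : ∀ ζ ∈ velocitySet R, (c : EReal) ≤ F ζ := by
    intro ζ hζ
    by_contra hlt
    obtain ⟨B, hB, hmem, hB'⟩ := exists_open_of_uscReg_lt (not_le.1 hlt)
    obtain ⟨k, hk, hkB⟩ := hω.exists_velocity_mem ha hT.map_zero hβ hζ hB hmem
    have h1 := (le_interiorRate (P := P) (a := logWeight T g) hk).trans_lt (hB' _ hkB)
    exact absurd (ha.neg_le_velocityRate hT hup hk) (not_le.2 (EReal.coe_lt_coe_iff.1 h1))
  have hle : ∀ ζ, F ζ ≤ C := fun ζ => by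
    refine uscReg_le_of_le (g := fun _ => (C : EReal)) upperSemicontinuous_const fun y => ?_
    exact iSup_le fun k => iSup_le fun hk => iSup_le fun _ => EReal.coe_le_coe_iff.2 (hC k hk)
  have hmem : velocity (1 : R → ℕ) ∈ velocitySet R :=
    velocity_mem (one_le_stepCount fun _ => le_rfl)
  have hΛ : ⨆ ζ, F ζ = ((⨆ ζ, F ζ).toReal : EReal) :=
    (EReal.coe_toReal (ne_top_of_le_ne_top (EReal.coe_ne_top C) (iSup_le hle))
      (ne_bot_of_le_ne_bot (EReal.coe_ne_bot c) ((hge _ hmem).trans (le_iSup F _)))).symm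
  refine ⟨(⨆ ζ, F ζ).toReal, c, hΛ, upperSemicontinuous_uscReg _, fun ζ hζ => ?_, hge,
    fun ζ => hΛ ▸ le_iSup F ζ, fun x y s t hs ht hst c₁ c₂ hx hy =>
      ha.interiorRate_concave hT hup x y hs ht hst hx hy⟩
  refine le_bot_iff.1 ((uscReg_le_iSup
    (isCompact_velocitySet (R := R)).isClosed.isOpen_compl hζ).trans (iSup₂_le fun y hy => ?_))
  refine iSup_le fun k => iSup_le fun hk => iSup_le fun hky => ?_
  exact absurd (hky ▸ velocity_mem (one_le_stepCount hk)) hy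

end LargeDeviations

end RWRP

end

theorem mainTheorem5 {d : ℕ} (R : Finset (Fin d → ℤ)) (hR : R.Nonempty)
    {Ω : Type*} [MeasurableSpace Ω] (P : Measure Ω) [IsProbabilityMeasure P]
    (T : RWRP.LatticeGroup R → Ω → Ω) (hT : RWRP.IsErgodicSystem R P T)
    (β : EuclideanSpace ℝ (Fin d) → R → ℝ) (b : ℕ → EuclideanSpace ℝ (Fin d) → R → ℕ)
    (hβ : RWRP.IsVelocityChoice R β b)
    (ℓ : ℕ) (g : Ω × (Fin ℓ → R) → ℝ) (hgm : Measurable g) (hg : RWRP.InClassL P T g)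
    (hfin : ∀ᵐ ω ∂P, RWRP.freeEnergy T g ω ≠ ⊥ ∧ RWRP.freeEnergy T g ω ≠ ⊤) :
    ∃ (Λ : ℝ) (I : EuclideanSpace ℝ (Fin d) → EReal),
      (∀ᵐ ω ∂P,
        Tendsto (fun n : ℕ => RWRP.logRate n (RWRP.partitionFunction T g ω n)) atTop
          (𝓝 (Λ : EReal)) ∧
        (∀ ζ ∈ RWRP.velocitySet R,
          Tendsto (fun n : ℕ => RWRP.logRate n
            (RWRP.pointPartitionFunction T g ω n (RWRP.latticePoint β b n ζ))) atTop
            (𝓝 (RWRP.pointFreeEnergy T g β b ω ζ))) ∧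
        (∀ ζ, I ζ = (Λ : EReal) - RWRP.uscReg (RWRP.pointFreeEnergy T g β b ω) ζ) ∧
        RWRP.SatisfiesLDP (RWRP.endpointLaw T g ω) I) ∧
      (∀ ζ, 0 ≤ I ζ) ∧
      RWRP.IsConvexFun I ∧
      (∀ ζ ∈ RWRP.velocitySet R, I ζ ≠ ⊤) ∧
      ContinuousOn I (RWRP.velocitySet R) := by
  have : Nonempty R := hR.to_subtype
  have ha := hg.isSuperadditiveField hgm hT
  have hup : ∀ᵐ ω ∂P, RWRP.LinearlyBoundedAbove (RWRP.logWeight T g) ω := by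
    filter_upwards [hfin] with ω hω
    exact RWRP.linearlyBoundedAbove_logWeight hT.map_zero hT.map_add hω.2
  obtain ⟨Λ, c, hΛ, hF⟩ := ha.exists_isConcaveOn hT hβ hup
  refine ⟨Λ, fun ζ => (Λ : EReal) - RWRP.uscReg (RWRP.interiorRate P (RWRP.logWeight T g)) ζ,
    ?_, hF.sub_nonneg, hF.isConvexFun_sub (convex_convexHull ℝ _), fun ζ => hF.sub_ne_top, ?_⟩
  · filter_upwards [ha.ae_isRegularAt hT hup] with ω hω
    refine ⟨hΛ ▸ hω.tendsto_logRate_partitionFunction ha hT hβ, fun ζ hζ => ?_, fun ζ => ?_,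
      hω.satisfiesLDP ha hT hβ hΛ hF⟩
    · obtain ⟨L, hL⟩ := hω.exists_tendsto_roundedCounts ha hT hβ hζ
      obtain ⟨h1, h2⟩ := hω.tendsto_pointFreeEnergy hT hβ hζ hL
      rwa [h1]
    · rw [hω.uscReg_pointFreeEnergy ha hT hβ]
  · rw [RWRP.velocitySet_eq_range] at hF ⊢
    exact hF.continuousOn_sub
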